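/- **Conventions.** Let $k$ be a field. Modules are finitely generated left modules, $|M|$ is the length, $\operatorname{pd}$ the projective dimension; an indecomposable module is odd (even) if its projective dimension is odd (even). A *linear Nakayama algebra* is (up to isomorphism) the path algebra over $k$ of the linearly oriented quiver $\mathbb A_n$, $n\ge 1$, modulo an admissible ideal, say with simple modules $S_1,\dots,S_n$, where $S_1$ is projective, $\omega_A=S_n$ is injective, and the indecomposable projective module $P(S_i)$ has the composition factors $S_i,S_{i-1},\dots$ (from the top). It is *concave* if its Kupisch series $(|P(S_1)|,\dots,|P(S_n)|)$ first increases and then decreases (weakly), and *ascending* if $|P|\le|P'|$ for all indecomposable projective $P,P'$ with $\operatorname{Hom}(P,P')\ne0$. The *height* is the maximal length of an indecomposable module; an indecomposable module of that length is a *summit*. A *higher Auslander algebra of global dimension $d$* is an algebra whose global and dominant dimension are both equal to $d$. For an indecomposable module $M$ with composition series $0=M_0\subset\cdots\subset M_m=M$ let $\operatorname{char}M=(z_1,\dots,z_m)$, where $z_i=\operatorname{pd}(M_i/M_{i-1})$ if this number is odd, and $z_i=\operatorname{pd}M$ otherwise. An indecomposable module $M$ is *plus-strictly-increasing* if $\operatorname{char}M=(e,c_2,\dots,c_m)$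 with $e$ even, the $c_i$ odd, and $c_2<\dots<c_m<e$; it is *minus-strictly-increasing* if $\operatorname{char}M=(c_1,\dots,c_{m-1},e)$ with $e$ even, the $c_i$ odd, and $e-1<c_1<\dots<c_{m-1}$. A simple module $S$ is *$d$-closed* if it is torsionless (a submodule of a projective module) or the socle of a module $M$ with $\operatorname{pd}M\ge d$. An algebra is *$d$-closed* if all its simple modules are, and *$d$-bound* if moreover its global dimension is at most $d$. For a linear Nakayama algebra $A$, let $U$ be the maximal submodule of $P(\omega_A)$ all of whose composition factors are $d$-closed, and $Y_A=P(\omega_A)/U$. The *partial $d$-closure* $C_d(A)$ is obtained from $A$ by repeatedly replacing $A$ by the one-point extension $A[Y_A]$ until $Y_A=0$. For a sequence $\mathbf z$ of non-negative integers with exactly one entry $0$ and all others odd, $A(\mathbf z)$ denotes the (unique up to isomorphism) ascending linear Nakayama algebra with $\operatorname{char}P(\omega_{A(\mathbf z)})=\mathbf z$. **Proposition 8.6.** Let $d$ be even and $m\ge2$. Let $A$ be a concave Nakayama algebra of height $m+1$ which is $d$-bound. The following assertions are equivalent: * (1) $A$ is a higher Auslander algebra of global dimension $d$. * (2) $A$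 has a plus-strictly-increasing module $Y$ of length $m$ with $\operatorname{pd}(\operatorname{soc}_2Y/\operatorname{soc}Y)=1$. * (2$'$) $A$ has a plus-strictly-increasing module $Y'$ of length $m$. * (2$''$) $A$ has a plus-strictly-increasing module $Y''$ of length $m$ which is injective. * (3) $A$ has a minus-strictly-increasing module $R$ of length $m$ which is the radical of a summit and which is projective. * (3$'$) $A$ has a minus-strictly-increasing module $R'$ of length $m$ which is the radical of a summit. * (3$''$) $A$ has a minus-strictly-increasing module $R''$ of length $m$ which is the radical of a summit and satisfies $\operatorname{pd}\operatorname{top}R''=d$. * (4) $A\cong C_dA(c_1,\dots,c_{m-1},0,1)$ with odd numbers $c_i$ such that $c_1<c_2<\dots<c_{m-1}<d$. There is also the following condition: * (5) $A$ has an odd indecomposable module $N$ of length $m$ such that $\operatorname{char}N$ is strictly increasing. It implies the equivalent conditions (1) to (4), but the converse is not true: over every field $k$ there are an even $d$, an $m\ge2$, and a $d$-bound concave Nakayama algebra $A$ of height $m+1$ satisfying (1) but not (5). -/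

import Mathlib

universe u

namespace Nakayama

/-! ### Modules over a ring

All modules over a ring `A : Type u` are left modules living in `Type u`; every finitely generated
module has an isomorphic copy there. For the finite-dimensional algebras below, finitely generated
means of finite length. -/

section Modules

variable (A : Type u) [Ring A]

/-- Projective dimension of a module (Mathlib's, in `WithBot ℕ∞`; the zero module has `⊥`). -/
noncomputable def pd (M : Type u) [AddCommGroup M] [Module A M] : WithBot ℕ∞ :=
  CategoryTheory.projectiveDimension (ModuleCat.of A M)

/-- An odd module: its projective dimension is an odd natural number. -/
def IsOddModule (M : Type u) [AddCommGroup M] [Module A M] : Prop :=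
  ∃ e : ℕ, Odd e ∧ pd A M = ((e : ℕ∞) : WithBot ℕ∞)

/-- Global dimension: the supremum of the projective dimensions of the finitely generated modules. -/
noncomputable def gldim : WithBot ℕ∞ :=
  ⨆ M : {M : ModuleCat.{u} A // Module.Finite A M}, pd A M.1

/-- Indecomposable (finitely generated) modules. -/
def IsIndec (M : Type u) [AddCommGroup M] [Module A M] : Prop :=
  Module.Finite A M ∧ CategoryTheory.Indecomposable (ModuleCat.of A M)

/-- A torsionless module: a submodule of a projective module. -/
def IsTorsionless (M : Type u) [AddCommGroup M] [Module A M] : Prop :=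
  ∃ (P : ModuleCat.{u} A) (f : M →ₗ[A] P), Module.Projective A P ∧ Function.Injective f

/-- The socle: the sum of all simple submodules. -/
def socle (M : Type u) [AddCommGroup M] [Module A M] : Submodule A M :=
  sSup {N : Submodule A M | IsSimpleModule A N}

/-- The radical of a module: the intersection of its maximal submodules. -/
abbrev rad (M : Type u) [AddCommGroup M] [Module A M] : Submodule A M :=
  Module.jacobson A M

/-- The top of a module. -/
abbrev top (M : Type u) [AddCommGroup M] [Module A M] : Type u :=
  M ⧸ rad A M

variable {A} in
/-- `f` is an injective envelope: an essential embedding into an injective module. -/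
def IsInjectiveEnvelope {M I : Type u} [AddCommGroup M] [Module A M] [AddCommGroup I] [Module A I]
    (f : M →ₗ[A] I) : Prop :=
  Module.Injective A I ∧ Function.Injective f ∧
    ∀ N : Submodule A I, N ⊓ LinearMap.range f = ⊥ → N = ⊥

variable {A} in
/-- `f` is a projective cover: a surjection from a projective module with superfluous kernel. -/
def IsProjectiveCover {P M : Type u} [AddCommGroup P] [Module A P] [AddCommGroup M] [Module A M]
    (f : P →ₗ[A] M) : Prop :=
  Module.Projective A P ∧ Function.Surjective f ∧
    ∀ N : Submodule A P, N ⊔ LinearMap.ker f = ⊤ → N = ⊤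

/-- The first `n` terms `I₀, …, I_{n-1}` of a minimal injective coresolution of `M` are
projective. -/
def DomDimGE : ℕ → ModuleCat.{u} A → Prop
  | 0, _ => True
  | n + 1, M => ∃ (I : ModuleCat.{u} A) (f : M →ₗ[A] I), IsInjectiveEnvelope f ∧
      Module.Projective A I ∧ DomDimGE n (ModuleCat.of A (I ⧸ LinearMap.range f))

/-- The dominant dimension of `A`. -/
noncomputable def domdim : ℕ∞ :=
  ⨆ (n : ℕ) (_ : DomDimGE A n (ModuleCat.of A A)), (n : ℕ∞)

/-- `A` is a higher Auslander algebra of global dimension `d`: global dimension and dominant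
dimension coincide, and are equal to `d`. -/
def IsHigherAuslander (d : ℕ) : Prop :=
  gldim A = (domdim A : WithBot ℕ∞) ∧ gldim A = ((d : ℕ∞) : WithBot ℕ∞)

/-- `h` is the height of `A`: the maximal length of an indecomposable module. -/
def HasHeight (h : ℕ) : Prop :=
  IsGreatest {l : ℕ∞ | ∃ M : ModuleCat.{u} A, IsIndec A M ∧ Module.length A M = l} h

/-- A summit: an indecomposable module of maximal length. -/
def IsSummit (P : Type u) [AddCommGroup P] [Module A P] : Prop :=
  IsIndec A P ∧ ∀ M : ModuleCat.{u} A, IsIndec A M → Module.length A M ≤ Module.length A P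

/-- `R` is (isomorphic to) the radical of a summit. -/
def IsSummitRadical (R : Type u) [AddCommGroup R] [Module A R] : Prop :=
  ∃ P : ModuleCat.{u} A, IsSummit A P ∧ Nonempty (R ≃ₗ[A] rad A P)

/-- The characteristic of `M` is `z = (z₁, …, z_m)`: for a composition series
`0 = M₀ ⊂ ⋯ ⊂ M_m = M` with factors `F_i = M_i / M_{i-1}`, the number `z_i` is the projective
dimension of `F_i` if `F_i` is odd, and that of `M` otherwise. (Used for uniserial `M`, where the
composition series is unique.) -/
def HasChar (M : Type u) [AddCommGroup M] [Module A M] (z : List ℕ) : Prop :=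
  ∃ N : Fin (z.length + 1) → Submodule A M,
    N 0 = ⊥ ∧ N (Fin.last z.length) = ⊤ ∧
    ∀ i : Fin z.length, N i.castSucc ⋖ N i.succ ∧
      (IsOddModule A (N i.succ ⧸ (N i.castSucc).submoduleOf (N i.succ)) →
        (((z.get i : ℕ) : ℕ∞) : WithBot ℕ∞) =
          pd A (N i.succ ⧸ (N i.castSucc).submoduleOf (N i.succ))) ∧
      (¬ IsOddModule A (N i.succ ⧸ (N i.castSucc).submoduleOf (N i.succ)) →
        (((z.get i : ℕ) : ℕ∞) : WithBot ℕ∞) = pd A M)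

/-- Plus-strictly-increasing: indecomposable, with characteristic `(e, c₂, …, c_m)`, where `e` is
even and `c₂ < ⋯ < c_m < e` with all `c_i` odd. -/
def IsPlusStrictlyIncreasing (M : Type u) [AddCommGroup M] [Module A M] : Prop :=
  IsIndec A M ∧ ∃ (e : ℕ) (c : List ℕ), HasChar A M (e :: c) ∧ Even e ∧ (∀ x ∈ c, Odd x) ∧
    (c ++ [e]).Pairwise (· < ·)

/-- Minus-strictly-increasing: indecomposable, with characteristic `(c₁, …, c_{m-1}, e)`, where
`e` is even and `e - 1 < c₁ < ⋯ < c_{m-1}` (as integers) with all `c_i` odd. -/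
def IsMinusStrictlyIncreasing (M : Type u) [AddCommGroup M] [Module A M] : Prop :=
  IsIndec A M ∧ ∃ (e : ℕ) (c : List ℕ), HasChar A M (c ++ [e]) ∧ Even e ∧ (∀ x ∈ c, Odd x) ∧
    (((e : ℤ) - 1) :: c.map (fun x : ℕ => (x : ℤ))).Pairwise (· < ·)

/-- `S` is a composition factor of `M`. -/
def IsCompositionFactor (S M : Type u) [AddCommGroup S] [Module A S] [AddCommGroup M]
    [Module A M] : Prop :=
  IsSimpleModule A S ∧ ∃ V W : Submodule A M, V ≤ W ∧
    Nonempty ((W ⧸ V.submoduleOf W) ≃ₗ[A] S)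

/-- A `d`-closed simple module `S`: it is torsionless, or the socle of a module of projective
dimension at least `d`. -/
def IsDClosedSimple (d : ℕ) (S : Type u) [AddCommGroup S] [Module A S] : Prop :=
  IsTorsionless A S ∨ ∃ M : ModuleCat.{u} A, Module.Finite A M ∧
    Nonempty (socle A M ≃ₗ[A] S) ∧ ((d : ℕ∞) : WithBot ℕ∞) ≤ pd A M

/-- `A` is `d`-closed: all simple modules are. -/
def IsDClosed (d : ℕ) : Prop :=
  ∀ S : ModuleCat.{u} A, IsSimpleModule A S → IsDClosedSimple A d S

/-- `A` is `d`-bound: of global dimension at most `d` and `d`-closed. -/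
def IsDBound (d : ℕ) : Prop :=
  gldim A ≤ ((d : ℕ∞) : WithBot ℕ∞) ∧ IsDClosed A d

/-- `P` is the projective cover of a simple injective module. Linear Nakayama algebras have exactly
one simple injective module `ω`, and this says `P = P(ω)`. -/
def IsPOmega (P : Type u) [AddCommGroup P] [Module A P] : Prop :=
  ∃ (W : ModuleCat.{u} A) (f : P →ₗ[A] W),
    IsSimpleModule A W ∧ Module.Injective A W ∧ IsProjectiveCover f

/-- All composition factors of `M` are `d`-closed. -/
def HasDClosedFactors (d : ℕ) (M : Type u) [AddCommGroup M] [Module A M] : Prop :=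
  ∀ S : ModuleCat.{u} A, IsCompositionFactor A S M → IsDClosedSimple A d S

/-- `A` is partially `d`-closed: all composition factors of `P(ω)` are `d`-closed. -/
def IsPartiallyDClosed (d : ℕ) : Prop :=
  ∃ P : ModuleCat.{u} A, IsPOmega A P ∧ HasDClosedFactors A d P

/-- `Y` is the `d`-cliff module `P(ω) / U`, where `U` is the maximal submodule of `P(ω)` all of
whose composition factors are `d`-closed. -/
def IsDCliffModule (d : ℕ) (Y : Type u) [AddCommGroup Y] [Module A Y] : Prop :=
  ∃ (P : ModuleCat.{u} A) (U : Submodule A P), IsPOmega A P ∧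
    Maximal (fun V : Submodule A P => HasDClosedFactors A d V) U ∧ Nonempty (Y ≃ₗ[A] P ⧸ U)

end Modules

/-! ### Linear Nakayama algebras -/

/-- Upper triangular `n × n` matrices: the path algebra of the linearly oriented quiver `𝔸_n`,
the matrix unit `(i, j)` with `i ≤ j` being the path between the vertices `i` and `j`. -/
def upperTriangular (k : Type u) [Field k] (n : ℕ) : Subalgebra k (Matrix (Fin n) (Fin n) k) where
  carrier := {x | ∀ i j : Fin n, j < i → x i j = 0}
  mul_mem' := by
    intro x y hx hy i j hij
    rw [Matrix.mul_apply]
    refine Finset.sum_eq_zero fun l _ => ?_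
    by_cases h : l < i
    · rw [hx i l h, zero_mul]
    · rw [hy l j (lt_of_lt_of_le hij (not_lt.mp h)), mul_zero]
  add_mem' := by
    intro x y hx hy i j hij
    rw [Matrix.add_apply, hx i j hij, hy i j hij, add_zero]
  algebraMap_mem' := by
    intro r i j hij
    rw [Matrix.algebraMap_matrix_apply, if_neg (ne_of_gt hij)]

/-- The idempotent (path of length zero) at the vertex `i`. -/
def idem (k : Type u) [Field k] {n : ℕ} (i : Fin n) : upperTriangular k n :=
  ⟨Matrix.single i i 1, by
    intro a b hab
    refine Matrix.single_apply_of_ne _ _ _ _ _ ?_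
    rintro ⟨rfl, rfl⟩
    exact lt_irrefl _ hab⟩

/-- A presentation of `A` as a linear Nakayama algebra: `A` is the path algebra of the linearly
oriented quiver `𝔸_n` (`n ≥ 1`) modulo an admissible ideal, that is, an ideal spanned by linear
combinations of paths of length at least two. -/
structure LinearNakayama (k A : Type u) [Field k] [Ring A] [Algebra k A] where
  n : ℕ
  pos : 0 < n
  proj : upperTriangular k n →ₐ[k] A
  surjective : Function.Surjective proj
  admissible : ∀ x : upperTriangular k n, proj x = 0 →
    ∀ i j : Fin n, (j : ℕ) ≤ (i : ℕ) + 1 → x.1 i j = 0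

/-- The Kupisch series: the lengths of the indecomposable projective left modules `A e_i`. -/
noncomputable def LinearNakayama.kupisch {k A : Type u} [Field k] [Ring A] [Algebra k A]
    (N : LinearNakayama k A) (i : Fin N.n) : ℕ∞ :=
  Module.length A (Submodule.span A {N.proj (idem k i)})

/-- A concave Nakayama algebra: a linear Nakayama algebra whose Kupisch series first increases,
then decreases (both in the weak sense). -/
def IsConcave (k A : Type u) [Field k] [Ring A] [Algebra k A] : Prop :=
  ∃ (N : LinearNakayama k A) (p : Fin N.n),
    MonotoneOn N.kupisch (Set.Iic p) ∧ AntitoneOn N.kupisch (Set.Ici p)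

/-- An ascending Nakayama algebra: a linear Nakayama algebra with `|P| ≤ |P'|` for all
indecomposable projective modules `P`, `P'` with `Hom(P, P') ≠ 0`. -/
def IsAscending (k A : Type u) [Field k] [Ring A] [Algebra k A] : Prop :=
  Nonempty (LinearNakayama k A) ∧ ∀ P P' : ModuleCat.{u} A,
    IsIndec A P → Module.Projective A P → IsIndec A P' → Module.Projective A P' →
    (∃ f : P →ₗ[A] P', f ≠ 0) → Module.length A P ≤ Module.length A P'

/-- `A` is the ascent algebra `A(z)`: the ascending Nakayama algebra (unique up to isomorphism)
such that `P(ω)` has characteristic `z`. -/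
def IsAscentAlgebra (k A : Type u) [Field k] [Ring A] [Algebra k A] (z : List ℕ) : Prop :=
  IsAscending k A ∧ ∃ P : ModuleCat.{u} A, IsPOmega A P ∧ HasChar A P z

/-! ### One-point extensions and the partial `d`-closure -/

/-- The one-point extension `A[M]`: matrices `(a, m; 0, c)` with `a ∈ A`, `m ∈ M`, `c ∈ k`. -/
@[ext]
structure OnePointExt (k A M : Type u) where
  base : A
  vec : M
  scal : k

namespace OnePointExt

set_option linter.unusedSectionVars false

variable {k A M : Type u} [Field k] [Ring A] [Algebra k A] [AddCommGroup M] [Module A M]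

instance : Zero (OnePointExt k A M) := ⟨⟨0, 0, 0⟩⟩
instance : One (OnePointExt k A M) := ⟨⟨1, 0, 1⟩⟩
instance : Add (OnePointExt k A M) :=
  ⟨fun x y => ⟨x.base + y.base, x.vec + y.vec, x.scal + y.scal⟩⟩
instance : Neg (OnePointExt k A M) := ⟨fun x => ⟨-x.base, -x.vec, -x.scal⟩⟩
instance : Mul (OnePointExt k A M) :=
  ⟨fun x y => ⟨x.base * y.base, x.base • y.vec + algebraMap k A y.scal • x.vec,
    x.scal * y.scal⟩⟩

@[simp] theorem zero_base : (0 : OnePointExt k A M).base = 0 := rfl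
@[simp] theorem zero_vec : (0 : OnePointExt k A M).vec = 0 := rfl
@[simp] theorem zero_scal : (0 : OnePointExt k A M).scal = 0 := rfl
@[simp] theorem one_base : (1 : OnePointExt k A M).base = 1 := rfl
@[simp] theorem one_vec : (1 : OnePointExt k A M).vec = 0 := rfl
@[simp] theorem one_scal : (1 : OnePointExt k A M).scal = 1 := rfl
@[simp] theorem add_base (x y : OnePointExt k A M) : (x + y).base = x.base + y.base := rfl
@[simp] theorem add_vec (x y : OnePointExt k A M) : (x + y).vec = x.vec + y.vec := rfl
@[simp] theorem add_scal (x y : OnePointExt k A M) : (x + y).scal = x.scal + y.scal := rfl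
@[simp] theorem neg_base (x : OnePointExt k A M) : (-x).base = -x.base := rfl
@[simp] theorem neg_vec (x : OnePointExt k A M) : (-x).vec = -x.vec := rfl
@[simp] theorem neg_scal (x : OnePointExt k A M) : (-x).scal = -x.scal := rfl
@[simp] theorem mul_base (x y : OnePointExt k A M) : (x * y).base = x.base * y.base := rfl
@[simp] theorem mul_vec (x y : OnePointExt k A M) :
    (x * y).vec = x.base • y.vec + algebraMap k A y.scal • x.vec := rfl
@[simp] theorem mul_scal (x y : OnePointExt k A M) : (x * y).scal = x.scal * y.scal := rfl

instance : Ring (OnePointExt k A M) :=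
  Ring.ofMinimalAxioms
    (fun x y z => by ext <;> simp [add_assoc])
    (fun x => by ext <;> simp)
    (fun x => by ext <;> simp)
    (fun x y z => by
      ext
      · simp [mul_assoc]
      · simp only [mul_vec, mul_base, mul_scal, smul_add, smul_smul, map_mul, add_assoc]
        rw [Algebra.commutes z.scal x.base, ← map_mul, ← map_mul, mul_comm z.scal y.scal]
      · simp [mul_assoc])
    (fun x => by ext <;> simp)
    (fun x => by ext <;> simp)
    (fun x y z => by
      ext
      · simp [mul_add]
      · simp only [mul_vec, add_vec, add_scal, smul_add, map_add, add_smul]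
        abel
      · simp [mul_add])
    (fun x y z => by
      ext
      · simp [add_mul]
      · simp only [mul_vec, add_vec, add_base, smul_add, add_smul]
        abel
      · simp [add_mul])

/-- The structure map `k → A[M]`, sending `c` to the scalar matrix. -/
def scalarHom : k →+* OnePointExt k A M where
  toFun c := ⟨algebraMap k A c, 0, c⟩
  map_one' := by ext <;> simp
  map_mul' x y := by ext <;> simp
  map_zero' := by ext <;> simp
  map_add' x y := by ext <;> simp

instance : Algebra k (OnePointExt k A M) :=
  scalarHom.toAlgebra' fun c x => by
    ext
    · simpa [scalarHom] using Algebra.commutes c x.base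
    · simp [scalarHom]
    · simpa [scalarHom] using mul_comm c x.scal

end OnePointExt

/-- `E` is the `d`-cliff extension `A[Y]` of `A`, where the `d`-cliff module `Y` of `A` is
non-zero. -/
def IsCliffExtension (k : Type u) [Field k] (d : ℕ) (A E : AlgCat.{u} k) : Prop :=
  ∃ Y : ModuleCat.{u} A, IsDCliffModule A d Y ∧ Nontrivial Y ∧
    Nonempty (E ≃ₐ[k] OnePointExt k A Y)

/-- `C` is (isomorphic to) the partial `d`-closure `C_d(A)` of `A`: it is obtained from `A` by
iterating the `d`-cliff extension until the algebra is partially `d`-closed (equivalently, until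
the `d`-cliff module is zero). -/
inductive IsPartialClosure (k : Type u) [Field k] (d : ℕ) : AlgCat.{u} k → AlgCat.{u} k → Prop
  | closed {A C : AlgCat.{u} k} : IsPartiallyDClosed A d → Nonempty (C ≃ₐ[k] A) →
      IsPartialClosure k d A C
  | step {A E C : AlgCat.{u} k} : IsCliffExtension k d A E → IsPartialClosure k d E C →
      IsPartialClosure k d A C

/-- `A` is isomorphic to `C_d A(z)`. -/
def IsClosureOfAscent (k : Type u) [Field k] (d : ℕ) (z : List ℕ) (A : AlgCat.{u} k) : Prop :=
  ∃ B : AlgCat.{u} k, IsAscentAlgebra k B z ∧ IsPartialClosure k d B A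

/-- `A` has an odd indecomposable module of length `m` with strictly increasing characteristic. -/
def HasStrictlyIncreasingModule (A : Type u) [Ring A] (m : ℕ) : Prop :=
  ∃ N : ModuleCat.{u} A, IsIndec A N ∧ IsOddModule A N ∧ Module.length A N = m ∧
    ∃ z : List ℕ, HasChar A N z ∧ z.Pairwise (· < ·)

end Nakayama

/-! Number the vertices `0, …, n - 1` and let `L b` be the socle of the projective module with top
`b - 1`. The indecomposable modules are the intervals `[a, b)` with `L b ≤ a < b ≤ n`. The
projective cover of `[a, b)` is `[L b, b)`, so its syzygy is `[L b, a)`, and its injective envelope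
is `[a, rightEnd a)`. Projective dimension, characteristics and dominant dimension thus become
statements about the monotone function `L`. Concavity says that `L` climbs in steps of at most 1
below a summit and of at least 1 above it. Below a summit a simple module at `u > 0` has projective
dimension 1, or its second syzygy is the simple module at `L u` (`pdS_cases`).

A plus-strictly-increasing module `[p, p + m)` and the minus-strictly-increasing radical `[p - m +
1, p + 1)` share exactly the even vertex `p`, and each determines the other
(`exists_isMinus_of_isPlus`, `isPlus_of_isMinus`). Applying `L` moves such a window down and lowers
all projective dimensions by two, until the top of the summit has projective dimension 1 and the
radical is projective (`exists_isMinus_last_eq_one`). By `d`-closedness the window can also be moved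
up, until its even vertex has projective dimension `d` (`exists_isMinus_even_eq`); then the
plus-strictly-increasing module is injective.

An injective module of this kind gives dominant dimension `d`: a first non-projective term in the
coresolution of a projective module would, by `d`-closedness, come with a module of projective
dimension `d` on the same socle, and the monotone odd entries exclude this
(`domDimInterval_of_isPlus`). Conversely, for a higher Auslander algebra the
plus-strictly-increasing module starts at the first vertex above the socle of a summit which is not
the socle of a projective module (`exists_isPlus_of_domDimInterval`). Its entries increase because
two adjacent odd vertices in the wrong order could be pushed up by `rightEnd` until the projective
dimension exceeds `d` (`pdS_lt_of_consecutive`).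

For the description as a partial closure, being `d`-bound forces the values of `L` above a summit:
the next value is the first vertex that is not yet `d`-closed, which is precisely what the cliff
extension produces (`isPartialClosure`). Conversely, restriction along the surjection from the
closure to the ascent algebra preserves projective dimension, hence also the characteristic of
`P(ω)`. An odd module with increasing characteristic yields a plus-strictly-increasing module one
vertex lower (`exists_isPlus_of_odd`). -/

namespace Nakayama

/-! ### Combinatorics of Kupisch functions -/

/-- `L b` is the socle of the indecomposable projective module with top `b - 1`. -/
structure IsKupisch (L : ℕ → ℕ) : Prop where
  mono : Monotone L
  one : L 1 = 0
  add_two_le : ∀ b, 2 ≤ b → L b + 2 ≤ b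

/-- The projective dimension of the interval module with vertices `a, …, b - 1`. -/
def pdI (L : ℕ → ℕ) (a b : ℕ) : ℕ :=
  if h : L b < a ∧ a < b then 1 + pdI L (L b) a else 0
termination_by b
decreasing_by exact h.2

/-- The projective dimension of the simple module at the vertex `u`. -/
def pdS (L : ℕ → ℕ) (u : ℕ) : ℕ := pdI L u (u + 1)

/-- The interval module with socle `a` which is injective has the vertices `a, …, rightEnd - 1`. -/
def rightEnd (n : ℕ) (L : ℕ → ℕ) (a : ℕ) : ℕ := Nat.findGreatest (fun b => L b ≤ a) n

section

variable {L : ℕ → ℕ}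

theorem pdI_step {a b : ℕ} (h : L b < a) (h' : a < b) : pdI L a b = 1 + pdI L (L b) a := by
  rw [pdI, dif_pos ⟨h, h'⟩]

theorem pdI_eq_zero {a b : ℕ} (h : a ≤ L b) : pdI L a b = 0 := by
  rw [pdI, dif_neg (by omega)]

theorem lt_of_pdI_pos {a b : ℕ} (h : 0 < pdI L a b) : L b < a ∧ a < b := by
  by_contra hc
  rw [pdI, dif_neg hc] at h
  exact lt_irrefl _ h

namespace IsKupisch

theorem zero (hL : IsKupisch L) : L 0 = 0 := by
  have := hL.mono (Nat.zero_le 1)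
  have := hL.one
  omega

theorem lt (hL : IsKupisch L) {b : ℕ} (hb : 0 < b) : L b < b := by
  rcases Nat.lt_or_ge b 2 with h | h
  · obtain rfl : b = 1 := by omega
    simp [hL.one]
  · have := hL.add_two_le b h
    omega

theorem succ_lt (hL : IsKupisch L) {u : ℕ} (hu : 0 < u) : L (u + 1) < u := by
  have := hL.add_two_le (u + 1) (by omega)
  omega

theorem _root_.Nakayama.pdI_of_eq {a b : ℕ} (h : L b < a) (h' : a < b) (he : L a = L b) :
    pdI L a b = 1 := by
  rw [pdI_step h h', pdI_eq_zero he.ge]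

theorem _root_.Nakayama.pdI_of_lt {a b : ℕ} (h : L b < a) (h' : a < b) (he : L a < L b) :
    pdI L a b = 2 + pdI L (L a) (L b) := by
  rw [pdI_step h h', pdI_step he h]
  omega

theorem _root_.Nakayama.pdS_zero : pdS L 0 = 0 := by
  rw [pdS, pdI_eq_zero (Nat.zero_le _)]

/-- The syzygy of the simple module at `u` is `[L (u + 1), u)`. It is projective if `L` does not
move at `u`; if `L` moves by one, the next syzygy is the single vertex `L u`. This two-step
recursion drives all arguments below a summit. -/
theorem pdS_cases (hL : IsKupisch L) {u : ℕ} (hu : 0 < u) (h : L (u + 1) ≤ L u + 1) :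
    (L (u + 1) = L u ∧ pdS L u = 1) ∨ (L (u + 1) = L u + 1 ∧ pdS L u = 2 + pdS L (L u)) := by
  have h1 := hL.mono (Nat.le_succ u)
  rcases Nat.lt_or_ge (L u) (L (u + 1)) with h2 | h2
  · right
    have h3 : L (u + 1) = L u + 1 := by omega
    refine ⟨h3, ?_⟩
    rw [pdS, pdI_of_lt (hL.succ_lt hu) (by omega) h2, h3, pdS]
  · left
    have h3 : L (u + 1) = L u := by have := h1; simp only [Nat.succ_eq_add_one] at this; omega
    exact ⟨h3, by rw [pdS, pdI_of_eq (hL.succ_lt hu) (by omega) h3.symm]⟩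

theorem pdS_pos (hL : IsKupisch L) {u : ℕ} (hu : 0 < u) : 0 < pdS L u := by
  rw [pdS, pdI_step (hL.succ_lt hu) (by omega)]
  omega

/-- The three projective dimensions of a short exact sequence of interval modules. -/
theorem pdI_triple (hL : IsKupisch L) {a b c : ℕ} (hab : a < b) (hbc : b < c) (hc : L c ≤ a) :
    pdI L a c ≤ max (pdI L a b) (pdI L b c) ∧ pdI L b c ≤ max (pdI L a c) (pdI L a b + 1) ∧
      pdI L a b ≤ max (pdI L a c) (pdI L b c - 1) := by
  induction c using Nat.strong_induction_on generalizing a b with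
  | _ c ih =>
    rcases Nat.lt_or_ge (L c) a with h | h
    · have h1 := ih b hbc h hab (hL.mono hbc.le)
      rw [pdI_step h (hab.trans hbc), pdI_step (h.trans hab) hbc]
      omega
    · obtain rfl : L c = a := by omega
      rw [pdI_eq_zero (a := L c) (b := c) le_rfl, pdI_step hab hbc]
      omega

theorem pdI_le_of_pdS_le (hL : IsKupisch L) {a c N : ℕ}
    (h : ∀ u, a ≤ u → u < c → pdS L u ≤ N) : pdI L a c ≤ N := by
  induction c with
  | zero => simp [pdI]
  | succ c ih =>
    rcases Nat.lt_or_ge (L (c + 1)) a with h1 | h1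
    · rcases Nat.lt_trichotomy a c with h2 | h2 | h2
      · have h3 := (hL.pdI_triple h2 (Nat.lt_succ_self c) h1.le).1
        have h4 := ih fun u hu hu' => h u hu (by omega)
        have h5 := h c h2.le (by omega)
        rw [pdS] at h5
        simp only [Nat.succ_eq_add_one] at h3
        omega
      · subst h2
        exact h a le_rfl (by omega)
      · rw [pdI, dif_neg (by omega)]
        omega
    · rw [pdI_eq_zero h1]
      omega

/-- The submodule `[v, c)` of `[v, c')` has projective dimension at most the maximum of that of `[v,
c')` and one less than that of the quotient, and nothing exceeds `d`. So the value `d` passes to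
larger modules with the same socle, in particular to the injective envelope. -/
theorem pdI_eq_of_le (hL : IsKupisch L) {n d v c c' : ℕ}
    (hG : ∀ a b, b ≤ n → pdI L a b ≤ d) (hc : v < c) (hcc : c ≤ c') (hc' : c' ≤ n)
    (hv : L c' ≤ v) (h : pdI L v c = d) : pdI L v c' = d := by
  rcases hcc.eq_or_lt with rfl | h1
  · exact h
  · have h2 := (hL.pdI_triple hc h1 hv).2.2
    have h3 := hG c c' hc'
    have h4 := hG v c' hc'
    omega

/-! Vertices below a summit. -/

/-- Vertices in the image of an ascending Kupisch function have lifts. -/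
theorem exists_lift (hL : IsKupisch L) {q c u' : ℕ} (hA : ∀ b < q, L (b + 1) ≤ L b + 1)
    (hc : c ≤ q) (hu : u' < L c) :
    ∃ u < c, L u = u' ∧ L (u + 1) = u' + 1 ∧ ∀ v ≤ c, L v ≤ u' → v ≤ u := by
  have h0 : L (Nat.findGreatest (fun b => L b ≤ u') c) ≤ u' :=
    Nat.findGreatest_spec (P := fun b => L b ≤ u') (Nat.zero_le c) (by simp [hL.zero])
  have h1 := Nat.findGreatest_le (P := fun b => L b ≤ u') c
  set u := Nat.findGreatest (fun b => L b ≤ u') c with hu'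
  have h2 : u ≠ c := by intro h; rw [h] at h0; omega
  have h3 : u' < L (u + 1) := by
    by_contra hh
    have := Nat.le_findGreatest (P := fun b => L b ≤ u') (m := u + 1) (n := c) (by omega)
      (by simpa using hh)
    omega
  have h4 := hA u (by omega)
  exact ⟨u, by omega, by omega, by omega, fun v hv hv' => Nat.le_findGreatest hv hv'⟩

/-- Run the two-step recursion on both vertices. The order `L u < L v` persists as long as `u`
moves, and an even vertex never stops at the value 1, so the lower vertex stops first. -/
theorem pdS_lt_of_even (hL : IsKupisch L) {q u v : ℕ} (hA : ∀ b < q, L (b + 1) ≤ L b + 1)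
    (hv : v < q) (huv : u < v) (he : Even (pdS L v)) : pdS L u < pdS L v := by
  induction v using Nat.strong_induction_on generalizing u with
  | _ v ih =>
    rcases hL.pdS_cases (by omega) (hA v hv) with ⟨_, h⟩ | ⟨h1, h2⟩
    · rw [h] at he; exact absurd he (by decide)
    · rcases Nat.eq_zero_or_pos u with rfl | hu
      · rw [pdS_zero]; omega
      · rcases hL.pdS_cases hu (hA u (by omega)) with ⟨_, h⟩ | ⟨h3, h4⟩
        · omega
        · have h5 := hL.mono (show u + 1 ≤ v by omega)
          have h6 := hL.lt (show 0 < v by omega)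
          have := ih (L v) h6 (u := L u) (by omega) (by omega)
            (by rw [h2] at he; rcases he with ⟨r, hr⟩; exact ⟨r - 1, by omega⟩)
          omega

/-- An even vertex of `[L (L c), L c)` lifts along `L` to a vertex of `[L c, c)` with value two
larger; the induction starts at the simple projective vertex `0`. Consequently an interval with only
odd vertices is never projective. -/
theorem exists_even (hL : IsKupisch L) {q c : ℕ} (hA : ∀ b < q, L (b + 1) ≤ L b + 1)
    (hc : c ≤ q) (hc0 : 0 < c) : ∃ u, L c ≤ u ∧ u < c ∧ Even (pdS L u) := by
  induction c using Nat.strong_induction_on with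
  | _ c ih =>
    rcases Nat.eq_zero_or_pos (L c) with h0 | h0
    · exact ⟨0, by omega, hc0, by rw [pdS_zero]; exact ⟨0, rfl⟩⟩
    · have h1 := hL.lt hc0
      obtain ⟨u', h2, h3, h4⟩ := ih (L c) h1 (by omega) h0
      obtain ⟨u, hu, h5, h6, h7⟩ := hL.exists_lift hA hc h3
      refine ⟨u, h7 _ h1.le h2, hu, ?_⟩
      rcases Nat.eq_zero_or_pos u with rfl | hu0
      · rw [pdS_zero]; exact ⟨0, rfl⟩
      · rcases hL.pdS_cases hu0 (hA u (by omega)) with ⟨h8, _⟩ | ⟨_, h9⟩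
        · omega
        · rw [h9, h5]; exact even_two.add h4

/-- The second syzygy of `[v, c)` is `[L v, L c)` if this is non-empty. Its vertices lift to
vertices of `[v, c)` with values two larger, so oddness of all vertices descends. The induction ends
with a projective syzygy, that is, with projective dimension 1. -/
theorem odd_pdI_of_odd (hL : IsKupisch L) {q v c : ℕ} (hA : ∀ b < q, L (b + 1) ≤ L b + 1)
    (hc : c ≤ q) (hv : v < c) (ho : ∀ u, v ≤ u → u < c → Odd (pdS L u)) : Odd (pdI L v c) := by
  induction c using Nat.strong_induction_on generalizing v with
  | _ c ih =>
    have h1 : L c < v := by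
      by_contra h
      obtain ⟨u, h2, h3, h4⟩ := hL.exists_even hA hc (by omega)
      exact (Nat.not_odd_iff_even.mpr h4) (ho u (by omega) h3)
    rcases (hL.mono hv.le).eq_or_lt with h | h
    · rw [pdI_of_eq h1 hv h]; exact odd_one
    · rw [pdI_of_lt h1 hv h]
      refine even_two.add_odd (ih (L c) (hL.lt (by omega)) (by omega) h ?_)
      intro u' hu1 hu2
      obtain ⟨u, hu, h5, h6, h7⟩ := hL.exists_lift hA hc hu2
      have h8 := ho u (h7 v hv.le hu1) hu
      rcases hL.pdS_cases (by have := h7 v hv.le hu1; omega) (hA u (by omega)) with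
        ⟨h9, _⟩ | ⟨_, h9⟩
      · omega
      · rw [h9, h5] at h8
        rcases h8 with ⟨r, hr⟩
        exact ⟨r - 1, by omega⟩

/-- A vertex of `[v, c)` either has value 1 or is sent by `L` into the second syzygy `[L v, L c)`,
where the induction applies. -/
theorem odd_of_odd_pdI (hL : IsKupisch L) {q v c : ℕ} (hA : ∀ b < q, L (b + 1) ≤ L b + 1)
    (hc : c ≤ q) (ho : Odd (pdI L v c)) : ∀ u, v ≤ u → u < c → Odd (pdS L u) := by
  induction c using Nat.strong_induction_on generalizing v with
  | _ c ih =>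
    obtain ⟨h1, h2⟩ := lt_of_pdI_pos ho.pos
    intro u hu hu'
    have h3 := hL.mono (show u + 1 ≤ c by omega)
    rcases hL.pdS_cases (by omega) (hA u (by omega)) with ⟨_, h⟩ | ⟨h4, h5⟩
    · rw [h]; exact odd_one
    · have h6 := hL.mono hu
      rw [pdI_of_lt h1 h2 (by omega)] at ho
      rw [h5]
      exact even_two.add_odd (ih (L c) (hL.lt (by omega)) (by omega) (v := L v)
        (by rcases ho with ⟨r, hr⟩; exact ⟨r - 1, by omega⟩) (L u) h6 (by omega))

end IsKupisch

end

end Nakayama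

/-! ### Plus- and minus-strictly-increasing windows of a bound Kupisch function. -/

namespace Nakayama

/-- The combinatorial content of a `d`-bound concave Nakayama algebra of height `m + 1`. -/
structure IsBoundKupisch (n m d : ℕ) (L : ℕ → ℕ) : Prop extends IsKupisch L where
  two_le : 2 ≤ m
  even : Even d
  height : ∀ b ≤ n, b ≤ L b + (m + 1)
  asc : ∀ s ≤ n, L s + (m + 1) = s → ∀ b < s, L (b + 1) ≤ L b + 1
  desc : ∀ s ≤ n, L s + (m + 1) = s → ∀ b, s ≤ b → b < n → L b + 1 ≤ L (b + 1)
  summit : ∃ s ≤ n, L s + (m + 1) = s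
  pd_le : ∀ a b, b ≤ n → pdI L a b ≤ d
  closed : ∀ v < n, (∃ b ≤ n, 0 < b ∧ L b = v) ∨
    ∃ c, v < c ∧ c ≤ n ∧ L c ≤ v ∧ pdI L v c = d

/-- The radical of the projective module with vertices `a, …, a + m` is
minus-strictly-increasing. -/
structure IsMinus (n m : ℕ) (L : ℕ → ℕ) (a : ℕ) : Prop where
  le : a + m + 1 ≤ n
  eq : L (a + m + 1) = a
  odd : ∀ u, a ≤ u → u + 1 < a + m → Odd (pdS L u)
  incr : ∀ u, a ≤ u → u + 2 < a + m → pdS L u < pdS L (u + 1)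
  even : ∀ u, u + 1 = a + m → Even (pdS L u)
  last : Odd (pdS L (a + m))
  last_le : pdS L (a + m) ≤ pdS L a

/-- The module with vertices `p, …, p + m - 1` is plus-strictly-increasing. -/
structure IsPlus (n m : ℕ) (L : ℕ → ℕ) (p : ℕ) : Prop where
  le : p + m ≤ n
  even : Even (pdS L p)
  odd : ∀ u, p < u → u < p + m → Odd (pdS L u)
  incr : ∀ u, p < u → u + 1 < p + m → pdS L u < pdS L (u + 1)
  even_pd : Even (pdI L p (p + m))
  lt : ∀ u, p < u → u < p + m → pdS L u < pdI L p (p + m)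

namespace IsBoundKupisch

variable {n m d : ℕ} {L : ℕ → ℕ}

theorem pdS_le (h : IsBoundKupisch n m d L) {u : ℕ} (hu : u < n) : pdS L u ≤ d :=
  h.pd_le u (u + 1) hu

theorem pdS_lt_of_odd (h : IsBoundKupisch n m d L) {u : ℕ} (hu : u < n) (ho : Odd (pdS L u)) :
    pdS L u < d := by
  refine lt_of_le_of_ne (h.pdS_le hu) fun he => ?_
  rw [he] at ho
  exact Nat.not_odd_iff_even.mpr h.even ho

theorem d_pos (h : IsBoundKupisch n m d L) : 0 < d := by
  obtain ⟨s, hs, hs'⟩ := h.summit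
  have := h.two_le
  have := h.pdS_pos one_pos
  have := h.pdS_le (u := 1) (by omega)
  omega

/-- The height `m + 1` leaves room for just one further composition factor: the projective cover of
a non-projective module of length `m` is a summit, and the syzygy is simple. -/
theorem eq_of_pos (h : IsBoundKupisch n m d L) {p : ℕ} (hp : p + m ≤ n)
    (h0 : 0 < pdI L p (p + m)) : L (p + m) + 1 = p := by
  have := h.height _ hp
  have := lt_of_pdI_pos h0
  omega

theorem lift_of_odd (h : IsBoundKupisch n m d L) {q u : ℕ}
    (hA : ∀ b < q, L (b + 1) ≤ L b + 1) (hu : u < q) (h1 : 1 < pdS L u) :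
    L (u + 1) = L u + 1 ∧ pdS L u = 2 + pdS L (L u) := by
  have h0 : u ≠ 0 := by rintro rfl; rw [pdS_zero] at h1; omega
  rcases h.pdS_cases (by omega) (hA u hu) with h2 | h2
  · omega
  · exact h2

/-- The new socle is `a = L (p + 2)`, which turns out to be `p - m + 1`. The vertices above `p + 1`
have values larger than 1, so `L` translates them onto `a, …, p - 2` and lowers their values by two.
The missing vertex `p - 1` is the syzygy of the given module, so its value is one less than the
projective dimension of that module. -/
theorem exists_isMinus_of_isPlus (h : IsBoundKupisch n m d L) {p : ℕ} (hp : IsPlus n m L p) :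
    ∃ a, IsMinus n m L a := by
  have hm := h.two_le
  have h0 := hp.lt (p + 1) (by omega) (by omega)
  have htop := h.eq_of_pos hp.le (by omega)
  have hA := h.asc _ hp.le (by omega)
  have hstep : ∀ u, p + 1 < u → u < p + m → L (u + 1) = L u + 1 ∧ pdS L u = 2 + pdS L (L u) := by
    intro u hu hu'
    have h1 := (hp.odd (u - 1) (by omega) (by omega)).pos
    have h2 := hp.incr (u - 1) (by omega) (by omega)
    rw [Nat.sub_add_cancel (by omega)] at h2
    exact h.lift_of_odd hA hu' (by omega)
  have hlin : ∀ i, p + 2 + i ≤ p + m → L (p + 2 + i) = L (p + 2) + i := by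
    intro i
    induction i with
    | zero => simp
    | succ i ih =>
      intro hi
      have h1 := hstep (p + 2 + i) (by omega) (by omega)
      have h2 := ih (by omega)
      rw [← add_assoc]
      omega
  obtain ⟨μ, rfl⟩ := Nat.exists_eq_add_of_le hm
  have h1 := hlin μ (by omega)
  rw [show p + 2 + μ = p + (2 + μ) by ring] at h1
  set a := L (p + 2) with ha
  have hpe : pdI L p (p + (2 + μ)) = 1 + pdS L (p - 1) := by
    rw [pdI_step (by omega) (by omega), show L (p + (2 + μ)) = p - 1 by omega, pdS,
      Nat.sub_add_cancel (by omega)]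
  -- The vertex `u + 3 + μ` is `u + m + 1`: the translation is by the length of a summit.
  have hlow : ∀ u, a ≤ u → u + 1 < p → u + 3 + μ < p + (2 + μ) ∧
      pdS L (u + 3 + μ) = 2 + pdS L u := by
    intro u hu hu'
    have h2 := hstep (u + 3 + μ) (by omega) (by omega)
    have h3 := hlin (u - a) (by omega)
    rw [show p + 2 + (u - a) = u + 3 + μ by omega] at h3
    rw [h3, show a + (u - a) = u by omega] at h2
    exact ⟨by omega, h2.2⟩
  have hodd : Odd (pdS L (p - 1)) := by
    have := hp.even_pd
    rw [hpe, Nat.even_add] at this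
    simpa using this
  have hodd' : ∀ u, a ≤ u → u < p → Odd (pdS L u) := by
    intro u hu hu'
    by_cases h2 : u + 1 < p
    · have h3 := hp.odd (u + 3 + μ) (by omega) (by omega)
      rw [(hlow u hu h2).2] at h3
      rcases h3 with ⟨r, hr⟩
      exact ⟨r - 1, by omega⟩
    · rwa [show u = p - 1 by omega]
  have hle := hp.le
  refine ⟨a, ⟨by omega, ?_, fun u hu hu' => hodd' u hu (by omega), ?_, ?_, ?_, ?_⟩⟩
  · rw [ha]; congr 1; omega
  · intro u hu hu'
    have h2 := hlow u hu (by omega)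
    by_cases h3 : u + 2 < p
    · have h4 := hlow (u + 1) (by omega) (by omega)
      have h5 := hp.incr (u + 3 + μ) (by omega) (by omega)
      rw [show u + 3 + μ + 1 = u + 1 + 3 + μ by ring] at h5
      omega
    · have h4 := hp.lt (u + 3 + μ) (by omega) (by omega)
      rw [show u + 1 = p - 1 by omega]
      omega
  · intro u hu
    rw [show u = p by omega]
    exact hp.even
  · rw [show a + (2 + μ) = p + 1 by omega]
    exact hp.odd _ (by omega) (by omega)
  · rw [show a + (2 + μ) = p + 1 by omega]
    have h4 := hp.odd (p + 1) (by omega) (by omega)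
    rcases Nat.eq_zero_or_pos μ with rfl | hμ
    · rw [show a = p - 1 by omega]
      omega
    · have h2 := hlow a le_rfl (by omega)
      have h3 := hp.incr (p + 1) (by omega) (by omega)
      rw [show a + 3 + μ = p + 1 + 1 by omega] at h2
      have h5 := hodd' a le_rfl (by omega)
      rcases h4 with ⟨r, hr⟩
      rcases h5 with ⟨r', hr'⟩
      omega

/-- If the top of the summit has value at least 3, every vertex of the summit has value larger than
1. Then `L` translates the whole summit downwards and lowers all values by two, which preserves
every defining condition. Descent on the value of the top. -/
theorem exists_isMinus_last_eq_one (h : IsBoundKupisch n m d L) {a : ℕ} (ha : IsMinus n m L a) :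
    ∃ a, IsMinus n m L a ∧ pdS L (a + m) = 1 := by
  induction hN : pdS L (a + m) using Nat.strong_induction_on generalizing a with
  | _ N ih =>
  have hm := h.two_le
  by_cases h1 : pdS L (a + m) = 1
  · exact ⟨a, ha, h1⟩
  have hA := h.asc _ ha.le (by rw [ha.eq]; ring)
  have h3 : 3 ≤ pdS L (a + m) := by
    rcases ha.last with ⟨r, hr⟩
    omega
  have hbig : ∀ u, a ≤ u → u < a + m + 1 → 1 < pdS L u := by
    intro u hu hu'
    rcases hu.eq_or_lt with rfl | h4
    · have := ha.last_le
      omega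
    · rcases Nat.lt_trichotomy (u + 1) (a + m) with h5 | h5 | h5
      · have h6 := ha.incr (u - 1) (by omega) (by omega)
        rw [Nat.sub_add_cancel (by omega)] at h6
        have := (ha.odd (u - 1) (by omega) (by omega)).pos
        omega
      · have h6 := ha.even u h5
        have := h.pdS_pos (show 0 < u by omega)
        rcases h6 with ⟨r, hr⟩
        omega
      · rw [show u = a + m by omega]
        omega
  have hlin : ∀ i ≤ m + 1, L (a + i) = L a + i := by
    intro i
    induction i with
    | zero => simp
    | succ i ih =>
      intro hi
      have h4 := h.lift_of_odd hA (u := a + i) (by omega) (hbig _ (by omega) (by omega))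
      have := ih (by omega)
      rw [← add_assoc]
      omega
  have hpd : ∀ i ≤ m, pdS L (a + i) = 2 + pdS L (L a + i) := by
    intro i hi
    have h4 := h.lift_of_odd hA (u := a + i) (by omega) (hbig _ (by omega) (by omega))
    rw [h4.2, hlin i (by omega)]
  have h5 := hlin (m + 1) le_rfl
  rw [← add_assoc, ha.eq] at h5
  have hpar : ∀ i ≤ m, (Odd (pdS L (a + i)) → Odd (pdS L (L a + i))) ∧
      (Even (pdS L (a + i)) → Even (pdS L (L a + i))) := by
    intro i hi
    rw [hpd i hi]
    constructor
    · rintro ⟨r, hr⟩; exact ⟨r - 1, by omega⟩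
    · rintro ⟨r, hr⟩; exact ⟨r - 1, by omega⟩
  have hle := ha.le
  refine ih (pdS L (L a + m)) ?_ (a := L a) ⟨by omega, ?_, ?_, ?_, ?_, ?_, ?_⟩ rfl
  · have := hpd m le_rfl; omega
  · rw [← add_assoc] at h5; rw [← h5]
  · intro u hu hu'
    have := (hpar (u - L a) (by omega)).1 (ha.odd _ (by omega) (by omega))
    rwa [show L a + (u - L a) = u by omega] at this
  · intro u hu hu'
    have h6 := ha.incr (a + (u - L a)) (by omega) (by omega)
    have h7 := hpd (u - L a) (by omega)
    have h8 := hpd (u - L a + 1) (by omega)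
    rw [show L a + (u - L a + 1) = u + 1 by omega, ← add_assoc] at h8
    rw [show L a + (u - L a) = u by omega] at h7
    omega
  · intro u hu
    have := (hpar (u - L a) (by omega)).2 (ha.even _ (by omega))
    rwa [show L a + (u - L a) = u by omega] at this
  · exact (hpar m le_rfl).1 ha.last
  · have h6 := hpd m le_rfl
    have h7 := hpd 0 (by omega)
    have := ha.last_le
    simp only [add_zero] at h7
    omega

/-- Above a minus-strictly-increasing radical, the function `L` is a translation as long as the
vertices below are not the socles of modules of projective dimension `d`. -/
theorem translation (h : IsBoundKupisch n m d L) {a N : ℕ} (ha : IsMinus n m L a)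
    (hN : N ≤ m + 1)
    (hpd : ∀ i < N, ∀ c, a + i + 1 < c → c ≤ n → L c < a + i + 1 → pdI L (a + i + 1) c < d) :
    ∀ i ≤ N, a + m + 1 + i ≤ n ∧ L (a + m + 1 + i) = a + i := by
  intro i
  induction i with
  | zero => exact fun _ => ⟨ha.le, ha.eq⟩
  | succ i ih =>
    intro hi
    obtain ⟨h1, h2⟩ := ih (by omega)
    have hle := ha.le
    have hm := h.two_le
    -- By `hpd` only the first alternative survives. Since `L` is strictly increasing above the
    -- summit, the vertex `a + i + 1` must already be the next value of `L`.
    rcases h.closed (a + i + 1) (by omega) with ⟨b, hb, -, hb'⟩ | ⟨c, hc, hc', hc1, hc2⟩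
    · have h3 : a + m + 1 + i < b := by
        by_contra hcon
        have := h.mono (show b ≤ a + m + 1 + i by omega)
        omega
      have h4 := h.desc _ ha.le (by rw [ha.eq]; ring) (a + m + 1 + i) (by omega) (by omega)
      have h5 := h.mono (show a + m + 1 + i + 1 ≤ b by omega)
      rw [← add_assoc]
      omega
    · have hd := h.d_pos
      have := hpd i (by omega) c hc hc' (lt_of_pdI_pos (by omega)).1
      omega

/-- The even vertex `a + m - 1` dominates everything below it, and the top `a + m` is bounded by the
value at `a`. -/
theorem pdS_le_of_isMinus (h : IsBoundKupisch n m d L) {a : ℕ} (ha : IsMinus n m L a) {u : ℕ}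
    (hu : a ≤ u) (hu' : u < a + m + 1) : pdS L u ≤ pdS L (a + m - 1) := by
  have hA := h.asc _ ha.le (by rw [ha.eq]; ring)
  have hm := h.two_le
  have hlt : ∀ u, u < a + m - 1 → pdS L u < pdS L (a + m - 1) := fun u hu =>
    h.pdS_lt_of_even hA (by omega) hu (ha.even _ (by omega))
  rcases Nat.lt_trichotomy u (a + m - 1) with h1 | h1 | h1
  · exact (hlt u h1).le
  · rw [h1]
  · rw [show u = a + m by omega]
    exact ha.last_le.trans (hlt a (by omega)).le

/-- If the even vertex does not have value `d`, its value is at most `d - 2` by parity, and it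
bounds all values in the summit. Hence no module with socle in `a + 1, …, a + m + 1` reaches `d`,
all these vertices are socles of projective modules, and the window moves up by `m + 1` with all
values raised by two. -/
theorem exists_isMinus_even_eq (h : IsBoundKupisch n m d L) {a : ℕ} (ha : IsMinus n m L a) :
    ∃ a, IsMinus n m L a ∧ pdS L (a + m - 1) = d := by
  induction hN : d - pdS L (a + m - 1) using Nat.strong_induction_on generalizing a with
  | _ N ih =>
  have hm := h.two_le
  have hle := ha.le
  have hf := h.pdS_le (u := a + m - 1) (by omega)
  by_cases h1 : pdS L (a + m - 1) = d
  · exact ⟨a, ha, h1⟩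
  have hev := ha.even (a + m - 1) (by omega)
  have hd := h.even
  have htr := h.translation ha (N := m + 1) le_rfl (by
    intro i hi c hc hc' hcl
    have hfd : pdS L (a + m - 1) + 2 ≤ d := by
      rcases hev with ⟨r, hr⟩
      rcases hd with ⟨r', hr'⟩
      omega
    -- If the module ends above the summit, its syzygy lies inside the summit; otherwise the module
    -- itself does.
    rcases Nat.lt_or_ge (a + m + 1) c with h2 | h2
    · have h3 := h.mono h2.le
      rw [ha.eq] at h3
      have := h.pdI_le_of_pdS_le (a := L c) (c := a + i + 1) (N := pdS L (a + m - 1))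
        fun u hu hu' => h.pdS_le_of_isMinus ha (by omega) (by omega)
      rw [pdI_step hcl hc]
      omega
    · have := h.pdI_le_of_pdS_le (a := a + i + 1) (c := c) (N := pdS L (a + m - 1))
        fun u hu hu' => h.pdS_le_of_isMinus ha (by omega) (by omega)
      omega)
  have hpd : ∀ i ≤ m, pdS L (a + m + 1 + i) = 2 + pdS L (a + i) := by
    intro i hi
    have h2 := (htr i (by omega)).2
    have h3 := (htr (i + 1) (by omega)).2
    rcases h.pdS_cases (u := a + m + 1 + i) (by omega) (by rw [add_assoc, h3]; omega) with h4 | h4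
    · rw [add_assoc, h3] at h4; omega
    · rw [h4.2, h2]
  set a' := a + m + 1 with ha'
  have hle' := (htr (m + 1) le_rfl).1
  refine ih (d - pdS L (a' + m - 1)) ?_ (a := a') ⟨by omega, ?_, ?_, ?_, ?_, ?_, ?_⟩ rfl
  · have := hpd (m - 1) (by omega)
    rw [show a' + (m - 1) = a' + m - 1 by omega, show a + (m - 1) = a + m - 1 by omega] at this
    omega
  · rw [add_assoc, (htr (m + 1) le_rfl).2]; omega
  · intro u hu hu'
    have h2 := hpd (u - a') (by omega)
    rw [show a' + (u - a') = u by omega] at h2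
    rw [h2]
    exact even_two.add_odd (ha.odd _ (by omega) (by omega))
  · intro u hu hu'
    have h2 := hpd (u - a') (by omega)
    have h3 := hpd (u - a' + 1) (by omega)
    have h4 := ha.incr (a + (u - a')) (by omega) (by omega)
    rw [show a' + (u - a') = u by omega] at h2
    rw [show a' + (u - a' + 1) = u + 1 by omega, ← add_assoc] at h3
    omega
  · intro u hu
    have h2 := hpd (u - a') (by omega)
    rw [show a' + (u - a') = u by omega] at h2
    rw [h2]
    exact even_two.add (ha.even _ (by omega))
  · rw [hpd m le_rfl]
    exact even_two.add_odd ha.last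
  · have h2 := hpd 0 (by omega)
    have h3 := hpd m le_rfl
    have := ha.last_le
    simp only [add_zero] at h2
    omega

/-- Without control of the even vertex, `m - 2` steps are still available: they only involve socles
among the odd vertices, where oddness and strict increase keep the projective dimension below `d`.
-/
theorem translation_of_isMinus (h : IsBoundKupisch n m d L) {a : ℕ} (ha : IsMinus n m L a) :
    ∀ i ≤ m - 2, a + m + 1 + i ≤ n ∧ L (a + m + 1 + i) = a + i := by
  have hm := h.two_le
  have hle := ha.le
  have hd := h.d_pos
  refine h.translation ha (by omega) ?_
  intro i hi c hc hc' hcl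
  rcases Nat.lt_or_ge c (a + m) with h1 | h1
  · have := h.pdI_le_of_pdS_le (a := a + i + 1) (c := c) (N := d - 1) fun u hu hu' => by
      have := h.pdS_lt_of_odd (by omega) (ha.odd u (by omega) (by omega))
      omega
    omega
  · have h2 := h.mono h1
    have hA := h.asc _ ha.le (by rw [ha.eq]; ring)
    have h3 := h.pdS_cases (u := a + m) (by omega) (hA _ (by omega))
    rw [ha.eq] at h3
    -- A vertex of the syzygy inside the window is followed by an odd vertex of larger value, so its
    -- value is at most `d - 2`. The only possible vertex outside is `a - 1 = L (a + m)`, whose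
    -- value is two less than that of `a + m`.
    have h4 := h.pdI_le_of_pdS_le (a := L c) (c := a + i + 1) (N := d - 2) fun u hu hu' => by
      rcases Nat.lt_or_ge u a with h5 | h5
      · have h6 : u = L (a + m) := by omega
        have h7 := ha.last_le
        have h8 := h.pdS_lt_of_odd (by omega) (ha.odd a (by omega) (by omega))
        rw [h6]
        omega
      · have h6 := ha.incr u (by omega) (by omega)
        have := h.pdS_lt_of_odd (u := u + 1) (by omega) (ha.odd _ (by omega) (by omega))
        omega
    have h5 : 2 ≤ d := by
      rcases h.even with ⟨r, hr⟩
      omega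
    rw [pdI_step hcl hc]
    omega

/-- The module starts at the even vertex `a + m - 1`, continues with the top `a + m` of the summit,
and then with the translates of `a, …, a + m - 3`, whose values are raised by two. Its syzygy is the
simple module at `a + m - 2`, the last odd vertex of the radical. -/
theorem isPlus_of_isMinus (h : IsBoundKupisch n m d L) {a : ℕ} (ha : IsMinus n m L a) :
    IsPlus n m L (a + m - 1) := by
  have hm := h.two_le
  have htr := h.translation_of_isMinus ha
  have hA := h.asc _ ha.le (by rw [ha.eq]; ring)
  obtain ⟨μ, rfl⟩ := Nat.exists_eq_add_of_le hm
  have hpd : ∀ i < μ, pdS L (a + (2 + μ) + 1 + i) = 2 + pdS L (a + i) := by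
    intro i hi
    have h2 := (htr i (by omega)).2
    have h3 := (htr (i + 1) (by omega)).2
    rcases h.pdS_cases (u := a + (2 + μ) + 1 + i) (by omega) (by rw [add_assoc, h3]; omega)
      with h4 | h4
    · rw [add_assoc, h3] at h4; omega
    · rw [h4.2, h2]
  have h1 := htr μ (by omega)
  have hcase : ∀ u, a + μ + 1 < u → u < a + μ + 1 + (2 + μ) → u = a + (2 + μ) ∨
      ∃ i < μ, u = a + (2 + μ) + 1 + i := by
    intro u hu hu'
    rcases Nat.lt_or_ge (a + (2 + μ)) u with h2 | h2
    · exact .inr ⟨u - (a + (2 + μ) + 1), by omega, by omega⟩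
    · exact .inl (by omega)
  have hpY : pdI L (a + μ + 1) (a + μ + 1 + (2 + μ)) = 1 + pdS L (a + μ) := by
    have h2 : L (a + μ + 1 + (2 + μ)) = a + μ := by
      rw [show a + μ + 1 + (2 + μ) = a + (2 + μ) + 1 + μ by ring, h1.2]
    rw [pdI_step (by omega) (by omega), h2, pdS]
  have hsub : a + (2 + μ) - 1 = a + μ + 1 := by omega
  have hgap : ∀ i < μ, pdS L (a + i) + 2 ≤ pdS L (a + i + 1) := by
    intro i hi
    have h2 := ha.incr (a + i) (by omega) (by omega)
    obtain ⟨r, hr⟩ := ha.odd (a + i) (by omega) (by omega)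
    obtain ⟨r', hr'⟩ := ha.odd (a + i + 1) (by omega) (by omega)
    omega
  have hmon : ∀ i ≤ μ, pdS L (a + i) ≤ pdS L (a + μ) := by
    intro i hi
    induction hi using Nat.decreasingInduction with
    | self => exact le_rfl
    | of_succ i hi ih =>
      have := hgap i hi
      have := ih
      rw [← add_assoc] at this
      omega
  rw [hsub]
  refine ⟨by omega, ha.even _ (by omega), ?_, ?_, ?_, ?_⟩
  · intro u hu hu'
    rcases hcase u hu hu' with rfl | ⟨i, hi, rfl⟩
    · exact ha.last
    · rw [hpd i hi]
      exact even_two.add_odd (ha.odd _ (by omega) (by omega))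
  · intro u hu hu'
    rcases hcase u hu (by omega) with rfl | ⟨i, hi, rfl⟩
    · have h2 := hpd 0 (by omega)
      have := ha.last_le
      simp only [add_zero] at h2
      omega
    · have h2 := hpd i hi
      have h3 := hpd (i + 1) (by omega)
      have h4 := ha.incr (a + i) (by omega) (by omega)
      rw [show a + (2 + μ) + 1 + (i + 1) = a + (2 + μ) + 1 + i + 1 by ring, ← add_assoc a i 1] at h3
      omega
  · rw [hpY]
    exact odd_one.add_odd (ha.odd _ (by omega) (by omega))
  · intro u hu hu'
    rw [hpY]
    rcases hcase u hu hu' with rfl | ⟨i, hi, rfl⟩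
    · have := ha.last_le
      have := hmon 0 (by omega)
      simp only [add_zero] at this
      omega
    · have h2 := hpd i hi
      have h3 := hgap i hi
      have h4 := hmon (i + 1) hi
      rw [← add_assoc] at h4
      omega

theorem rightEnd_eq (h : IsKupisch L) {a b : ℕ} (hb : b ≤ n) (hab : L b ≤ a)
    (hlt : b < n → a < L (b + 1)) : rightEnd n L a = b := by
  refine le_antisymm ?_ (Nat.le_findGreatest (P := fun b => L b ≤ a) hb hab)
  by_contra hc
  have h1 : L (rightEnd n L a) ≤ a :=
    Nat.findGreatest_spec (P := fun b => L b ≤ a) (Nat.zero_le n) (by simp [h.zero])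
  have h2 : rightEnd n L a ≤ n := Nat.findGreatest_le n
  have h3 := h.mono (show b + 1 ≤ rightEnd n L a by omega)
  have := hlt (by omega)
  omega

/-- A longer module with socle `a + m - 1` would have a projective cover with this same socle. Its
quotient by the socle would have the simple module at the even vertex as syzygy, hence projective
dimension `d + 1`. -/
theorem rightEnd_of_isMinus (h : IsBoundKupisch n m d L) {a : ℕ} (ha : IsMinus n m L a)
    (hd : pdS L (a + m - 1) = d) : rightEnd n L (a + m - 1) = a + m - 1 + m := by
  have hm := h.two_le
  have hP := h.isPlus_of_isMinus ha
  have h1 := (h.translation_of_isMinus ha (m - 2) le_rfl)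
  rw [show a + m + 1 + (m - 2) = a + m - 1 + m by omega] at h1
  refine rightEnd_eq h.toIsKupisch hP.le (by omega) fun hlt => ?_
  have h2 := h.desc _ ha.le (by rw [ha.eq]; ring) (a + m - 1 + m) (by omega) hlt
  by_contra hc
  have h3 : L (a + m - 1 + m + 1) = a + m - 1 := by omega
  have h4 := h.pd_le (a + m) (a + m - 1 + m + 1) (by omega)
  rw [pdI_step (by omega) (by omega), h3] at h4
  rw [pdS, Nat.sub_add_cancel (by omega)] at hd
  omega

/-- An odd module has only odd composition factors, so its syzygy, the simple module at `p - 1`, is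
even. The top has value larger than 1, hence `L` moves by one there, and the module of length `m`
with socle `p - 1` has the simple module at `p - 2` as its syzygy; this is the
plus-strictly-increasing module. -/
theorem exists_isPlus_of_odd (h : IsBoundKupisch n m d L) {p : ℕ} (hp : p + m ≤ n)
    (ho : Odd (pdI L p (p + m)))
    (hinc : ∀ u, p ≤ u → u + 1 < p + m → Odd (pdS L u) → Odd (pdS L (u + 1)) →
      pdS L u < pdS L (u + 1)) : ∃ p, IsPlus n m L p := by
  have hm := h.two_le
  have htop := h.eq_of_pos hp ho.pos
  have hA := h.asc _ hp (by omega)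
  have hodd := h.odd_of_odd_pdI hA le_rfl ho
  have hinc' : ∀ u, p ≤ u → u + 1 < p + m → pdS L u + 2 ≤ pdS L (u + 1) := by
    intro u hu hu'
    have h1 := hodd u hu (by omega)
    have h2 := hodd (u + 1) (by omega) hu'
    have h3 := hinc u hu hu' h1 h2
    obtain ⟨r, hr⟩ := h1
    obtain ⟨r', hr'⟩ := h2
    omega
  obtain ⟨μ, rfl⟩ := Nat.exists_eq_add_of_le hm
  have h1 := hinc' (p + μ) (by omega) (by omega)
  have h0 := (hodd (p + μ) (by omega) (by omega)).pos
  have h2 := h.lift_of_odd hA (u := p + μ + 1) (by omega) (by omega)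
  rw [show p + μ + 1 + 1 = p + (2 + μ) by ring] at h2
  -- After the renaming the odd module has socle `p + 2`, and the module to be found has socle `p +
  -- 1`.
  obtain ⟨p, rfl⟩ : ∃ p', p = p' + 2 := ⟨p - 2, by
    have h3 : 0 < p := by omega
    by_contra hc
    omega⟩
  have h3 : L (p + 2 + μ + 1) = p := by omega
  have hpY : pdI L (p + 1) (p + 1 + (2 + μ)) = 1 + pdS L p := by
    rw [show p + 1 + (2 + μ) = p + 2 + μ + 1 by ring, pdI_step (by omega) (by omega), h3, pdS]
  rw [h3] at h2
  have h4 := hodd (p + 2 + μ + 1) (by omega) (by omega)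
  have hev : Odd (pdS L p) := by
    rw [h2.2] at h4
    rcases h4 with ⟨r, hr⟩
    exact ⟨r - 1, by omega⟩
  have hmon : ∀ i ≤ μ, pdS L (p + 2 + i) ≤ pdS L (p + 2 + μ) := by
    intro i hi
    induction hi using Nat.decreasingInduction with
    | self => exact le_rfl
    | of_succ i hi ih =>
      have h5 := hinc' (p + 2 + i) (by omega) (by omega)
      have := ih
      rw [← add_assoc] at this
      omega
  refine ⟨p + 1, by omega, ?_, fun u hu hu' => hodd u (by omega) (by omega), ?_, ?_, ?_⟩
  · rw [pdI_step (by omega) (by omega), show L (p + 2 + (2 + μ)) = p + 1 by omega] at ho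
    change Odd (1 + pdS L (p + 1)) at ho
    rcases ho with ⟨r, hr⟩
    exact ⟨r, by omega⟩
  · intro u hu hu'
    have := hinc' u (by omega) (by omega)
    omega
  · rw [hpY]
    exact odd_one.add_odd hev
  · intro u hu hu'
    rw [hpY]
    have h5 := hmon (u - (p + 2)) (by omega)
    rw [show p + 2 + (u - (p + 2)) = u by omega] at h5
    omega

end IsBoundKupisch

end Nakayama

/-! ### Dominant dimension in terms of the Kupisch function. -/

namespace Nakayama

variable {n m d : ℕ} {L : ℕ → ℕ}

/-- The vertex `v` is the socle of an indecomposable projective module. -/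
def IsProjSocle (n : ℕ) (L : ℕ → ℕ) (v : ℕ) : Prop := ∃ b ≤ n, 0 < b ∧ L b = v

/-- The first `N` terms of the minimal injective coresolution of the interval module with the
vertices `x, …, y - 1` are projective. -/
def DomDimInterval (n : ℕ) (L : ℕ → ℕ) : ℕ → ℕ → ℕ → Prop
  | 0, _, _ => True
  | N + 1, x, y => IsProjSocle n L x ∧
      (y < rightEnd n L x → DomDimInterval n L N y (rightEnd n L x))

/-- The end points of the cosyzygies of the interval module with the vertices `x, …, y - 1`. -/
def cosyzygySeq (n : ℕ) (L : ℕ → ℕ) (x y : ℕ) : ℕ → ℕ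
  | 0 => x
  | 1 => y
  | k + 2 => rightEnd n L (cosyzygySeq n L x y k)

theorem cosyzygySeq_succ (x y k : ℕ) :
    cosyzygySeq n L x y (k + 1) = cosyzygySeq n L y (rightEnd n L x) k := by
  induction k using Nat.strong_induction_on with
  | _ k ih =>
    match k with
    | 0 => rfl
    | 1 => rfl
    | k + 2 =>
      rw [cosyzygySeq, ih k (by omega), cosyzygySeq]

theorem isProjSocle_of_domDimInterval {N x y : ℕ} (h : DomDimInterval n L N x y) :
    ∀ k < N, (∀ j, 1 ≤ j → j ≤ k → cosyzygySeq n L x y j < cosyzygySeq n L x y (j + 1)) →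
      IsProjSocle n L (cosyzygySeq n L x y k) := by
  induction N generalizing x y with
  | zero => intro k hk; omega
  | succ N ih =>
    rintro (_ | k) hk hj
    · exact h.1
    · have h1 := hj 1 le_rfl (by omega)
      rw [cosyzygySeq_succ]
      refine ih (h.2 h1) k (by omega) fun j hj1 hj2 => ?_
      rw [← cosyzygySeq_succ, ← cosyzygySeq_succ]
      exact hj (j + 1) (by omega) (by omega)

/-- Here `k` is the first stage at which the injective envelope of a cosyzygy fails to be
projective; all cosyzygies up to this stage are non-zero. -/
theorem exists_of_not_domDimInterval {N x y : ℕ} (h : ¬ DomDimInterval n L N x y) :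
    ∃ k < N, (∀ j < k, IsProjSocle n L (cosyzygySeq n L x y j)) ∧
      ¬ IsProjSocle n L (cosyzygySeq n L x y k) ∧
      ∀ j, 1 ≤ j → j ≤ k → cosyzygySeq n L x y j < cosyzygySeq n L x y (j + 1) := by
  induction N generalizing x y with
  | zero => exact absurd trivial h
  | succ N ih =>
    by_cases hx : IsProjSocle n L x
    · rw [DomDimInterval, not_and, Classical.not_imp] at h
      obtain ⟨h1, h2⟩ := h hx
      obtain ⟨k, hk, h3, h4, h5⟩ := ih h2
      refine ⟨k + 1, by omega, ?_, ?_, ?_⟩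
      · rintro (_ | j) hj
        · exact hx
        · rw [cosyzygySeq_succ]; exact h3 j (by omega)
      · rwa [cosyzygySeq_succ]
      · rintro (_ | _ | j) hj1 hj2
        · omega
        · exact h1
        · rw [cosyzygySeq_succ x y (j + 1), cosyzygySeq_succ x y (j + 1 + 1)]
          exact h5 (j + 1) (by omega) (by omega)
    · exact ⟨0, by omega, by omega, hx, by omega⟩

namespace IsKupisch

theorem rightEnd_le (a : ℕ) : rightEnd n L a ≤ n := Nat.findGreatest_le n

theorem map_rightEnd_le (h : IsKupisch L) (a : ℕ) : L (rightEnd n L a) ≤ a :=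
  Nat.findGreatest_spec (P := fun b => L b ≤ a) (Nat.zero_le n) (by simp [h.zero])

theorem le_rightEnd {a b : ℕ} (hb : b ≤ n) (hab : L b ≤ a) : b ≤ rightEnd n L a :=
  Nat.le_findGreatest (P := fun b => L b ≤ a) hb hab

theorem map_rightEnd (h : IsKupisch L) {a : ℕ} (ha : IsProjSocle n L a) :
    L (rightEnd n L a) = a := by
  obtain ⟨b, hb, -, rfl⟩ := ha
  exact le_antisymm (h.map_rightEnd_le _) (h.mono (le_rightEnd hb le_rfl))

theorem lt_map_of_rightEnd_lt {a b : ℕ} (hb : b ≤ n) (hab : rightEnd n L a < b) : a < L b := by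
  by_contra hc
  have := le_rightEnd hb (not_lt.mp hc)
  omega

theorem cosyzygySeq_le {x y : ℕ} (hy : y ≤ n) : ∀ k, cosyzygySeq n L x y (k + 1) ≤ n
  | 0 => hy
  | _ + 1 => rightEnd_le _

theorem map_cosyzygySeq (h : IsKupisch L) {b k : ℕ}
    (hk : ∀ j < k, IsProjSocle n L (cosyzygySeq n L (L b) b j)) :
    ∀ j < k, L (cosyzygySeq n L (L b) b (j + 2)) = cosyzygySeq n L (L b) b j := fun j hj =>
  h.map_rightEnd (hk j hj)

/-- While the injective terms are projective, the coresolution of the projective module `[L b, b)`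
read backwards is a minimal projective resolution of the cosyzygy. -/
theorem pdI_cosyzygySeq (h : IsKupisch L) {b k : ℕ} (hb : 0 < b)
    (hk : ∀ j < k, IsProjSocle n L (cosyzygySeq n L (L b) b j))
    (hlt : ∀ j, 1 ≤ j → j ≤ k → cosyzygySeq n L (L b) b j < cosyzygySeq n L (L b) b (j + 1)) :
    ∀ j ≤ k, pdI L (cosyzygySeq n L (L b) b j) (cosyzygySeq n L (L b) b (j + 1)) = j := by
  intro j
  induction j with
  | zero => exact fun _ => pdI_eq_zero le_rfl
  | succ j ih =>
    intro hj
    have h1 := h.map_cosyzygySeq hk j (by omega)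
    change L (cosyzygySeq n L (L b) b (j + 1 + 1)) = _ at h1
    have h2 : cosyzygySeq n L (L b) b j < cosyzygySeq n L (L b) b (j + 1) := by
      rcases Nat.eq_zero_or_pos j with rfl | h0
      · exact h.lt hb
      · exact hlt j h0 (by omega)
    rw [pdI_step (by omega) (hlt (j + 1) (by omega) hj), h1, ih (by omega), add_comm]

/-- The cosyzygies of a projective module of dominant dimension at least `N` which is not
injective. -/
theorem cosyzygySeq_lt (h : IsKupisch L) {b N : ℕ} (hbn : b ≤ n) (hb : 0 < b)
    (hlt : b < rightEnd n L (L b)) (hN : DomDimInterval n L N (L b) b) :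
    ∀ k ≤ N, cosyzygySeq n L (L b) b k < cosyzygySeq n L (L b) b (k + 1) ∧
      ∀ j < k, IsProjSocle n L (cosyzygySeq n L (L b) b j) := by
  intro k
  induction k using Nat.strong_induction_on with
  | _ k ih =>
    intro hk
    have hsoc : ∀ j < k, IsProjSocle n L (cosyzygySeq n L (L b) b j) := fun j hj =>
      isProjSocle_of_domDimInterval hN j (by omega) fun i _ hi => (ih i (by omega) (by omega)).1
    refine ⟨?_, hsoc⟩
    match k with
    | 0 => exact h.lt hb
    | 1 => exact hlt
    | k + 2 =>
      have h1 := h.map_rightEnd (hsoc k (by omega))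
      have h2 := h.map_rightEnd (hsoc (k + 1) (by omega))
      have h3 := (ih k (by omega) (by omega)).1
      have h4 : L (cosyzygySeq n L (L b) b (k + 2)) ≤ cosyzygySeq n L (L b) b (k + 1) := by
        rw [cosyzygySeq, h1]; exact h3.le
      have h5 := le_rightEnd (n := n) (cosyzygySeq_le hbn (k + 1)) h4
      -- If two consecutive right ends agreed, `L` would have to take the two different values `y k`
      -- and `y (k + 1)` there.
      refine lt_of_le_of_ne h5 fun he => ?_
      change cosyzygySeq n L (L b) b (k + 2) = rightEnd n L (cosyzygySeq n L (L b) b (k + 1)) at he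
      rw [← he] at h2
      change L (rightEnd n L (cosyzygySeq n L (L b) b k)) = _ at h2
      omega

/-- A non-injective projective module with `N` projective-injective terms has a non-zero `N`-th
cosyzygy, and its projective dimension is `N > d`. -/
theorem not_domDimInterval (h : IsKupisch L) {b N : ℕ} (hbn : b ≤ n) (hb : 0 < b)
    (hlt : b < rightEnd n L (L b)) (hd : ∀ a b, b ≤ n → pdI L a b ≤ d) (hN : d < N) :
    ¬ DomDimInterval n L N (L b) b := by
  intro hD
  have h1 := h.cosyzygySeq_lt hbn hb hlt hD
  have h2 := h.pdI_cosyzygySeq hb (k := N) (h1 N le_rfl).2 (fun j _ hj => (h1 j hj).1) N le_rfl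
  have := hd (cosyzygySeq n L (L b) b N) _ (cosyzygySeq_le (n := n) (L := L) (x := L b) hbn N)
  omega

/-- The second syzygies of `[v, c)` and of its simple socle both start at `L v`. The two numbers
therefore drop in step, until the larger module becomes projective. -/
theorem pdI_le_pdS_of_even (hL : IsKupisch L) {q v c : ℕ} (hA : ∀ b < q, L (b + 1) ≤ L b + 1)
    (hv : v < c) (hc : c ≤ q) (he : Even (pdS L v)) : pdI L v c ≤ pdS L v := by
  induction v using Nat.strong_induction_on generalizing c with
  | _ v ih =>
    rcases Nat.eq_zero_or_pos v with rfl | h0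
    · rw [pdI_eq_zero (Nat.zero_le _)]; omega
    rcases hL.pdS_cases h0 (hA v (by omega)) with ⟨_, h⟩ | ⟨h1, h2⟩
    · rw [h] at he; exact absurd he (by decide)
    rcases Nat.lt_or_ge (L c) v with h3 | h3
    · have h4 := hL.mono (show v + 1 ≤ c by omega)
      have h5 := hL.lt (show 0 < c by omega)
      have := ih (L v) (hL.lt h0) (c := L c) (by omega) (by omega)
        (by rw [h2] at he; rcases he with ⟨r, hr⟩; exact ⟨r - 1, by omega⟩)
      rw [pdI_of_lt h3 hv (by omega)]
      omega
    · rw [pdI_eq_zero h3]; omega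

/-- The same descent with the socle one vertex higher. It may also stop at a module with projective
syzygy, which accounts for the additional 1. -/
theorem pdI_succ_le_of_even (hL : IsKupisch L) {q v c : ℕ} (hA : ∀ b < q, L (b + 1) ≤ L b + 1)
    (hv : v + 1 < c) (hc : c ≤ q) (he : Even (pdS L v)) : pdI L (v + 1) c ≤ pdS L v + 1 := by
  induction v using Nat.strong_induction_on generalizing c with
  | _ v ih =>
    rcases Nat.lt_or_ge (L c) (v + 1) with h3 | h3
    · rcases Nat.eq_zero_or_pos v with rfl | h0
      · rw [pdI_step h3 hv, show L c = 0 by omega, pdI_eq_zero (Nat.zero_le _)]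
        omega
      rcases hL.pdS_cases h0 (hA v (by omega)) with ⟨_, h⟩ | ⟨h1, h2⟩
      · rw [h] at he; exact absurd he (by decide)
      have h4 := hL.mono hv.le
      rcases h4.eq_or_lt with h5 | h5
      · rw [pdI_of_eq h3 hv h5]; omega
      · have h6 := hL.lt (show 0 < c by omega)
        have := ih (L v) (hL.lt h0) (c := L c) (by omega) (by omega)
          (by rw [h2] at he; rcases he with ⟨r, hr⟩; exact ⟨r - 1, by omega⟩)
        rw [pdI_of_lt h3 hv h5, h1]
        omega
    · rw [pdI_eq_zero h3]; omega

end IsKupisch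

namespace IsBoundKupisch

open IsKupisch

/-- Up to a summit `L` starts at `0` and climbs in steps of at most one, so it skips no value. -/
theorem isProjSocle_of_le (h : IsBoundKupisch n m d L) {q v : ℕ} (hq : q ≤ n)
    (hs : L q + (m + 1) = q) (hv : v ≤ L q) : IsProjSocle n L v := by
  rcases hv.eq_or_lt with rfl | hv
  · exact ⟨q, hq, by omega, rfl⟩
  · obtain ⟨u, hu, h1, h2, -⟩ := h.exists_lift (h.asc q hq hs) le_rfl hv
    rcases Nat.eq_zero_or_pos u with rfl | h0
    · exact ⟨1, by omega, by omega, by rw [h.one, ← h1, h.zero]⟩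
    · exact ⟨u, by omega, h0, h1⟩

/-- Consider the first cosyzygy of a projective module whose envelope is not projective, at a stage
below `d`. Closedness gives a module of projective dimension `d` with the same socle. At an even
stage this contradicts a general bound along the coresolution; at an odd stage second syzygies
transport the module into the range of the plus-strictly-increasing module, where parity and
monotonicity exclude it. -/
theorem domDimInterval_of_isPlus (h : IsBoundKupisch n m d L) {p : ℕ} (hp : IsPlus n m L p)
    (hinj : rightEnd n L p = p + m) {b : ℕ} (hb0 : 0 < b) (hbn : b ≤ n) :
    DomDimInterval n L d (L b) b := by
  have hm := h.two_le
  have hd := h.d_pos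
  have hpn := hp.le
  have h0 := hp.lt (p + 1) (by omega) (by omega)
  have htop := h.eq_of_pos hp.le (by omega)
  have hA := h.asc _ hp.le (by omega)
  have hdes := h.desc _ hp.le (by omega)
  by_contra hcon
  obtain ⟨k, hkd, hk1, hk2, hk3⟩ := exists_of_not_domDimInterval hcon
  have hpd := h.pdI_cosyzygySeq hb0 hk1 hk3 k le_rfl
  have hmap := h.map_cosyzygySeq hk1
  have hle : ∀ k, cosyzygySeq n L (L b) b (k + 1) ≤ n := cosyzygySeq_le hbn
  obtain ⟨k, rfl⟩ : ∃ k', k = k' + 1 := by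
    rcases k with _ | k
    · exact absurd ⟨b, hbn, hb0, rfl⟩ hk2
    · exact ⟨k, rfl⟩
  have hlt' : ∀ j ≤ k + 1, cosyzygySeq n L (L b) b j < cosyzygySeq n L (L b) b (j + 1) := by
    rintro (_ | j) hj
    · exact h.lt hb0
    · exact hk3 _ (by omega) hj
  generalize hy : cosyzygySeq n L (L b) b = y at hpd hmap hle hlt' hk1 hk2 hk3
  have hy1 : y 1 = b := by rw [← hy]; rfl
  have hy0 : y 0 = L b := by rw [← hy]; rfl
  have hy2 : ∀ j, y (j + 2) = rightEnd n L (y j) := by rw [← hy]; exact fun _ => rfl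
  have hvn : y (k + 1) < n := (hlt' (k + 1) le_rfl).trans_le (hle _)
  obtain ⟨c, hc, hcn, hLc, hcd⟩ := (h.closed _ hvn).resolve_left hk2
  -- Otherwise the module of projective dimension `d` would sit inside the cosyzygy, which would
  -- then also have projective dimension `d` instead of `k + 1 < d`.
  have hcgt : y (k + 2) < c := by
    by_contra hc'
    have := h.pdI_eq_of_le h.pd_le hc (not_lt.mp hc') (hle _)
      (by rw [hmap k (by omega)]; exact (hlt' k (by omega)).le) hcd
    rw [this] at hpd
    omega
  rcases Nat.even_or_odd (k + 1) with hpar | hpar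
  · -- even cosyzygies
    -- A module properly containing an even cosyzygy either is projective or has a second syzygy
    -- which properly contains the cosyzygy two stages earlier. At stage `0` the module contains a
    -- projective module with the same socle, hence is projective.
    have key : ∀ i, 2 * i ≤ k + 1 → ∀ c ≤ n, y (2 * i + 1) < c → pdI L (y (2 * i)) c ≤ 2 * i := by
      intro i
      induction i with
      | zero =>
        intro _ c _ hc
        rw [Nat.mul_zero, hy0, pdI_eq_zero (h.mono (by rw [hy1] at hc; exact hc.le))]
      | succ i ih =>
        intro hi c hcn hc
        rw [show 2 * (i + 1) + 1 = 2 * i + 1 + 2 by ring, hy2] at hc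
        have h1 := lt_map_of_rightEnd_lt hcn hc
        have h2 := hmap (2 * i) (by omega)
        have h3 := hlt' (2 * i) (by omega)
        rw [show 2 * (i + 1) = 2 * i + 2 by ring]
        rcases Nat.lt_or_ge (L c) (y (2 * i + 2)) with h4 | h4
        · have h5 := ih (by omega) (L c) ((h.lt (by omega)).le.trans hcn) h1
          have h6 := hlt' (2 * i + 2) (by omega)
          have h7 : y (2 * i + 2) < c := by
            rw [← hy2] at hc; exact h6.trans hc
          rw [pdI_of_lt h4 h7 (by omega), h2]
          omega
        · rw [pdI_eq_zero h4]; omega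
    obtain ⟨i, hi⟩ := hpar
    have := key i (by omega) c hcn (by rw [show 2 * i + 1 = k + 2 by omega]; exact hcgt)
    rw [show 2 * i = k + 1 by omega] at this
    omega
  · -- odd cosyzygies
    obtain ⟨i, hi⟩ := hpar
    have hgap : ¬ IsProjSocle n L p := by
      rintro ⟨b', hb', -, hb''⟩
      have h1 := le_rightEnd hb' hb''.le
      have h2 := h.mono (h1.trans hinj.le)
      omega
    -- Since `p` is not the socle of a projective module, closedness yields a module with socle `p`
    -- and projective dimension `d`; it embeds into the injective module `[p, p + m)`.
    have he : pdI L p (p + m) = d := by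
      obtain ⟨c, hc1, hc2, hc3, hc4⟩ := (h.closed p (by omega)).resolve_left hgap
      exact h.pdI_eq_of_le h.pd_le hc1 ((le_rightEnd hc2 hc3).trans hinj.le) hp.le (by omega) hc4
    have hp1 : pdS L (p - 1) + 1 = d := by
      rw [pdI_step (by omega) (by omega), show L (p + m) = p - 1 by omega] at he
      rw [pdS, Nat.sub_add_cancel (by omega)]
      omega
    have hbq : y 1 < p + m := by
      by_contra hc'
      have h1 := hk3 1 le_rfl (by omega)
      rw [hy2 0, hy0] at h1
      have h2 := hdes (y 1) (by omega) (by have := hle 1; rw [hy2 0, hy0] at this; omega)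
      have h3 := h.map_rightEnd_le (n := n) (L b)
      have h4 := h.mono (show y 1 + 1 ≤ rightEnd n L (L b) by omega)
      rw [hy1] at h2 h4
      omega
    have hsplit : ∀ i', i' ≤ i → (∀ l ≤ i', y (2 * l + 1) < p + m) ∨
        ∃ l < i', (∀ l' ≤ l, y (2 * l' + 1) < p + m) ∧ p + m ≤ y (2 * l + 3) := by
      intro i'
      induction i' with
      | zero =>
        intro _; left; intro l hl
        obtain rfl : l = 0 := by omega
        exact hbq
      | succ i' ih =>
        intro hi'
        rcases ih (by omega) with h1 | ⟨l, h1, h2⟩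
        · rcases Nat.lt_or_ge (y (2 * (i' + 1) + 1)) (p + m) with h2 | h2
          · left
            intro l hl
            rcases Nat.lt_or_ge l (i' + 1) with h3 | h3
            · exact h1 l (by omega)
            · obtain rfl : l = i' + 1 := by omega
              exact h2
          · exact .inr ⟨i', by omega, h1, h2⟩
        · exact .inr ⟨l, by omega, h2⟩
    -- The number `l` marks the last term before the odd-indexed end points leave the range below `p
    -- + m`.
    have hl : ∃ l ≤ i, (∀ l' ≤ l, y (2 * l' + 1) < p + m) ∧ (l < i → p + m ≤ y (2 * l + 3)) := by
      rcases hsplit i le_rfl with h1 | ⟨l, h1, h2, h3⟩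
      · exact ⟨i, le_rfl, h1, by omega⟩
      · exact ⟨l, h1.le, h2, fun _ => h3⟩
    obtain ⟨l, hli, hlq, hlend⟩ := hl
    -- Each such vertex is the last one sent by `L` to its predecessor, so `L` moves by one there
    -- and the value grows by two. The chain starts with value 1, as `[L b, b)` is not injective.
    have hpdl : ∀ l' ≤ l, pdS L (y (2 * l' + 1)) = 2 * l' + 1 := by
      intro l'
      induction l' with
      | zero =>
        intro _
        have h1 := hk3 1 le_rfl (by omega)
        rw [hy2 0, hy0] at h1
        have h3 := h.map_rightEnd_le (n := n) (L b)
        have h4 := h.mono (show y 1 + 1 ≤ rightEnd n L (L b) by omega)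
        rcases h.pdS_cases (u := y 1) (by omega) (hA _ hbq) with h5 | h5
        · exact h5.2
        · rw [hy1] at h4 h5; omega
      | succ l' ih =>
        intro hl'
        have h1 := ih (by omega)
        have h2 := hmap (2 * l' + 1) (by omega)
        have h3 := hlq (l' + 1) hl'
        rw [show 2 * (l' + 1) + 1 = 2 * l' + 1 + 2 by ring] at h3 ⊢
        have h4 := lt_map_of_rightEnd_lt (n := n) (L := L) (a := y (2 * l' + 1))
          (b := y (2 * l' + 1 + 2) + 1) (by omega) (by rw [← hy2]; omega)
        have h5 := hlt' (2 * l' + 1) (by omega)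
        have h6 := hlt' (2 * l' + 1 + 1) (by omega)
        change y (2 * l' + 1 + 1) < y (2 * l' + 1 + 2) at h6
        rcases h.pdS_cases (u := y (2 * l' + 1 + 2)) (by omega) (hA _ h3) with h7 | h7
        · omega
        · rw [h7.2, h2, h1]; ring
    have hu := hpdl l le_rfl
    have huq := hlq l le_rfl
    -- The vertex `p` is excluded by parity. For `l = i` the vertices below `p` are excluded because
    -- they are socles of projective modules. For `l < i` the next term has `L`-value at least `p -
    -- 1`, and `p - 1` itself has value `d - 1`, which is larger than `2 * l + 1`.
    have hpu : p < y (2 * l + 1) := by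
      have hne : y (2 * l + 1) ≠ p := by
        intro he'
        have := hp.even
        rw [← he', hu] at this
        exact Nat.not_even_iff_odd.mpr ⟨l, rfl⟩ this
      rcases hli.eq_or_lt with rfl | hlt
      · by_contra hc'
        refine hk2 (h.isProjSocle_of_le hp.le (by omega) ?_)
        rw [hi]; omega
      · have h1 := hlend hlt
        have h2 := hmap (2 * l + 1) (by omega)
        have h3 := h.mono h1
        have hne' : y (2 * l + 1) ≠ p - 1 := by
          intro he'
          rw [he'] at hu
          omega
        change L (y (2 * l + 3)) = _ at h2
        omega
    -- Each second syzygy lowers the projective dimension by two and moves the socle two steps back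
    -- in the sequence.
    have hshift : ∀ t ≤ i - l, ∃ c ≤ n, pdI L (y (2 * (i - t) + 1)) c = d - 2 * t := by
      intro t
      induction t with
      | zero =>
        intro _
        exact ⟨c, hcn, by rw [Nat.sub_zero, ← hi, hcd]; rfl⟩
      | succ t ih =>
        intro ht
        obtain ⟨c, hcn, hc⟩ := ih (by omega)
        obtain ⟨h1, h2⟩ := lt_of_pdI_pos (L := L) (a := y (2 * (i - t) + 1)) (b := c) (by omega)
        have h3 := hmap (2 * (i - (t + 1)) + 1) (by omega)
        rw [show 2 * (i - (t + 1)) + 1 + 2 = 2 * (i - t) + 1 by omega] at h3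
        refine ⟨L c, (h.lt (by omega)).le.trans hcn, ?_⟩
        rcases (h.mono h2.le).eq_or_lt with h4 | h4
        · rw [pdI_of_eq h1 h2 h4] at hc
          omega
        · rw [pdI_of_lt h1 h2 h4, h3] at hc
          omega
    obtain ⟨c', hcn', hc'⟩ := hshift (i - l) le_rfl
    rw [show i - (i - l) = l by omega] at hc'
    obtain ⟨h1, h2⟩ := lt_of_pdI_pos (L := L) (a := y (2 * l + 1)) (b := c') (by omega)
    -- Beyond `p + m` the syzygy starts above `p`, and by monotonicity its vertices have values at
    -- most `2 * l`, too small. Up to `p + m` all composition factors are odd, while `d - 2 * (i -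
    -- l)` is even.
    rcases Nat.lt_or_ge (p + m) c' with h3 | h3
    · have h4 := lt_map_of_rightEnd_lt (n := n) (L := L) (a := p) hcn' (by omega)
      have hincr : ∀ w' w, p < w → w + w' + 1 < p + m → pdS L w < pdS L (w + w' + 1) := by
        intro w'
        induction w' with
        | zero => intro w hw hw'; exact hp.incr w hw (by omega)
        | succ w' ih =>
          intro w hw hw'
          exact (ih w hw (by omega)).trans (hp.incr (w + w' + 1) (by omega) (by omega))
      have h5 := h.pdI_le_of_pdS_le (a := L c') (c := y (2 * l + 1)) (N := 2 * l)
        fun w hw hw' => by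
          have := hincr (y (2 * l + 1) - w - 1) w (by omega) (by omega)
          rw [show w + (y (2 * l + 1) - w - 1) + 1 = y (2 * l + 1) by omega, hu] at this
          omega
      rw [pdI_step h1 h2] at hc'
      have := h.even
      rcases this with ⟨r, hr⟩
      omega
    · have h4 := h.odd_pdI_of_odd hA h3 h2 fun w hw hw' => hp.odd w (by omega) (by omega)
      rw [hc'] at h4
      have := h.even
      rcases this with ⟨r, hr⟩
      rcases h4 with ⟨r', hr'⟩
      omega

/-- Going down by `L` leads from `u` to a vertex `b` of value 1. There `[L b, b)` is the radical of
the next projective module, and `rightEnd` retraces the path from `b` up to `u`. -/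
theorem exists_cosyzygySeq_eq (h : IsBoundKupisch n m d L) {q : ℕ} (hq : q ≤ n)
    (hA : ∀ b < q, L (b + 1) ≤ L b + 1) {t u : ℕ} (hu : u < q) (ht : pdS L u = 2 * t + 1) :
    ∃ b, 0 < b ∧ b < q ∧ L (b + 1) = L b ∧ cosyzygySeq n L (L b) b (2 * t + 1) = u := by
  induction t generalizing u with
  | zero =>
    have h0 : u ≠ 0 := by rintro rfl; rw [pdS_zero] at ht; omega
    rcases h.pdS_cases (by omega) (hA u hu) with h1 | h1
    · exact ⟨u, by omega, hu, h1.1, rfl⟩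
    · omega
  | succ t ih =>
    obtain ⟨h1, h2⟩ := h.lift_of_odd hA hu (by omega)
    have h3 : L u ≤ u := by
      have := h.mono (Nat.le_succ u)
      have := h.lt (Nat.succ_pos u)
      simp only [Nat.succ_eq_add_one] at *
      omega
    obtain ⟨b, hb0, hbq, hb, hseq⟩ := ih (u := L u) (by omega) (by omega)
    refine ⟨b, hb0, hbq, hb, ?_⟩
    rw [show 2 * (t + 1) + 1 = 2 * t + 1 + 2 by ring, cosyzygySeq, hseq]
    exact rightEnd_eq h.toIsKupisch (by omega) le_rfl fun _ => by omega

/-- By `exists_cosyzygySeq_eq` the iterates of `rightEnd` at `u` are terms of the cosyzygy sequence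
of a non-injective projective module, at the index `pdS L u + 2 * i`. Dominant dimension `d` makes
all terms with index below `d` socles of projective modules. -/
theorem isProjSocle_iterate (h : IsBoundKupisch n m d L)
    (hD : ∀ b, 0 < b → b ≤ n → DomDimInterval n L d (L b) b) {q : ℕ} (hq : q ≤ n)
    (hA : ∀ b < q, L (b + 1) ≤ L b + 1) {u : ℕ} (hu : u < q) (ho : Odd (pdS L u)) {i : ℕ}
    (hi : pdS L u + 2 * i < d) : IsProjSocle n L ((rightEnd n L)^[i] u) := by
  obtain ⟨t, ht⟩ := ho
  obtain ⟨b, hb0, hbq, hb, hseq⟩ := h.exists_cosyzygySeq_eq hq hA hu ht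
  have h1 : ∀ i, cosyzygySeq n L (L b) b (2 * t + 1 + 2 * i) = (rightEnd n L)^[i] u := by
    intro i
    induction i with
    | zero => exact hseq
    | succ i ih =>
      rw [show 2 * t + 1 + 2 * (i + 1) = 2 * t + 1 + 2 * i + 2 by ring, cosyzygySeq, ih,
        Function.iterate_succ_apply']
  rw [← h1]
  have h2 : b + 1 ≤ rightEnd n L (L b) := le_rightEnd (by omega) hb.le
  exact (h.cosyzygySeq_lt (by omega) hb0 h2 (hD b hb0 (by omega)) d le_rfl).2 _ (by omega)

theorem pdS_lt_of_consecutive (h : IsBoundKupisch n m d L)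
    (hD : ∀ b, 0 < b → b ≤ n → DomDimInterval n L d (L b) b) {q : ℕ} (hq : q ≤ n)
    (hA : ∀ b < q, L (b + 1) ≤ L b + 1) {u s : ℕ} (hu : u + 1 < q) (ho : Odd (pdS L u))
    (ho' : Odd (pdS L (u + 1))) (hs : L s + (m + 1) = s) (hsR : s < rightEnd n L (u + 1)) :
    pdS L u < pdS L (u + 1) := by
  by_contra hcon
  have hsn : s ≤ n := hsR.le.trans (rightEnd_le _)
  have hR : ∀ x ≤ n, x ≤ rightEnd n L x := fun x hx => le_rightEnd hx (by
    rcases Nat.eq_zero_or_pos x with rfl | h0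
    · rw [h.zero]
    · exact (h.lt h0).le)
  -- Under `hcon`, the bound needed for pushing up `u` also covers `u + 1`. The two vertices stay
  -- adjacent, and the value at the lower one grows by two each time.
  have key : ∀ i, (i = 0 ∨ pdS L u + 2 * (i - 1) < d) →
      (rightEnd n L)^[i] (u + 1) = (rightEnd n L)^[i] u + 1 ∧
        pdS L ((rightEnd n L)^[i] u) = pdS L u + 2 * i ∧
        s < rightEnd n L ((rightEnd n L)^[i] (u + 1)) ∧ (rightEnd n L)^[i] (u + 1) ≤ n := by
    intro i
    induction i with
    | zero => exact fun _ => ⟨rfl, rfl, hsR, by simp; omega⟩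
    | succ i ih =>
      intro hi
      have hi' : pdS L u + 2 * i < d := by simpa using hi
      obtain ⟨h1, h2, h3, h4⟩ := ih (by omega)
      have h5 := h.isProjSocle_iterate hD hq hA (by omega) ho hi'
      have h6 := h.isProjSocle_iterate hD hq hA hu ho' (i := i) (by omega)
      rw [Function.iterate_succ_apply', Function.iterate_succ_apply']
      generalize (rightEnd n L)^[i] u = U at *
      rw [h1] at h3 h4 h6 ⊢
      have h7 := h.map_rightEnd h5
      have h8 := h.map_rightEnd h6
      have h9 := rightEnd_le (n := n) (L := L) (U + 1)
      -- This right end lies above the summit `s`, where `L` is strictly increasing; hence the right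
      -- ends of `U` and `U + 1` are adjacent again.
      have h10 := h.desc s hsn hs (rightEnd n L (U + 1) - 1) (by omega) (by omega)
      rw [Nat.sub_add_cancel (by omega)] at h10
      have h11 := le_rightEnd (n := n) (L := L) (a := U) (b := rightEnd n L (U + 1) - 1)
        (by omega) (by omega)
      have h12 : rightEnd n L U < rightEnd n L (U + 1) := by
        by_contra hc
        have := h.mono (not_lt.mp hc)
        omega
      have h13 : rightEnd n L (U + 1) = rightEnd n L U + 1 := by omega
      refine ⟨h13, ?_, ?_, h9⟩
      · rw [h13] at h8
        rcases h.pdS_cases (u := rightEnd n L U) (by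
          have := hR U (by omega)
          rcases Nat.eq_zero_or_pos U with h0 | h0
          · rw [h0, pdS_zero] at h2
            have := ho.pos
            omega
          · omega) (by omega) with h14 | h14
        · omega
        · rw [h14.2, h7, h2]; ring
      · exact h3.trans_le (hR _ h9)
  have h1 := h.pdS_lt_of_odd (by omega) ho
  obtain ⟨r, hr⟩ := ho
  obtain ⟨r', hr'⟩ := h.even
  -- With `pdS L u = 2 * r + 1` and `d = 2 * r'`, this many steps lead to the value `d + 1`.
  obtain ⟨h2, h3, -, h5⟩ := key (r' - r) (by omega)
  have := h.pdS_le (u := (rightEnd n L)^[r' - r] u) (by omega)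
  omega

/-- Take the first gap `p` among the socles of projective modules above the socle of a summit. Odd
vertices below `p + m` are such socles, so `p` is even, and closedness gives it the value `d`. Even
values increase along the quiver in this range, so all later vertices below `p + m` are odd. -/
theorem exists_isPlus_of_domDimInterval (h : IsBoundKupisch n m d L)
    (hD : ∀ b, 0 < b → b ≤ n → DomDimInterval n L d (L b) b) : ∃ p, IsPlus n m L p := by
  have hm := h.two_le
  obtain ⟨s, hsn, hs⟩ := h.summit
  have hex : ∃ v, L s < v ∧ ¬ IsProjSocle n L v := by
    refine ⟨n - 1, by omega, ?_⟩
    rintro ⟨b, hb, -, hb'⟩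
    have := h.mono hb
    have := h.add_two_le n (by omega)
    omega
  classical
  obtain ⟨hp1, hgap⟩ := Nat.find_spec hex
  have hmin : ∀ v, L s < v → v < Nat.find hex → IsProjSocle n L v := fun v h1 h2 => by
    by_contra hc
    exact Nat.find_min hex h2 ⟨h1, hc⟩
  have hpn : Nat.find hex ≤ n - 1 := by
    refine Nat.find_le ⟨by omega, ?_⟩
    rintro ⟨b, hb, -, hb'⟩
    have := h.mono hb
    have := h.add_two_le n (by omega)
    omega
  generalize Nat.find hex = p at hp1 hgap hmin hpn
  -- Above `s` the function `L` increases strictly and skips no value before `p`, so all these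
  -- projective modules are summits.
  have htr : ∀ t, L s + t < p → s + t ≤ n ∧ L (s + t) = L s + t := by
    intro t
    induction t with
    | zero => exact fun _ => ⟨hsn, rfl⟩
    | succ t ih =>
      intro ht
      obtain ⟨h1, h2⟩ := ih (by omega)
      obtain ⟨b, hb, -, hb'⟩ := hmin (L s + (t + 1)) (by omega) ht
      have h3 : s + t < b := by
        by_contra hc
        have := h.mono (not_lt.mp hc)
        omega
      have h4 := h.desc s hsn hs (s + t) (by omega) (by omega)
      have h5 := h.mono (show s + t + 1 ≤ b by omega)
      rw [← add_assoc]
      omega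
  obtain ⟨hq, htop⟩ := htr (p - L s - 1) (by omega)
  rw [show s + (p - L s - 1) = p + m by omega] at hq htop
  have htop' : L (p + m) + 1 = p := by omega
  have hA := h.asc _ hq (by omega)
  have hR : rightEnd n L p = p + m := rightEnd_eq h.toIsKupisch hq (by omega) fun hlt => by
    have h1 := h.desc (p + m) hq (by omega) (p + m) le_rfl hlt
    refine lt_of_le_of_ne (by omega) fun he => hgap ⟨p + m + 1, hlt, by omega, he.symm⟩
  have hsoc : ∀ u < p + m, Odd (pdS L u) → IsProjSocle n L u := fun u hu ho =>
    h.isProjSocle_iterate hD hq hA hu ho (i := 0) (by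
      simpa using h.pdS_lt_of_odd (by omega) ho)
  have hpe : Even (pdS L p) := by
    rw [← Nat.not_odd_iff_even]
    exact fun ho => hgap (hsoc p (by omega) ho)
  obtain ⟨c, hc1, hc2, hc3, hc4⟩ := (h.closed p (by omega)).resolve_left hgap
  have hcq : c ≤ p + m := hR ▸ le_rightEnd hc2 hc3
  have hpd : pdS L p = d := by
    have := h.pdI_le_pdS_of_even hA hc1 hcq hpe
    have := h.pdS_le (u := p) (by omega)
    omega
  have hodd : ∀ u, p < u → u < p + m → Odd (pdS L u) := by
    intro u hu hu'
    rw [← Nat.not_even_iff_odd]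
    intro he
    have := h.pdS_lt_of_even hA hu' hu he
    have := h.pdS_le (u := u) (by omega)
    omega
  -- If `p - 1` were even, its value would be at most `d - 2`, and modules with socle `p` would have
  -- projective dimension at most `d - 1`.
  have hp1o : Odd (pdS L (p - 1)) := by
    rw [← Nat.not_even_iff_odd]
    intro he
    have h1 := h.pdI_succ_le_of_even hA (v := p - 1) (by omega) hcq he
    rw [Nat.sub_add_cancel (by omega)] at h1
    have h2 := h.pdS_lt_of_even hA (u := p - 1) (v := p) (by omega) (by omega) hpe
    obtain ⟨r, hr⟩ := h.even
    obtain ⟨r', hr'⟩ := he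
    omega
  have hpY : pdI L p (p + m) = 1 + pdS L (p - 1) := by
    rw [pdI_step (by omega) (by omega), pdS, show L (p + m) = p - 1 by omega,
      Nat.sub_add_cancel (by omega)]
  have hincr : ∀ u, p < u → u + 1 < p + m → pdS L u < pdS L (u + 1) := by
    intro u hu hu'
    refine h.pdS_lt_of_consecutive hD hq hA hu' (hodd u hu (by omega))
      (hodd _ (by omega) hu') (s := p + m) (by omega) ?_
    obtain ⟨b, hb, -, hb'⟩ := hsoc (u + 1) hu' (hodd _ (by omega) hu')
    have h1 := le_rightEnd hb hb'.le
    by_contra hc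
    have := h.mono (show b ≤ p + m by omega)
    omega
  -- If this failed, the top would have value larger than 1, hence two more than that of `L (p + m -
  -- 1) = p - 2`. But `p - 2` and `p - 1` are then adjacent odd vertices with increasing values; the
  -- summit used here is `p + m - 1`.
  have hlast : pdS L (p + m - 1) < 1 + pdS L (p - 1) := by
    by_contra hc
    have h1 := hodd (p + m - 1) (by omega) (by omega)
    have h0 := hp1o.pos
    obtain ⟨h2, h3⟩ := h.lift_of_odd hA (u := p + m - 1) (by omega) (by omega)
    rw [Nat.sub_add_cancel (by omega)] at h2
    have h4 : Odd (pdS L (L (p + m - 1))) := by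
      rw [h3] at h1
      rcases h1 with ⟨r, hr⟩
      exact ⟨r - 1, by omega⟩
    have h5 := h.pdS_lt_of_consecutive hD hq hA (u := L (p + m - 1)) (s := p + m - 1) (by omega)
      h4 (by rwa [show L (p + m - 1) + 1 = p - 1 by omega]) (by omega) (by
        rw [show L (p + m - 1) + 1 = p - 1 by omega]
        have := le_rightEnd (n := n) (L := L) (a := p - 1) hq (by omega)
        omega)
    rw [show L (p + m - 1) + 1 = p - 1 by omega] at h5
    obtain ⟨r, hr⟩ := h4
    obtain ⟨r', hr'⟩ := hp1o
    omega
  refine ⟨p, hq, hpe, hodd, hincr, ?_, ?_⟩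
  · rw [hpY]; exact odd_one.add_odd hp1o
  · intro u hu hu'
    rw [hpY]
    have hmon : ∀ i, p < p + m - 1 - i → pdS L (p + m - 1 - i) ≤ pdS L (p + m - 1) := by
      intro i
      induction i with
      | zero => exact fun _ => le_rfl
      | succ i ih =>
        intro hi
        have h1 := ih (by omega)
        have h2 := hincr (p + m - 1 - (i + 1)) hi (by omega)
        rw [show p + m - 1 - (i + 1) + 1 = p + m - 1 - i by omega] at h2
        omega
    have := hmon (p + m - 1 - u) (by omega)
    rw [show p + m - 1 - (p + m - 1 - u) = u by omega] at this
    omega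

end IsBoundKupisch

end Nakayama

/-! ### Paths in a linear Nakayama algebra and its Kupisch function. -/

namespace Nakayama

/-- The matrix unit `(i, j)`. -/
def matrixUnit (k : Type u) [Field k] {n : ℕ} (i j : Fin n) (h : i ≤ j) : upperTriangular k n :=
  ⟨Matrix.single i j 1, by
    intro a b hab
    refine Matrix.single_apply_of_ne _ _ _ _ _ ?_
    rintro ⟨rfl, rfl⟩
    exact absurd hab (not_lt.mpr h)⟩

theorem eq_sum_matrixUnit {k : Type u} [Field k] {n : ℕ} (x : upperTriangular k n) :
    x = ∑ i : Fin n, ∑ j : Fin n, if h : i ≤ j then x.1 i j • matrixUnit k i j h else 0 := by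
  apply Subtype.ext
  conv_lhs => rw [Matrix.matrix_eq_sum_single x.1]
  rw [AddSubmonoidClass.coe_finsetSum]
  refine Finset.sum_congr rfl fun i _ => ?_
  rw [AddSubmonoidClass.coe_finsetSum]
  refine Finset.sum_congr rfl fun j _ => ?_
  split_ifs with h
  · simp [matrixUnit]
  · rw [x.2 i j (not_le.mp h)]
    simp

namespace LinearNakayama

variable {k A : Type u} [Field k] [Ring A] [Algebra k A] (N : LinearNakayama k A)

/-- The image in `A` of the path from the vertex `b - 1` to the vertex `a`. -/
def path (a b : ℕ) : A :=
  if h : a < b ∧ b ≤ N.n then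
    N.proj (matrixUnit k ⟨a, by omega⟩ ⟨b - 1, by omega⟩ (Fin.mk_le_mk.mpr (by omega)))
  else 0

/-- The function describing the socles of the indecomposable projective modules. -/
noncomputable def soc (b : ℕ) : ℕ := if b ≤ N.n then sInf {a | N.path a b ≠ 0} else b - 2

variable {N}

theorem path_eq_zero {a b : ℕ} (h : b ≤ a) : N.path a b = 0 := dif_neg (by omega)

theorem path_eq_zero' {a b : ℕ} (h : N.n < b) : N.path a b = 0 := dif_neg (by omega)

theorem path_mul_path {s t b : ℕ} (hs : s ≤ t) (ht : t < b) :
    N.path s (t + 1) * N.path t b = N.path s b := by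
  by_cases hb : b ≤ N.n
  · rw [path, path, path, dif_pos (by omega), dif_pos (by omega), dif_pos (by omega), ← map_mul]
    congr 1
    apply Subtype.ext
    change Matrix.single _ _ _ * Matrix.single _ _ _ = Matrix.single _ _ _
    have : (⟨t + 1 - 1, by omega⟩ : Fin N.n) = ⟨t, by omega⟩ := Fin.ext (by simp)
    rw [this, Matrix.single_mul_single_same, mul_one]
  · rw [path_eq_zero' (N := N) (a := t) (not_le.mp hb), path_eq_zero' (not_le.mp hb), mul_zero]

theorem path_mul_path_of_ne {s t' t b : ℕ} (h : t' ≠ t + 1) :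
    N.path s t' * N.path t b = 0 := by
  rw [path, path]
  split_ifs with h1 h2
  · rw [← map_mul]
    convert map_zero N.proj
    apply Subtype.ext
    change Matrix.single _ _ _ * Matrix.single _ _ _ = 0
    rw [Matrix.single_mul_single_of_ne]
    intro h3
    have := congrArg Fin.val h3
    simp only at this
    omega
  all_goals simp

theorem path_succ_eq_idem (i : Fin N.n) : N.path i (i + 1) = N.proj (idem k i) := by
  rw [path, dif_pos (by omega)]
  congr 1

theorem one_eq_sum : (1 : A) = ∑ t ∈ Finset.range N.n, N.path t (t + 1) := by
  rw [Finset.sum_range, ← map_one N.proj]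
  have : (1 : upperTriangular k N.n) = ∑ i : Fin N.n, idem k i := by
    apply Subtype.ext
    rw [AddSubmonoidClass.coe_finsetSum]
    exact (Matrix.sum_single_one).symm
  rw [this, map_sum]
  exact Finset.sum_congr rfl fun i _ => (path_succ_eq_idem i).symm

theorem induction {p : A → Prop} (hadd : ∀ a b, p a → p b → p (a + b)) (h0 : p 0)
    (hsmul : ∀ (c : k) a, p a → p (c • a)) (hpath : ∀ s t, s ≤ t → t < N.n → p (N.path s (t + 1)))
    (a : A) : p a := by
  obtain ⟨x, rfl⟩ := N.surjective a
  rw [eq_sum_matrixUnit x, map_sum]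
  refine Finset.sum_induction _ p hadd h0 fun i _ => ?_
  rw [map_sum]
  refine Finset.sum_induction _ p hadd h0 fun j _ => ?_
  split_ifs with h
  · rw [map_smul]
    refine hsmul _ _ ?_
    have := hpath i j h j.2
    rw [path, dif_pos ⟨Nat.lt_succ_of_le h, j.2⟩] at this
    exact this
  · rw [map_zero]
    exact h0

theorem path_ne_zero_of_le {a b : ℕ} (h : a < b) (hb : b ≤ N.n) (hab : b ≤ a + 2) :
    N.path a b ≠ 0 := by
  rw [path, dif_pos ⟨h, hb⟩]
  intro h0
  have := N.admissible _ h0 ⟨a, by omega⟩ ⟨b - 1, by omega⟩ (by simp only; omega)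
  simp [matrixUnit] at this

/-- A longer path is a multiple of each of its final pieces, so non-vanishing passes from `a` to
every larger starting point below `b`. -/
theorem path_ne_zero_iff {a b : ℕ} (h : a < b) (hb : b ≤ N.n) :
    N.path a b ≠ 0 ↔ N.soc b ≤ a := by
  rw [soc, if_pos hb]
  constructor
  · exact fun h => Nat.sInf_le h
  · intro hle h0
    have hne : {a | N.path a b ≠ 0}.Nonempty :=
      ⟨b - 1, path_ne_zero_of_le (by omega) hb (by omega)⟩
    refine Nat.sInf_mem hne ?_
    rw [← path_mul_path hle h, h0, mul_zero]

theorem soc_zero : N.soc 0 = 0 := by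
  rw [soc, if_pos (Nat.zero_le _)]
  simp [path_eq_zero]

/-- Admissibility gives the gap of two inside the quiver. Beyond `N.n` the default value `b - 2` of
`soc` keeps both monotonicity and the gap, so that no range condition is needed. -/
theorem isKupisch : IsKupisch N.soc where
  one := by
    have := (path_ne_zero_iff one_pos N.pos).mp (path_ne_zero_of_le one_pos N.pos (by omega))
    omega
  add_two_le b hb := by
    by_cases hbn : b ≤ N.n
    · have := (path_ne_zero_iff (a := b - 2) (by omega) hbn).mp
        (path_ne_zero_of_le (by omega) hbn (by omega))
      omega
    · rw [soc, if_neg hbn]; omega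
  mono := by
    refine monotone_nat_of_le_succ fun b => ?_
    by_cases hbn : b + 1 ≤ N.n
    · by_contra hcon
      rw [not_le] at hcon
      have h1 : N.soc b < b := by
        rcases Nat.eq_zero_or_pos b with rfl | h0
        · rw [soc_zero] at hcon
          omega
        · have := (path_ne_zero_iff (N := N) (a := b - 1) (b := b) (by omega) (by omega)).mp
            (path_ne_zero_of_le (by omega) (by omega) (by omega))
          omega
      have h2 := (path_ne_zero_iff (N := N) (a := N.soc (b + 1)) (b := b + 1) (by omega) hbn).mpr
        le_rfl
      have h3 := (path_ne_zero_iff (N := N) (a := N.soc (b + 1)) (b := b) (by omega)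
        (by omega)).not.mpr (by omega)
      rw [not_not] at h3
      apply h2
      obtain ⟨b, rfl⟩ : ∃ b', b = b' + 1 := ⟨b - 1, by omega⟩
      rw [← path_mul_path (s := N.soc (b + 1 + 1)) (t := b) (b := b + 1 + 1) (by omega) (by omega),
        h3, zero_mul]
    · rw [soc, soc, if_neg hbn]
      split_ifs with h
      · rcases Nat.lt_or_ge b 2 with h2 | h2
        · have h1 : b = 1 ∨ b = 0 := by omega
          rcases h1 with rfl | rfl
          · have := (path_ne_zero_iff (N := N) one_pos N.pos).mp
              (path_ne_zero_of_le one_pos N.pos (by omega))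
            rw [soc, if_pos h] at this
            omega
          · have := N.pos; omega
        · have := (path_ne_zero_iff (a := b - 2) (by omega) h).mp
            (path_ne_zero_of_le (by omega) h (by omega))
          rw [soc, if_pos h] at this
          omega
      · omega

end LinearNakayama

/-! ### Interval modules, their submodules and homomorphisms into them. -/

open LinearNakayama

variable {k A : Type u} [Field k] [Ring A] [Algebra k A]

/-- The elements `z a, …, z (b - 1)` of `M` are a basis of a submodule which is an interval module
with the vertices `a, …, b - 1`. -/
structure IsIntervalFamily (N : LinearNakayama k A) {M : Type u} [AddCommGroup M] [Module A M]
    (a b : ℕ) (z : ℕ → M) : Prop where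
  lt : a < b
  le : b ≤ N.n
  ne_zero : ∀ t, a ≤ t → t < b → z t ≠ 0
  eq_zero : ∀ t, t < a → z t = 0
  smul : ∀ s t, s ≤ t → t < b → N.path s (t + 1) • z t = z s
  smul_ne : ∀ s t t', t < b → t' ≠ t + 1 → N.path s t' • z t = 0

/-- The elements `z a, …, z (b - 1)` are a basis of `M` exhibiting `M` as the interval module with
the vertices `a, …, b - 1`. -/
structure IsIntervalBasis (N : LinearNakayama k A) {M : Type u} [AddCommGroup M] [Module A M]
    (a b : ℕ) (z : ℕ → M) : Prop extends IsIntervalFamily N a b z where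
  span : Submodule.span A (z '' Set.Iio b) = ⊤

/-- `M` is an interval module with the vertices `a, …, b - 1`. -/
def IsInterval (N : LinearNakayama k A) (M : Type u) [AddCommGroup M] [Module A M]
    (a b : ℕ) : Prop := ∃ z : ℕ → M, IsIntervalBasis N a b z

namespace IsIntervalFamily

variable {N : LinearNakayama k A} {M : Type u} [AddCommGroup M] [Module A M] {a b : ℕ} {z : ℕ → M}

/-- The submodule with vertices below `c`. -/
def below (A : Type u) [Ring A] {M : Type u} [AddCommGroup M] [Module A M] (z : ℕ → M) (c : ℕ) :
    Submodule A M := Submodule.span A (z '' Set.Iio c)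

/-- Paths send each `z t` to some `z s` or to zero, so the span over the ground field is already a
submodule. Scalars act through `algebraMap`, because `M` only carries its structure over `A`. -/
theorem exists_coeff (hz : IsIntervalFamily N a b z) {c : ℕ} (hc : c ≤ b) {y : M}
    (hy : y ∈ below A z c) :
    ∃ x : ℕ → k, y = ∑ t ∈ Finset.range c, algebraMap k A (x t) • z t := by
  induction hy using Submodule.span_induction with
  | mem y hy =>
    obtain ⟨t, ht, rfl⟩ := hy
    refine ⟨Pi.single t 1, ?_⟩
    rw [Finset.sum_eq_single_of_mem t (Finset.mem_range.mpr ht)]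
    · simp
    · intro s _ hst
      simp [Pi.single_eq_of_ne hst]
  | zero => exact ⟨0, by simp⟩
  | add y y' _ _ h h' =>
    obtain ⟨x, rfl⟩ := h
    obtain ⟨x', rfl⟩ := h'
    exact ⟨x + x', by simp [add_smul, Finset.sum_add_distrib]⟩
  | smul r y _ h =>
    obtain ⟨x, rfl⟩ := h
    induction r using N.induction with
    | hadd r r' h h' =>
      obtain ⟨y, hy⟩ := h
      obtain ⟨y', hy'⟩ := h'
      exact ⟨y + y', by simp [add_smul, Finset.sum_add_distrib, hy, hy']⟩
    | h0 => exact ⟨0, by simp⟩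
    | hsmul w r h =>
      obtain ⟨y, hy⟩ := h
      refine ⟨w • y, ?_⟩
      rw [Algebra.smul_def, mul_smul, hy, Finset.smul_sum]
      simp [mul_smul]
    | hpath s t hst ht =>
      by_cases htc : t < c
      · refine ⟨Pi.single s (x t), ?_⟩
        rw [Finset.smul_sum, Finset.sum_eq_single_of_mem t (Finset.mem_range.mpr htc),
          Finset.sum_eq_single_of_mem s (Finset.mem_range.mpr (by omega)), ← mul_smul,
          ← Algebra.commutes, mul_smul, hz.smul s t hst (by omega)]
        · simp
        · intro r _ hr
          simp [Pi.single_eq_of_ne hr]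
        · intro r hr hrt
          rw [← mul_smul, ← Algebra.commutes, mul_smul,
            hz.smul_ne s r (t + 1) (by have := Finset.mem_range.mp hr; omega) (by omega), smul_zero]
      · refine ⟨0, ?_⟩
        rw [Finset.smul_sum]
        simp only [Pi.zero_apply, map_zero, zero_smul, Finset.sum_const_zero]
        refine Finset.sum_eq_zero fun r hr => ?_
        rw [← mul_smul, ← Algebra.commutes, mul_smul,
          hz.smul_ne s r (t + 1) (by have := Finset.mem_range.mp hr; omega)
            (by have := Finset.mem_range.mp hr; omega), smul_zero]

theorem _root_.Nakayama.IsIntervalBasis.mem_top (hz : IsIntervalBasis N a b z) (y : M) : y ∈ below A z b := by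
  rw [below, hz.span]; trivial

theorem idem_smul_sum (hz : IsIntervalFamily N a b z) {c s t : ℕ} (hc : c ≤ b) (hs : s ≤ t)
    (htc : t < c) (x : ℕ → k) :
    N.path s (t + 1) • ∑ t ∈ Finset.range c, algebraMap k A (x t) • z t =
      algebraMap k A (x t) • z s := by
  rw [Finset.smul_sum, Finset.sum_eq_single_of_mem t (Finset.mem_range.mpr htc), ← mul_smul,
    ← Algebra.commutes, mul_smul, hz.smul s t hs (by omega)]
  intro r hr hrt
  rw [← mul_smul, ← Algebra.commutes, mul_smul,
    hz.smul_ne s r (t + 1) (by have := Finset.mem_range.mp hr; omega) (by omega), smul_zero]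

theorem smul_eq_zero_of_mem_below (hz : IsIntervalFamily N a b z) {c s t : ℕ} (hc : c ≤ b)
    (ht : c ≤ t) {y : M} (hy : y ∈ below A z c) : N.path s (t + 1) • y = 0 := by
  obtain ⟨x, rfl⟩ := hz.exists_coeff hc hy
  rw [Finset.smul_sum]
  refine Finset.sum_eq_zero fun r hr => ?_
  rw [← mul_smul, ← Algebra.commutes, mul_smul,
    hz.smul_ne s r (t + 1) (by have := Finset.mem_range.mp hr; omega)
      (by have := Finset.mem_range.mp hr; omega), smul_zero]

theorem mem_below_iff (hz : IsIntervalFamily N a b z) {c t : ℕ} (hc : c ≤ b) (hta : a ≤ t)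
    (htb : t < b) : z t ∈ below A z c ↔ t < c := by
  constructor
  · intro h
    by_contra hc'
    have := hz.smul_eq_zero_of_mem_below (s := t) hc (not_lt.mp hc') h
    rw [hz.smul t t le_rfl htb] at this
    exact hz.ne_zero t hta htb this
  · exact fun h => Submodule.subset_span ⟨t, h, rfl⟩

theorem below_mono {c c' : ℕ} (h : c ≤ c') : below A z c ≤ below A z c' :=
  Submodule.span_mono (Set.image_mono (Set.Iio_subset_Iio h))

theorem below_eq_bot (hz : IsIntervalFamily N a b z) {c : ℕ} (hc : c ≤ a) : below A z c = ⊥ := by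
  rw [below, Submodule.span_eq_bot]
  rintro _ ⟨t, ht, rfl⟩
  exact hz.eq_zero t (lt_of_lt_of_le ht hc)

/-- The submodules of an interval module form a chain. -/
theorem _root_.Nakayama.IsIntervalBasis.exists_eq_below (hz : IsIntervalBasis N a b z) (V : Submodule A M) :
    ∃ c, a ≤ c ∧ c ≤ b ∧ V = below A z c := by
  classical
  -- Let `c` be the first vertex with `z c` outside `V`. An element of `V` with non-zero coefficient
  -- at some `t ≥ c` would be moved by the path from `t` to `c` to a non-zero multiple of `z c`.
  have hex : ∃ c, c = b ∨ (a ≤ c ∧ z c ∉ V) := ⟨b, .inl rfl⟩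
  have hlt : ∀ t, t < Nat.find hex → z t ∈ V := by
    intro t ht
    have := Nat.find_min hex ht
    rw [not_or, not_and, not_not] at this
    by_cases hta : a ≤ t
    · exact this.2 hta
    · rw [hz.eq_zero t (not_le.mp hta)]; exact V.zero_mem
  have hle : Nat.find hex ≤ b := Nat.find_le (.inl rfl)
  have hsp := Nat.find_spec hex
  have hlb := hz.lt
  generalize Nat.find hex = c at hlt hle hsp
  refine ⟨c, by omega, hle, le_antisymm ?_ ?_⟩
  · intro y hy
    obtain ⟨x, rfl⟩ := hz.exists_coeff le_rfl (hz.mem_top y)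
    refine Submodule.sum_mem _ fun t ht => ?_
    have htb := Finset.mem_range.mp ht
    rcases Nat.lt_or_ge t c with htc | htc
    · exact Submodule.smul_mem _ _ (Submodule.subset_span ⟨t, htc, rfl⟩)
    · have hcz : z c ∉ V := by
        rcases hsp with h | h
        · omega
        · exact h.2
      have h1 := V.smul_mem (N.path c (t + 1)) hy
      rw [hz.idem_smul_sum le_rfl htc htb] at h1
      have h2 : x t = 0 := by
        by_contra hx
        apply hcz
        have := V.smul_mem (algebraMap k A (x t)⁻¹) h1
        rwa [← mul_smul, ← map_mul, inv_mul_cancel₀ hx, map_one, one_smul] at this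
      rw [h2, map_zero, zero_smul]
      exact Submodule.zero_mem _
  · rw [below, Submodule.span_le]
    rintro _ ⟨t, ht, rfl⟩
    exact hlt t ht

theorem isInterval_below (hz : IsIntervalFamily N a b z) {c : ℕ} (hac : a < c) (hcb : c ≤ b) :
    IsInterval N (below A z c) a c := by
  classical
  have hmem : ∀ t, t < c → z t ∈ below A z c := fun t ht => Submodule.subset_span ⟨t, ht, rfl⟩
  refine ⟨fun t => if h : t < c then ⟨z t, hmem t h⟩ else 0, ⟨⟨hac, hcb.trans hz.le, ?_, ?_, ?_, ?_⟩,
    ?_⟩⟩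
  · intro t h1 h2
    rw [dif_pos h2, Ne, Subtype.ext_iff]
    exact hz.ne_zero t h1 (by omega)
  · intro t h
    rw [dif_pos (by omega), Subtype.ext_iff]
    exact hz.eq_zero t h
  · intro s t hst ht
    rw [dif_pos ht, dif_pos (by omega), Subtype.ext_iff]
    exact hz.smul s t hst (by omega)
  · intro s t t' ht ht'
    rw [dif_pos ht, Subtype.ext_iff]
    exact hz.smul_ne s t t' (by omega) ht'
  · rw [eq_top_iff]
    rintro ⟨y, hy⟩ -
    have h1 : y ∈ (Submodule.span A ((fun t => if h : t < c then
        (⟨z t, hmem t h⟩ : below A z c) else 0) '' Set.Iio c)).map (below A z c).subtype := by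
      rw [Submodule.map_span]
      refine Submodule.span_mono ?_ hy
      rintro _ ⟨t, ht, rfl⟩
      have ht' : t < c := ht
      exact ⟨_, ⟨t, ht, rfl⟩, by simp [ht']⟩
    obtain ⟨⟨y', hy'⟩, h2, rfl⟩ := h1
    exact h2

theorem _root_.Nakayama.IsIntervalBasis.isInterval_quotient (hz : IsIntervalBasis N a b z) {c : ℕ} (hac : a ≤ c) (hcb : c < b) :
    IsInterval N (M ⧸ below A z c) c b := by
  refine ⟨fun t => (below A z c).mkQ (z t), ⟨⟨hcb, hz.le, ?_, ?_, ?_, ?_⟩, ?_⟩⟩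
  · intro t h1 h2
    rw [Submodule.mkQ_apply, Ne, Submodule.Quotient.mk_eq_zero,
      hz.mem_below_iff hcb.le (by omega) h2]
    omega
  · intro t ht
    rw [Submodule.mkQ_apply, Submodule.Quotient.mk_eq_zero]
    exact Submodule.subset_span ⟨t, ht, rfl⟩
  · intro s t hs ht
    rw [← map_smul, hz.smul s t hs ht]
  · intro s t t' ht ht'
    rw [← map_smul, hz.smul_ne s t t' ht ht', map_zero]
  · have := congrArg (Submodule.map (below A z c).mkQ) hz.span
    rw [Submodule.map_span, Submodule.map_top, Submodule.range_mkQ, ← Set.image_comp] at this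
    exact this

/-- Homomorphisms to an interval module are given by linear forms. -/
theorem exists_hom (hz : IsIntervalFamily N a b z) {X : Type u} [AddCommGroup X] [Module A X]
    [Module k X] [IsScalarTower k A X] (φ : X →ₗ[k] k)
    (hφ : ∀ t, b ≤ t → ∀ y, φ (N.path a (t + 1) • y) = 0) :
    ∃ f : X →ₗ[A] M, ∀ y, f y =
      ∑ t ∈ Finset.Ico a b, algebraMap k A (φ (N.path a (t + 1) • y)) • z t := by
  have hsm : ∀ (w : k) (r : A) (y : X), φ (r • (w • y)) = w * φ (r • y) := by
    intro w r y
    rw [← algebraMap_smul A w y, ← mul_smul, ← Algebra.commutes, mul_smul, algebraMap_smul,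
      map_smul, smul_eq_mul]
  refine ⟨{ toFun := fun y => ∑ t ∈ Finset.Ico a b, algebraMap k A (φ (N.path a (t + 1) • y)) • z t
            map_add' := ?_
            map_smul' := ?_ }, fun y => rfl⟩
  · intro y y'
    simp [smul_add, add_smul, Finset.sum_add_distrib]
  · intro r
    induction r using N.induction with
    | hadd r r' h h' =>
      intro y
      have h1 := h y
      have h2 := h' y
      simp only [RingHom.id_apply] at h1 h2 ⊢
      rw [add_smul r r' (∑ t ∈ Finset.Ico a b, _), ← h1, ← h2, ← Finset.sum_add_distrib]
      refine Finset.sum_congr rfl fun t _ => ?_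
      rw [add_smul, smul_add, map_add, map_add, add_smul]
    | h0 => intro y; simp
    | hsmul w r h =>
      intro y
      have h1 := h y
      simp only [RingHom.id_apply] at h1 ⊢
      rw [Algebra.smul_def, mul_smul _ r (∑ t ∈ Finset.Ico a b, _), ← h1, Finset.smul_sum]
      refine Finset.sum_congr rfl fun t _ => ?_
      rw [mul_smul _ r y, algebraMap_smul A w (r • y), hsm, map_mul, mul_smul]
    | hpath s t hst ht =>
      intro y
      simp only [RingHom.id_apply]
      rw [Finset.smul_sum]
      have hz0 : ∀ t' ∈ Finset.Ico a b, t' ≠ t → N.path s (t + 1) •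
          algebraMap k A (φ (N.path a (t' + 1) • y)) • z t' = 0 := by
        intro t' ht' hne
        rw [← mul_smul, ← Algebra.commutes, mul_smul, hz.smul_ne s t' (t + 1)
          (by have := Finset.mem_Ico.mp ht'; omega) (by omega), smul_zero]
      have hl0 : ∀ s' ∈ Finset.Ico a b, s' ≠ s →
          algebraMap k A (φ (N.path a (s' + 1) • N.path s (t + 1) • y)) • z s' = 0 := by
        intro s' _ hne
        rw [← mul_smul, path_mul_path_of_ne (by omega), zero_smul, map_zero, map_zero, zero_smul]
      by_cases h1 : s ∈ Finset.Ico a b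
      · have h1' := Finset.mem_Ico.mp h1
        rw [Finset.sum_eq_single_of_mem s h1 hl0, ← mul_smul, path_mul_path h1'.1 (by omega)]
        by_cases h2 : t < b
        · rw [Finset.sum_eq_single_of_mem t (Finset.mem_Ico.mpr ⟨by omega, h2⟩) hz0,
            ← mul_smul, ← Algebra.commutes, mul_smul, hz.smul s t hst h2]
        · rw [hφ t (by omega), map_zero, zero_smul]
          refine (Finset.sum_eq_zero fun t' ht' => hz0 t' ht' ?_).symm
          have := Finset.mem_Ico.mp ht'
          omega
      · rw [Finset.sum_eq_zero fun s' hs' => hl0 s' hs' (by rintro rfl; exact h1 hs')]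
        symm
        refine Finset.sum_eq_zero fun t' ht' => ?_
        by_cases h2 : t' = t
        · subst h2
          have := Finset.mem_Ico.mp ht'
          rw [Finset.mem_Ico] at h1
          rw [← mul_smul, ← Algebra.commutes, mul_smul, hz.smul s t' hst this.2,
            hz.eq_zero s (by omega), smul_zero]
        · exact hz0 t' ht' h2

end IsIntervalFamily

end Nakayama

namespace Nakayama

open CategoryTheory

/-! ### General facts on projective dimension and indecomposability. -/

section Generalities

variable {R : Type u} [Ring R] {M M' : Type u} [AddCommGroup M] [Module R M] [AddCommGroup M']
  [Module R M']

theorem pd_congr (e : M ≃ₗ[R] M') : pd R M = pd R M' :=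
  projectiveDimension_eq_of_iso e.toModuleIso

theorem pd_eq_bot_iff : pd R M = ⊥ ↔ Subsingleton M := by
  rw [pd, projectiveDimension_eq_bot_iff]
  exact ModuleCat.isZero_iff_subsingleton

theorem projective_iff_hasProjectiveDimensionLT :
    Module.Projective R M ↔ HasProjectiveDimensionLT (ModuleCat.of R M) 1 := by
  rw [← projective_iff_hasProjectiveDimensionLT_one, IsProjective.iff_projective]

theorem pd_le_iff (n : ℕ) : pd R M ≤ ((n : ℕ∞) : WithBot ℕ∞) ↔
    HasProjectiveDimensionLT (ModuleCat.of R M) (n + 1) :=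
  projectiveDimension_le_iff _ n

theorem pd_le_zero_iff : pd R M ≤ (((0 : ℕ) : ℕ∞) : WithBot ℕ∞) ↔ Module.Projective R M := by
  rw [pd_le_iff, projective_iff_hasProjectiveDimensionLT]

theorem pd_eq_zero [Nontrivial M] [h : Module.Projective R M] :
    pd R M = (((0 : ℕ) : ℕ∞) : WithBot ℕ∞) := by
  refine le_antisymm (pd_le_zero_iff.mpr h) ?_
  by_contra hcon
  have : pd R M < ((0 : ℕ) : WithBot ℕ∞) := not_le.mp hcon
  rw [pd, projectiveDimension_lt_iff, hasProjectiveDimensionLT_zero_iff_isZero] at this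
  exact not_subsingleton M (ModuleCat.isZero_iff_subsingleton.mp this)

theorem pd_eq_iff (n : ℕ) : pd R M = ((n : ℕ∞) : WithBot ℕ∞) ↔
    HasProjectiveDimensionLT (ModuleCat.of R M) (n + 1) ∧
      ¬ HasProjectiveDimensionLT (ModuleCat.of R M) n := by
  rw [le_antisymm_iff, pd_le_iff]
  exact and_congr_right fun _ => projectiveDimension_ge_iff _ n

theorem shortExact_quotient (V : Submodule R M) :
    (ModuleCat.shortComplexOfCompEqZero V.subtype V.mkQ
      (LinearMap.exact_subtype_mkQ V).linearMap_comp_eq_zero).ShortExact :=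
  ModuleCat.shortComplex_shortExact _ (LinearMap.exact_subtype_mkQ V) V.injective_subtype
    V.mkQ_surjective

theorem pd_quotient [Module.Projective R M] (V : Submodule R M) {m : ℕ}
    (h : ¬ Module.Projective R (M ⧸ V)) (hV : pd R V = ((m : ℕ∞) : WithBot ℕ∞)) :
    pd R (M ⧸ V) = ((m + 1 : ℕ) : ℕ∞) := by
  have h1 := fun n => (shortExact_quotient V).hasProjectiveDimensionLT_X₃_iff n
    ((IsProjective.iff_projective M).mp inferInstance)
  rw [pd_eq_iff] at hV ⊢
  refine ⟨(h1 m).mpr hV.1, ?_⟩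
  rcases m with _ | m
  · rwa [zero_add, ← projective_iff_hasProjectiveDimensionLT]
  · exact fun h2 => hV.2 ((h1 m).mp h2)

theorem indecomposable_iff : Indecomposable (ModuleCat.of R M) ↔
    Nontrivial M ∧ ∀ U V : Submodule R M, IsCompl U V → U = ⊥ ∨ V = ⊥ := by
  rw [Indecomposable, ModuleCat.isZero_iff_subsingleton, ← not_subsingleton_iff_nontrivial]
  refine and_congr Iff.rfl ⟨fun h U V hUV => ?_, fun h Y Z e => ?_⟩
  · have := h (ModuleCat.of R U) (ModuleCat.of R V)
      ((Submodule.prodEquivOfIsCompl U V hUV).symm.toModuleIso ≪≫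
        (ModuleCat.biprodIsoProd (ModuleCat.of R U) (ModuleCat.of R V)).symm)
    rw [ModuleCat.isZero_iff_subsingleton, ModuleCat.isZero_iff_subsingleton] at this
    exact this.imp (fun h => (Submodule.subsingleton_iff_eq_bot).mp h)
      (fun h => (Submodule.subsingleton_iff_eq_bot).mp h)
  · let f : M ≃ₗ[R] Y × Z := (e ≪≫ ModuleCat.biprodIsoProd Y Z).toLinearEquiv
    have hc : IsCompl (LinearMap.ker (LinearMap.snd R Y Z ∘ₗ f.toLinearMap))
        (LinearMap.ker (LinearMap.fst R Y Z ∘ₗ f.toLinearMap)) := by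
      constructor
      · rw [Submodule.disjoint_def]
        intro x h1 h2
        apply f.injective
        rw [map_zero]
        exact Prod.ext h2 h1
      · rw [codisjoint_iff, eq_top_iff]
        intro x _
        rw [Submodule.mem_sup]
        refine ⟨f.symm ((f x).1, 0), by simp, f.symm (0, (f x).2), by simp, ?_⟩
        rw [← map_add]
        simp
    rw [ModuleCat.isZero_iff_subsingleton, ModuleCat.isZero_iff_subsingleton]
    rcases h _ _ hc with h1 | h1
    · left
      refine ⟨fun y y' => ?_⟩
      have h2 : ∀ y : Y, y = 0 := fun y => by
        have : f.symm (y, 0) ∈ LinearMap.ker (LinearMap.snd R Y Z ∘ₗ f.toLinearMap) := by simp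
        rw [h1, Submodule.mem_bot] at this
        simpa using congrArg f this
      rw [h2 y, h2 y']
    · right
      refine ⟨fun y y' => ?_⟩
      have h2 : ∀ y : Z, y = 0 := fun y => by
        have : f.symm (0, y) ∈ LinearMap.ker (LinearMap.fst R Y Z ∘ₗ f.toLinearMap) := by simp
        rw [h1, Submodule.mem_bot] at this
        simpa using congrArg f this
      rw [h2 y, h2 y']

theorem exists_dual_eq_one {k V : Type u} [Field k] [AddCommGroup V] [Module k V] {v : V}
    (hv : v ≠ 0) : ∃ φ : V →ₗ[k] k, φ v = 1 := by
  by_contra! hcon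
  refine hv ((Module.forall_dual_apply_eq_zero_iff k v).mp fun φ => ?_)
  by_contra h0
  refine hcon ((φ v)⁻¹ • φ) ?_
  simp [inv_mul_cancel₀ h0]

end Generalities

variable {k A : Type u} [Field k] [Ring A] [Algebra k A] {N : LinearNakayama k A}

/-! ### The indecomposable modules are the interval modules. -/

section

variable {M M' : Type u} [AddCommGroup M] [Module A M] [AddCommGroup M'] [Module A M'] {a b c : ℕ}

theorem IsInterval.lt (h : IsInterval N M a b) : a < b := by
  obtain ⟨z, hz⟩ := h
  exact hz.lt

theorem IsInterval.le (h : IsInterval N M a b) : b ≤ N.n := by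
  obtain ⟨z, hz⟩ := h
  exact hz.le

theorem IsInterval.soc_le (h : IsInterval N M a b) : N.soc b ≤ a := by
  obtain ⟨z, hz⟩ := h
  have hlt := hz.lt
  rw [← LinearNakayama.path_ne_zero_iff hlt hz.le]
  intro h0
  have h1 := hz.smul a (b - 1) (by omega) (by omega)
  rw [Nat.sub_add_cancel (by omega), h0, zero_smul] at h1
  exact hz.ne_zero a le_rfl hlt h1.symm

theorem IsInterval.nontrivial (h : IsInterval N M a b) : Nontrivial M := by
  obtain ⟨z, hz⟩ := h
  exact ⟨z a, 0, hz.ne_zero a le_rfl hz.lt⟩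

theorem IsInterval.of_equiv (h : IsInterval N M a b) (e : M ≃ₗ[A] M') : IsInterval N M' a b := by
  obtain ⟨z, hz⟩ := h
  refine ⟨fun t => e (z t), ⟨⟨hz.lt, hz.le, ?_, ?_, ?_, ?_⟩, ?_⟩⟩
  · intro t h1 h2 h3
    exact hz.ne_zero t h1 h2 (e.injective (by rw [h3, map_zero]))
  · intro t h1
    rw [hz.eq_zero t h1, map_zero]
  · intro s t h1 h2
    rw [← map_smul, hz.smul s t h1 h2]
  · intro s t t' h1 h2
    rw [← map_smul, hz.smul_ne s t t' h1 h2, map_zero]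
  · have := congrArg (Submodule.map e.toLinearMap) hz.span
    rw [Submodule.map_span, Submodule.map_top, LinearEquiv.range, ← Set.image_comp] at this
    exact this

/-- A linear form with value 1 on the socle element `z a` induces, via `exists_hom`, a homomorphism
carrying one interval basis to the other; it is injective because it does not kill the socle. -/
theorem IsInterval.nonempty_equiv (h : IsInterval N M a b) (h' : IsInterval N M' a b) :
    Nonempty (M ≃ₗ[A] M') := by
  obtain ⟨z, hz⟩ := h
  obtain ⟨z', hz'⟩ := h'
  let _ := Module.compHom M (algebraMap k A)
  have : IsScalarTower k A M := ⟨fun w r x => by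
    rw [Algebra.smul_def, mul_smul]; rfl⟩
  have hlt := hz.lt
  obtain ⟨φ, hφ⟩ := exists_dual_eq_one (k := k) (hz.ne_zero a le_rfl hlt)
  obtain ⟨f, hf⟩ := hz'.exists_hom φ fun t ht y => by
    rw [hz.smul_eq_zero_of_mem_below le_rfl ht (hz.mem_top y), map_zero]
  have hfz : ∀ t, t < b → f (z t) = z' t := by
    intro t ht
    rcases Nat.lt_or_ge t a with hta | hta
    · rw [hz.eq_zero t hta, hz'.eq_zero t hta, map_zero]
    rw [hf, Finset.sum_eq_single_of_mem t (Finset.mem_Ico.mpr ⟨hta, ht⟩),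
      hz.smul a t hta ht, hφ, map_one, one_smul]
    intro s hs hst
    rw [hz.smul_ne a t (s + 1) ht (by omega), map_zero, map_zero, zero_smul]
  refine ⟨LinearEquiv.ofBijective f ⟨?_, ?_⟩⟩
  · rw [← LinearMap.ker_eq_bot]
    obtain ⟨c, hc, hc', hker⟩ := hz.exists_eq_below (LinearMap.ker f)
    rcases hc.eq_or_lt with rfl | hc
    · rw [hker, hz.below_eq_bot le_rfl]
    · have : z a ∈ LinearMap.ker f := by
        rw [hker]
        exact Submodule.subset_span ⟨a, hc, rfl⟩
      rw [LinearMap.mem_ker, hfz a hlt] at this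
      exact absurd this (hz'.ne_zero a le_rfl hlt)
  · rw [← LinearMap.range_eq_top, eq_top_iff, ← hz'.span, Submodule.span_le]
    rintro _ ⟨t, ht, rfl⟩
    exact ⟨z t, hfz t ht⟩

/-- The indecomposable modules are the interval modules. -/
theorem exists_isInterval [Nontrivial M]
    (h : ∀ U V : Submodule A M, IsCompl U V → U = ⊥ ∨ V = ⊥) :
    ∃ a b, IsInterval N M a b := by
  let _ := Module.compHom M (algebraMap k A)
  have : IsScalarTower k A M := ⟨fun w r x => by
    rw [Algebra.smul_def, mul_smul]; rfl⟩
  -- Choose a longest path acting non-trivially on `M`. The element it moves generates an interval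
  -- submodule, and by maximality a linear form on its socle satisfies the hypothesis of
  -- `exists_hom`; the resulting map is a retraction, so the submodule is a direct summand.
  have hex : ∃ l, ∃ s, s + l < N.n ∧ ∃ y : M, N.path s (s + l + 1) • y ≠ 0 := by
    obtain ⟨y, hy⟩ := exists_ne (0 : M)
    by_contra! hcon
    apply hy
    rw [← one_smul A y, LinearNakayama.one_eq_sum (N := N), Finset.sum_smul]
    exact Finset.sum_eq_zero fun t ht => hcon 0 t (Finset.mem_range.mp ht) y
  classical
  obtain ⟨l₀, hl₀⟩ := hex
  have hmax := Nat.findGreatest_spec (P := fun l => ∃ s, s + l < N.n ∧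
    ∃ y : M, N.path s (s + l + 1) • y ≠ 0) (n := N.n) (by obtain ⟨s, hs, -⟩ := hl₀; omega) hl₀
  have hmax' : ∀ l, Nat.findGreatest (fun l => ∃ s, s + l < N.n ∧
    ∃ y : M, N.path s (s + l + 1) • y ≠ 0) N.n < l → ∀ s, s + l < N.n →
      ∀ y : M, N.path s (s + l + 1) • y = 0 := by
    intro l hl s hs y
    by_contra hy
    exact Nat.findGreatest_is_greatest hl (by omega) ⟨s, hs, y, hy⟩
  generalize Nat.findGreatest (fun l => ∃ s, s + l < N.n ∧
    ∃ y : M, N.path s (s + l + 1) • y ≠ 0) N.n = l at hmax hmax'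
  obtain ⟨s, hsl, y, hy⟩ := hmax
  have hz : IsIntervalFamily N s (s + l + 1) (fun t => N.path t (s + l + 1) • y) := by
    refine ⟨by omega, hsl, ?_, ?_, ?_, ?_⟩
    · intro t h1 h2 h3
      apply hy
      rw [← LinearNakayama.path_mul_path h1 h2, mul_smul, h3, smul_zero]
    · intro t ht
      have := hmax' (s + l - t) (by omega) t (by omega) y
      rwa [show t + (s + l - t) + 1 = s + l + 1 by omega] at this
    · intro r t h1 h2
      rw [← mul_smul, LinearNakayama.path_mul_path h1 h2]
    · intro r t t' h1 h2
      rw [← mul_smul, LinearNakayama.path_mul_path_of_ne h2, zero_smul]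
  refine ⟨s, s + l + 1, _, hz, ?_⟩
  generalize (fun t => N.path t (s + l + 1) • y) = z at hz
  obtain ⟨φ, hφ⟩ := exists_dual_eq_one (k := k) (hz.ne_zero s le_rfl hz.lt)
  obtain ⟨f, hf⟩ := hz.exists_hom φ fun t ht y => by
    by_cases htn : t < N.n
    · have := hmax' (t - s) (by omega) s (by omega) y
      rw [show s + (t - s) = t by omega] at this
      rw [this, map_zero]
    · rw [LinearNakayama.path_eq_zero' (by omega), zero_smul, map_zero]
  have hfz : ∀ t, t < s + l + 1 → f (z t) = z t := by
    intro t ht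
    rcases Nat.lt_or_ge t s with hta | hta
    · rw [hz.eq_zero t hta, map_zero]
    rw [hf, Finset.sum_eq_single_of_mem t (Finset.mem_Ico.mpr ⟨hta, ht⟩),
      hz.smul s t hta ht, hφ, map_one, one_smul]
    intro r hr hrt
    rw [hz.smul_ne s t (r + 1) ht (by omega), map_zero, map_zero, zero_smul]
  have hfr : ∀ y, f y ∈ Submodule.span A (z '' Set.Iio (s + l + 1)) := by
    intro y
    rw [hf]
    refine Submodule.sum_mem _ fun t ht => Submodule.smul_mem _ _ (Submodule.subset_span
      ⟨t, (Finset.mem_Ico.mp ht).2, rfl⟩)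
  have hfU : ∀ y ∈ Submodule.span A (z '' Set.Iio (s + l + 1)), f y = y := by
    intro y hy
    induction hy using Submodule.span_induction with
    | mem y hy =>
      obtain ⟨t, ht, rfl⟩ := hy
      exact hfz t ht
    | zero => exact map_zero f
    | add x y _ _ hx hy => rw [map_add, hx, hy]
    | smul r x _ hx => rw [map_smul, hx]
  have hcompl : IsCompl (Submodule.span A (z '' Set.Iio (s + l + 1))) (LinearMap.ker f) := by
    constructor
    · rw [Submodule.disjoint_def]
      intro x h1 h2
      rw [← hfU x h1]
      exact h2
    · rw [codisjoint_iff, eq_top_iff]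
      intro x _
      rw [Submodule.mem_sup]
      exact ⟨f x, hfr x, x - f x, by
        rw [LinearMap.mem_ker, map_sub, hfU _ (hfr x), sub_self], by simp⟩
  rcases h _ _ hcompl with h1 | h1
  · exfalso
    have : z s ∈ Submodule.span A (z '' Set.Iio (s + l + 1)) :=
      Submodule.subset_span ⟨s, hz.lt, rfl⟩
    rw [h1, Submodule.mem_bot] at this
    exact hz.ne_zero s le_rfl hz.lt this
  · have := hcompl.sup_eq_top
    rwa [h1, sup_bot_eq] at this

theorem IsInterval.eq_bot_or_eq_bot (h : IsInterval N M a b) (U V : Submodule A M)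
    (hUV : Disjoint U V) : U = ⊥ ∨ V = ⊥ := by
  obtain ⟨z, hz⟩ := h
  obtain ⟨c, hc, hc', rfl⟩ := hz.exists_eq_below U
  obtain ⟨c', hd, hd', rfl⟩ := hz.exists_eq_below V
  by_contra! hcon
  have h1 : a < c := by
    by_contra h; exact hcon.1 (hz.below_eq_bot (not_lt.mp h))
  have h2 : a < c' := by
    by_contra h; exact hcon.2 (hz.below_eq_bot (not_lt.mp h))
  rw [Submodule.disjoint_def] at hUV
  exact hz.ne_zero a le_rfl hz.lt (hUV (z a) (Submodule.subset_span ⟨a, h1, rfl⟩)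
    (Submodule.subset_span ⟨a, h2, rfl⟩))

theorem IsInterval.isIndec (h : IsInterval N M a b) : IsIndec A M := by
  refine ⟨?_, indecomposable_iff.mpr ⟨h.nontrivial, fun U V hUV =>
    h.eq_bot_or_eq_bot U V hUV.disjoint⟩⟩
  obtain ⟨z, hz⟩ := h
  classical
  refine ⟨⟨(Finset.range b).image z, ?_⟩⟩
  · rw [Finset.coe_image, Finset.coe_range]
    exact hz.span

theorem exists_isInterval_of_isIndec (N : LinearNakayama k A) (h : IsIndec A M) :
    ∃ a b, IsInterval N M a b := by
  obtain ⟨h1, h2⟩ := indecomposable_iff.mp h.2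
  exact exists_isInterval h2

theorem IsInterval.eq_of_isInterval {a' b' : ℕ} (h : IsInterval N M a b)
    (h' : IsInterval N M a' b') : a = a' ∧ b = b' := by
  obtain ⟨z, hz⟩ := h
  obtain ⟨w, hw⟩ := h'
  have key : ∀ {a b a' b' : ℕ} {z w : ℕ → M}, IsIntervalBasis N a b z → IsIntervalBasis N a' b' w →
      ∀ t, a ≤ t → t < b → a' ≤ t ∧ t < b' := by
    intro a b a' b' z w hz hw t h1 h2
    have h3 := hz.smul t t le_rfl h2
    have h4 := hz.ne_zero t h1 h2
    have h5 : t < b' := by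
      by_contra hc
      rw [hw.smul_eq_zero_of_mem_below le_rfl (not_lt.mp hc) (hw.mem_top (z t))] at h3
      exact h4 h3.symm
    refine ⟨?_, h5⟩
    by_contra hc
    obtain ⟨x, hx⟩ := hw.exists_coeff le_rfl (hw.mem_top (z t))
    rw [hx, hw.idem_smul_sum le_rfl le_rfl h5, hw.eq_zero t (not_le.mp hc), smul_zero] at h3
    rw [← hx] at h3
    exact h4 h3.symm
  have := hz.lt
  have := hw.lt
  have h1 := key hz hw a le_rfl hz.lt
  have h2 := key hw hz a' le_rfl hw.lt
  have h3 := key hz hw (b - 1) (by omega) (by omega)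
  have h4 := key hw hz (b' - 1) (by omega) (by omega)
  omega

theorem IsInterval.isSimpleModule (h : IsInterval N M a (a + 1)) : IsSimpleModule A M := by
  have := h.nontrivial
  obtain ⟨z, hz⟩ := h
  rw [isSimpleModule_iff]
  refine { eq_bot_or_eq_top := fun U => ?_ }
  obtain ⟨c, hc, hc', rfl⟩ := hz.exists_eq_below U
  rcases hc.eq_or_lt with rfl | hc
  · exact .inl (hz.below_eq_bot le_rfl)
  · right
    rw [show c = a + 1 by omega]
    exact hz.span

theorem IsInterval.length_eq (h : IsInterval N M a b) : Module.length A M = (b - a : ℕ) := by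
  induction hl : b - a generalizing a M with
  | zero => have := h.lt; omega
  | succ l ih =>
    have hlt := h.lt
    by_cases hl0 : l = 0
    · obtain rfl : b = a + 1 := by omega
      have := h.isSimpleModule
      rw [Module.length_eq_one, hl0]
      rfl
    · obtain ⟨z, hz⟩ := h
      have h1 := ih (hz.isInterval_quotient (c := a + 1) (by omega) (by omega)) (by omega)
      have h2 := (hz.isInterval_below (c := a + 1) (by omega) (by omega)).isSimpleModule
      rw [Module.length_eq_add_of_exact _ _ (Submodule.injective_subtype _)
        (Submodule.mkQ_surjective _) (LinearMap.exact_subtype_mkQ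
          (IsIntervalFamily.below A z (a + 1))), h1, Module.length_eq_one]
      push_cast
      rw [add_comm]

end

/-! ### Indecomposable projective modules and projective dimension. -/

section Projective

variable {a b : ℕ}

theorem isIntervalFamily_path (hb : 0 < b) (hbn : b ≤ N.n) :
    IsIntervalFamily N (N.soc b) b (fun t => N.path t b) where
  lt := LinearNakayama.isKupisch.lt hb
  le := hbn
  ne_zero t h1 h2 := (LinearNakayama.path_ne_zero_iff h2 hbn).mpr h1
  eq_zero t h1 := by
    by_contra h
    have := (LinearNakayama.path_ne_zero_iff (h1.trans (LinearNakayama.isKupisch.lt hb)) hbn).mp h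
    omega
  smul s t h1 h2 := LinearNakayama.path_mul_path h1 h2
  smul_ne s t t' _ h2 := LinearNakayama.path_mul_path_of_ne h2

variable (N) in
/-- The indecomposable projective module with top `b - 1`. -/
abbrev projCover (b : ℕ) : Submodule A A := IsIntervalFamily.below A (fun t => N.path t b) b

theorem isInterval_projCover (hb : 0 < b) (hbn : b ≤ N.n) :
    IsInterval N (projCover N b) (N.soc b) b :=
  (isIntervalFamily_path hb hbn).isInterval_below (LinearNakayama.isKupisch.lt hb) le_rfl

theorem smul_path_of_mem_projCover (hb : 0 < b) {x : A} (hx : x ∈ projCover N b) :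
    x * N.path (b - 1) b = x := by
  induction hx using Submodule.span_induction with
  | mem x hx =>
    obtain ⟨t, ht, rfl⟩ := hx
    have := LinearNakayama.path_mul_path (N := N) (s := t) (t := b - 1) (b := b)
      (by have : t < b := ht; omega) (by omega)
    rwa [Nat.sub_add_cancel hb] at this
  | zero => exact zero_mul _
  | add x y _ _ hx hy => rw [add_mul, hx, hy]
  | smul r x _ hx => rw [smul_eq_mul, mul_assoc, hx]

theorem path_mem_projCover (hb : 0 < b) : N.path (b - 1) b ∈ projCover N b :=
  Submodule.subset_span ⟨b - 1, by simp [hb], rfl⟩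

instance projective_projCover : Module.Projective A (projCover N b) := by
  rcases Nat.eq_zero_or_pos b with rfl | hb
  · have h0 : projCover N 0 = ⊥ := by
      rw [projCover, IsIntervalFamily.below]
      simp
    rw [h0]
    infer_instance
  · refine Module.Projective.of_split (M := A) (projCover N b).subtype
      (LinearMap.toSpanSingleton A _ ⟨_, path_mem_projCover hb⟩) ?_
    ext ⟨x, hx⟩
    exact smul_path_of_mem_projCover hb hx

theorem exists_isInterval_of_soc_le (hb : a < b) (hbn : b ≤ N.n) (hab : N.soc b ≤ a) :
    ∃ M : ModuleCat.{u} A, IsInterval N M a b := by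
  obtain ⟨z, hz⟩ := isInterval_projCover (show 0 < b by omega) hbn
  exact ⟨ModuleCat.of A _, hz.isInterval_quotient hab hb⟩

variable {M : Type u} [AddCommGroup M] [Module A M]

/-- If `M` is projective, its projective cover splits. The submodules of the cover form a chain, so
the kernel and the image of the section cannot both be non-zero. -/
theorem IsInterval.projective_iff (h : IsInterval N M a b) :
    Module.Projective A M ↔ a = N.soc b := by
  have hlt := h.lt
  have hle := h.le
  obtain ⟨z, hz⟩ := isInterval_projCover (show 0 < b by omega) hle
  constructor
  · intro hM
    obtain ⟨e⟩ := h.nonempty_equiv (hz.isInterval_quotient h.soc_le hlt)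
    have hM' : Module.Projective A (_ ⧸ IsIntervalFamily.below A z a) := .of_equiv e
    obtain ⟨s, hs⟩ := Module.projective_lifting_property
      (IsIntervalFamily.below A z a).mkQ LinearMap.id (Submodule.mkQ_surjective _)
    have hdis : Disjoint (IsIntervalFamily.below A z a) (LinearMap.range s) := by
      rw [Submodule.disjoint_def]
      rintro _ hx ⟨y, rfl⟩
      have h1 : (IsIntervalFamily.below A z a).mkQ (s y) = y := LinearMap.congr_fun hs y
      rw [Submodule.mkQ_apply, (Submodule.Quotient.mk_eq_zero _).mpr hx] at h1
      rw [← h1, map_zero]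
    rcases IsInterval.eq_bot_or_eq_bot ⟨z, hz⟩ _ _ hdis with h1 | h1
    · by_contra hne
      have h2 := h.soc_le
      have h3 := (hz.mem_below_iff (c := a) hlt.le le_rfl hz.lt).mpr (by omega)
      rw [h1, Submodule.mem_bot] at h3
      exact hz.ne_zero _ le_rfl hz.lt h3
    · exfalso
      have := h.nontrivial
      obtain ⟨x, hx⟩ := exists_ne (0 : M)
      have h2 : s (e x) ∈ LinearMap.range s := ⟨_, rfl⟩
      rw [h1, Submodule.mem_bot] at h2
      have h3 : (IsIntervalFamily.below A z a).mkQ (s (e x)) = e x := LinearMap.congr_fun hs _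
      rw [h2, map_zero] at h3
      exact hx (e.injective (by rw [← h3, map_zero]))
  · rintro rfl
    obtain ⟨e⟩ := h.nonempty_equiv ⟨z, hz⟩
    exact .of_equiv e.symm

/-- The syzygy is the submodule of the projective cover with the vertices below `a`, again an
interval module; this is the recursion defining `pdI`. -/
theorem IsInterval.pd_eq (h : IsInterval N M a b) :
    pd A M = ((pdI N.soc a b : ℕ∞) : WithBot ℕ∞) := by
  induction b using Nat.strong_induction_on generalizing a M with
  | _ b ih =>
    have hlt := h.lt
    rcases h.soc_le.eq_or_lt with h1 | h1
    · have := h.projective_iff.mpr h1.symm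
      have := h.nontrivial
      rw [pdI_eq_zero h1.ge]
      exact pd_eq_zero
    · obtain ⟨z, hz⟩ := isInterval_projCover (show 0 < b by omega) h.le
      have h2 := hz.isInterval_quotient h1.le hlt
      obtain ⟨e⟩ := h.nonempty_equiv h2
      have h3 := ih a hlt (hz.isInterval_below h1 hlt.le)
      rw [pd_congr e, pd_quotient _ (fun h4 => by have := h2.projective_iff.mp h4; omega) h3,
        pdI_step h1 hlt, add_comm]

end Projective

section Injective

variable {a b : ℕ} {M : Type u} [AddCommGroup M] [Module A M]

-- The map to be extended amounts to a linear form, which extends along a linear retraction of the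
-- embedding. `exists_hom` turns it back into a homomorphism: when `b` is the right end, the paths
-- to `a` from vertices at or above `b` already vanish in `A`.
open IsKupisch in
theorem IsInterval.injective_of_eq (h : IsInterval N M a b) (hb : b = rightEnd N.n N.soc a) :
    Module.Injective A M := by
  obtain ⟨z, hz⟩ := h
  refine ⟨fun X Y _ _ _ _ f hf g => ?_⟩
  let _ := Module.compHom X (algebraMap k A)
  have : IsScalarTower k A X := ⟨fun w r x => by rw [Algebra.smul_def, mul_smul]; rfl⟩
  let _ := Module.compHom Y (algebraMap k A)
  have : IsScalarTower k A Y := ⟨fun w r x => by rw [Algebra.smul_def, mul_smul]; rfl⟩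
  let _ := Module.compHom M (algebraMap k A)
  have : IsScalarTower k A M := ⟨fun w r x => by rw [Algebra.smul_def, mul_smul]; rfl⟩
  obtain ⟨φ, hφ⟩ := exists_dual_eq_one (k := k) (hz.ne_zero a le_rfl hz.lt)
  have hφz : ∀ y : M, y = ∑ t ∈ Finset.Ico a b, algebraMap k A (φ (N.path a (t + 1) • y)) • z t := by
    intro y
    obtain ⟨x, hx⟩ := hz.exists_coeff le_rfl (hz.mem_top y)
    conv_lhs => rw [hx]
    rw [Finset.range_eq_Ico, ← Finset.sum_Ico_consecutive _ (Nat.zero_le a) hz.lt.le,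
      Finset.sum_eq_zero, zero_add]
    · refine Finset.sum_congr rfl fun t ht => ?_
      have ht' := Finset.mem_Ico.mp ht
      rw [hx, hz.idem_smul_sum le_rfl ht'.1 ht'.2, algebraMap_smul A (x t) (z a), map_smul, hφ, smul_eq_mul,
        mul_one]
    · intro t ht
      rw [hz.eq_zero t (Finset.mem_Ico.mp ht).2, smul_zero]
  let f' : X →ₗ[k] Y := f.restrictScalars k
  let g' : X →ₗ[k] M := g.restrictScalars k
  obtain ⟨ρ, hρ⟩ := f'.exists_leftInverse_of_injective (LinearMap.ker_eq_bot.mpr hf)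
  have hpath : ∀ t, b ≤ t → N.path a (t + 1) = 0 := by
    intro t ht
    by_contra hne
    have htn : t + 1 ≤ N.n := by
      by_contra hc
      exact hne (LinearNakayama.path_eq_zero' (by omega))
    have h1 := (LinearNakayama.path_ne_zero_iff (by have := hz.lt; omega) htn).mp hne
    have := le_rightEnd htn h1
    omega
  obtain ⟨F, hF⟩ := hz.exists_hom (φ ∘ₗ g' ∘ₗ ρ) fun t ht y => by
    rw [hpath t ht, zero_smul, map_zero]
  refine ⟨F, fun x => ?_⟩
  rw [hF, hφz (g x)]
  refine Finset.sum_congr rfl fun t _ => ?_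
  have h1 : ρ (N.path a (t + 1) • f x) = N.path a (t + 1) • x := by
    rw [← map_smul]
    exact LinearMap.congr_fun hρ _
  simp only [LinearMap.comp_apply, h1]
  change _ = algebraMap k A (φ (N.path a (t + 1) • g x)) • _
  rw [← map_smul]
  rfl

end Injective

end Nakayama

/-! ### Socle, radical, composition factors and characteristic of interval modules. -/

namespace Nakayama

open IsIntervalFamily

variable {k A : Type u} [Field k] [Ring A] [Algebra k A] {N : LinearNakayama k A}

section Structure

variable {M M' : Type u} [AddCommGroup M] [Module A M] [AddCommGroup M'] [Module A M'] {a b c c' : ℕ}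
  {z : ℕ → M}

theorem IsIntervalBasis.below_top (hz : IsIntervalBasis N a b z) : below A z b = ⊤ := hz.span

theorem IsIntervalFamily.below_le_iff (hz : IsIntervalFamily N a b z) (hac : a ≤ c) (hcb : c ≤ b)
    (hcb' : c' ≤ b) : below A z c ≤ below A z c' ↔ c ≤ c' ∨ c = a := by
  constructor
  · intro h
    by_contra! hcon
    have h1 := h ((hz.mem_below_iff (t := c - 1) hcb (by omega) (by omega)).mpr (by omega))
    rw [hz.mem_below_iff hcb' (by omega) (by omega)] at h1
    omega
  · rintro (h | rfl)
    · exact below_mono h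
    · rw [hz.below_eq_bot le_rfl]
      exact bot_le

theorem IsIntervalFamily.below_injective (hz : IsIntervalFamily N a b z) (hac : a ≤ c) (hcb : c ≤ b)
    (hac' : a ≤ c') (hcb' : c' ≤ b) (h : below A z c = below A z c') : c = c' := by
  have h1 := (hz.below_le_iff hac hcb hcb').mp h.le
  have h2 := (hz.below_le_iff hac' hcb' hcb).mp h.ge
  omega

theorem IsIntervalFamily.length_below (hz : IsIntervalFamily N a b z) (hac : a ≤ c) (hcb : c ≤ b) :
    Module.length A (below A z c) = (c - a : ℕ) := by
  rcases hac.eq_or_lt with rfl | hac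
  · rw [hz.below_eq_bot le_rfl, Module.length_bot, Nat.sub_self]
    rfl
  · exact (hz.isInterval_below hac hcb).length_eq

theorem IsIntervalBasis.isInterval_subquotient (hz : IsIntervalBasis N a b z) (hac : a ≤ c)
    (hcc : c < c') (hcb : c' ≤ b) :
    IsInterval N (below A z c' ⧸ (below A z c).submoduleOf (below A z c')) c c' := by
  obtain ⟨w, hw⟩ := hz.isInterval_below (c := c') (by omega) hcb
  obtain ⟨e, he, he', h⟩ := hw.exists_eq_below ((below A z c).submoduleOf (below A z c'))
  have h1 := hw.length_below he he'
  rw [← h, (Submodule.submoduleOfEquivOfLe (below_mono hcc.le)).length_eq,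
    hz.length_below hac (by omega), Nat.cast_inj] at h1
  obtain rfl : e = c := by omega
  rw [h]
  exact hw.isInterval_quotient hac hcc

theorem IsIntervalBasis.covBy_iff (hz : IsIntervalBasis N a b z) (hac : a ≤ c) (hcb : c < b)
    (V : Submodule A M) : below A z c ⋖ V ↔ V = below A z (c + 1) := by
  constructor
  · intro h
    obtain ⟨e, he, he', rfl⟩ := hz.exists_eq_below V
    have h1 : c < e := by
      by_contra hcon
      exact h.1.not_ge (below_mono (not_lt.mp hcon))
    rcases h.eq_or_eq (below_mono (show c ≤ c + 1 by omega)) (below_mono h1) with h2 | h2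
    · have := hz.below_injective (by omega) (by omega) hac (by omega) h2
      omega
    · exact h2.symm
  · rintro rfl
    refine ⟨lt_of_le_of_ne (below_mono (by omega)) fun h => ?_, ?_⟩
    · have := hz.below_injective hac (by omega) (by omega) (by omega) h
      omega
    · intro V h1 h2
      obtain ⟨e, he, he', rfl⟩ := hz.exists_eq_below V
      have h3 : c < e := by
        by_contra hcon
        exact h1.not_ge (below_mono (not_lt.mp hcon))
      exact h2.not_ge (below_mono h3)

theorem IsIntervalBasis.socle_eq (hz : IsIntervalBasis N a b z) : socle A M = below A z (a + 1) := by
  have hlt := hz.lt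
  apply le_antisymm
  · refine sSup_le fun V hV => ?_
    obtain ⟨e, he, he', rfl⟩ := hz.exists_eq_below V
    have h1 := hz.length_below he he'
    have hV : IsSimpleModule A (below A z e) := hV
    rw [Module.length_eq_one] at h1
    have h2 : 1 = e - a := by exact_mod_cast h1
    exact below_mono (by omega)
  · exact le_sSup (hz.isInterval_below (by omega) hlt).isSimpleModule

theorem IsIntervalBasis.rad_eq (hz : IsIntervalBasis N a b z) : rad A M = below A z (b - 1) := by
  have hlt := hz.lt
  have hcov := (hz.covBy_iff (c := b - 1) (by omega) (by omega) ⊤).mpr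
    (by rw [Nat.sub_add_cancel (by omega), hz.below_top])
  apply le_antisymm
  · exact sInf_le (covBy_top_iff.mp hcov)
  · refine le_sInf fun V hV => ?_
    obtain ⟨e, he, he', rfl⟩ := hz.exists_eq_below V
    have h1 : e ≠ b := by
      rintro rfl
      exact hV.1 hz.below_top
    have h2 : below A z e ≤ below A z (b - 1) := below_mono (by omega)
    rcases h2.eq_or_lt with h3 | h3
    · exact h3.ge
    · exact absurd (hV.2 _ h3) hcov.1.ne

theorem IsInterval.socle (h : IsInterval N M a b) : IsInterval N (socle A M) a (a + 1) := by
  obtain ⟨z, hz⟩ := h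
  rw [hz.socle_eq]
  exact hz.isInterval_below (by omega) hz.lt

theorem IsInterval.quotient_socle (h : IsInterval N M a b) (hab : a + 1 < b) :
    IsInterval N (M ⧸ Nakayama.socle A M) (a + 1) b := by
  obtain ⟨z, hz⟩ := h
  rw [hz.socle_eq]
  exact hz.isInterval_quotient (by omega) hab

theorem IsInterval.rad (h : IsInterval N M a b) (hab : a + 1 < b) :
    IsInterval N (rad A M) a (b - 1) := by
  obtain ⟨z, hz⟩ := h
  rw [hz.rad_eq]
  exact hz.isInterval_below (by omega) (by omega)

theorem IsInterval.top (h : IsInterval N M a b) : IsInterval N (top A M) (b - 1) b := by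
  obtain ⟨z, hz⟩ := h
  change IsInterval N (M ⧸ Nakayama.rad A M) (b - 1) b
  rw [hz.rad_eq]
  have := hz.lt
  exact hz.isInterval_quotient (by omega) (by omega)

theorem IsInterval.finite (h : IsInterval N M a b) : Module.Finite A M := h.isIndec.1

theorem exists_isInterval_of_isSimpleModule (N : LinearNakayama k A) [IsSimpleModule A M] :
    ∃ v, IsInterval N M v (v + 1) := by
  have := IsSimpleModule.nontrivial A M
  obtain ⟨a, b, h⟩ := exists_isInterval (k := k) (N := N) (M := M) fun U V hUV =>
    (eq_bot_or_eq_top U).imp_right fun h => by simpa [h] using hUV.disjoint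
  have h1 := h.length_eq
  rw [Module.length_eq_one] at h1
  have h2 : 1 = b - a := by exact_mod_cast h1
  exact ⟨a, by rwa [show a + 1 = b by omega]⟩

theorem IsInterval.isOddModule_iff (h : IsInterval N M a b) :
    IsOddModule A M ↔ Odd (pdI N.soc a b) := by
  rw [IsOddModule, h.pd_eq]
  constructor
  · rintro ⟨e, he, h⟩
    have : pdI N.soc a b = e := by exact_mod_cast h
    rwa [this]
  · exact fun h => ⟨_, h, rfl⟩

/-- The entries of the characteristic of an interval module. -/
def charEntry (L : ℕ → ℕ) (a b u : ℕ) : ℕ := if Odd (pdS L u) then pdS L u else pdI L a b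

/-- The submodules form a chain, so the composition series is forced and its `i`-th factor is the
simple module at `a + i`. -/
theorem IsInterval.hasChar_iff (h : IsInterval N M a b) (x : List ℕ) :
    HasChar A M x ↔ x.length = b - a ∧
      ∀ i (hi : i < x.length), x[i] = charEntry N.soc a b (a + i) := by
  have hpd := h.pd_eq
  obtain ⟨z, hz⟩ := h
  have hlt := hz.lt
  have hfac : ∀ i, a + i < b → IsInterval N (below A z (a + i + 1) ⧸
      (below A z (a + i)).submoduleOf (below A z (a + i + 1))) (a + i) (a + i + 1) := fun i hi =>
    hz.isInterval_subquotient (by omega) (by omega) hi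
  constructor
  · rintro ⟨V, h0, hl, hV⟩
    have key : ∀ i (hi : i < x.length + 1), a + i ≤ b ∧ V ⟨i, hi⟩ = below A z (a + i) := by
      intro i
      induction i with
      | zero =>
        intro hi
        rw [add_zero, hz.below_eq_bot le_rfl]
        exact ⟨hlt.le, h0⟩
      | succ i ih =>
        intro hi
        obtain ⟨h1, h2⟩ := ih (by omega)
        have h3 := (hV ⟨i, by omega⟩).1
        change V ⟨i, _⟩ ⋖ V ⟨i + 1, _⟩ at h3
        rw [h2] at h3
        rcases h1.eq_or_lt with h4 | h4
        · rw [h4, hz.below_top] at h3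
          exact absurd h3.1 not_top_lt
        · exact ⟨h4, (hz.covBy_iff (by omega) h4 _).mp h3⟩
    have h1 := key x.length (by omega)
    have h2 : x.length = b - a := by
      rw [show V ⟨x.length, by omega⟩ = ⊤ from hl, ← hz.below_top] at h1
      have := hz.below_injective hlt.le le_rfl (by omega) h1.1 h1.2
      omega
    refine ⟨h2, fun i hi => ?_⟩
    obtain ⟨-, h3, h4⟩ := hV ⟨i, hi⟩
    have h5 := key i (by omega)
    have h6 := key (i + 1) (by omega)
    have h7 := hfac i (by omega)
    change _ → _ = pd A (V ⟨i + 1, _⟩ ⧸ (V ⟨i, _⟩).submoduleOf (V ⟨i + 1, _⟩)) at h3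
    change ¬ IsOddModule A (V ⟨i + 1, _⟩ ⧸ (V ⟨i, _⟩).submoduleOf (V ⟨i + 1, _⟩)) → _ at h4
    change IsOddModule A (V ⟨i + 1, _⟩ ⧸ (V ⟨i, _⟩).submoduleOf (V ⟨i + 1, _⟩)) → _ at h3
    rw [h5.2, h6.2, ← add_assoc, h7.isOddModule_iff] at h3 h4
    rw [h7.pd_eq] at h3
    rw [charEntry]
    split_ifs with h8
    · exact_mod_cast h3 h8
    · rw [hpd] at h4
      exact_mod_cast h4 h8
  · rintro ⟨h1, h2⟩
    refine ⟨fun i => below A z (a + i), ?_, ?_, fun i => ⟨?_, ?_⟩⟩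
    · exact hz.below_eq_bot (by simp)
    · simp only [Fin.val_last]
      rw [h1, show a + (b - a) = b by omega, hz.below_top]
    · rw [hz.covBy_iff (by simp) (by simp; omega)]
      rfl
    · have h3 := hfac i (by omega)
      change (IsOddModule A (below A z (a + i + 1) ⧸
        (below A z (a + i)).submoduleOf (below A z (a + i + 1))) → _ =
        pd A (below A z (a + i + 1) ⧸ (below A z (a + i)).submoduleOf (below A z (a + i + 1)))) ∧
        (¬ IsOddModule A (below A z (a + i + 1) ⧸
        (below A z (a + i)).submoduleOf (below A z (a + i + 1))) → _)
      rw [h3.isOddModule_iff, h3.pd_eq, hpd, List.get_eq_getElem, h2, charEntry]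
      constructor
      · intro h4
        rw [if_pos (show Odd (pdS N.soc (a + i)) from h4)]; rfl
      · intro h4
        rw [if_neg (show ¬ Odd (pdS N.soc (a + i)) from h4)]

theorem IsInterval.isCompositionFactor_iff (h : IsInterval N M a b) :
    IsCompositionFactor A M' M ↔ ∃ v, a ≤ v ∧ v < b ∧ IsInterval N M' v (v + 1) := by
  obtain ⟨z, hz⟩ := h
  constructor
  · rintro ⟨h1, V, W, hVW, ⟨e⟩⟩
    obtain ⟨c, hc, hc', rfl⟩ := hz.exists_eq_below V
    obtain ⟨c', hd, hd', rfl⟩ := hz.exists_eq_below W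
    have hlt : c < c' := by
      by_contra hcon
      have := IsSimpleModule.nontrivial A M'
      have := e.toEquiv.nontrivial
      have h2 : (below A z c).submoduleOf (below A z c') = ⊤ :=
        Submodule.submoduleOf_eq_top.mpr (below_mono (not_lt.mp hcon))
      rw [h2] at this
      exact not_subsingleton _ (inferInstance : Subsingleton (_ ⧸ (⊤ : Submodule A (below A z c'))))
    have h2 := (hz.isInterval_subquotient hc hlt hd').of_equiv e
    have h3 := h2.length_eq
    rw [Module.length_eq_one] at h3
    have h4 : 1 = c' - c := by exact_mod_cast h3
    exact ⟨c, hc, by omega, by rwa [show c + 1 = c' by omega]⟩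
  · rintro ⟨v, h1, h2, h3⟩
    refine ⟨h3.isSimpleModule, below A z v, below A z (v + 1), below_mono (by omega), ?_⟩
    exact (hz.isInterval_subquotient h1 (by omega) h2).nonempty_equiv h3

end Structure

/-! ### Torsionless and closed simple modules. -/

section Closed

variable {M : Type u} [AddCommGroup M] [Module A M] {a b v d : ℕ}

theorem LinearNakayama.isArtinianRing (N : LinearNakayama k A) : IsArtinianRing A := by
  have : Module.Finite k (upperTriangular k N.n) := inferInstanceAs
    (Module.Finite k (Subalgebra.toSubmodule (upperTriangular k N.n)))
  have : Module.Finite k A := Module.Finite.of_surjective N.proj.toLinearMap N.surjective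
  exact IsArtinianRing.of_finite k A

/-- Embed the projective module into a free one. Some coordinate, multiplied by some vertex
idempotent, is non-zero on the simple module and hence injective on it. -/
theorem IsInterval.exists_injective_projCover (h : IsInterval N M v (v + 1))
    (ht : IsTorsionless A M) :
    ∃ b, 0 < b ∧ b ≤ N.n ∧ ∃ f : M →ₗ[A] projCover N b, Function.Injective f := by
  obtain ⟨P, f, hP, hf⟩ := ht
  have := h.nontrivial
  have := h.isSimpleModule
  obtain ⟨x, hx⟩ := exists_ne (0 : M)
  obtain ⟨s, hs⟩ := hP.out
  have h1 : s (f x) ≠ 0 := by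
    intro h0
    apply hx
    apply hf
    rw [map_zero, ← hs (f x), h0, map_zero]
  obtain ⟨p, hp⟩ := Finsupp.ne_iff.mp h1
  have h2 : ∃ t < N.n, s (f x) p * N.path t (t + 1) ≠ 0 := by
    by_contra! hcon
    apply hp
    rw [← mul_one (s (f x) p), LinearNakayama.one_eq_sum (N := N), Finset.mul_sum]
    exact Finset.sum_eq_zero fun t ht => hcon t (Finset.mem_range.mp ht)
  obtain ⟨t, ht, h2⟩ := h2
  let g : M →ₗ[A] projCover N (t + 1) :=
    LinearMap.toSpanSingleton A _ ⟨_, path_mem_projCover (N := N) t.succ_pos⟩ ∘ₗ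
      Finsupp.lapply p ∘ₗ s ∘ₗ f
  refine ⟨t + 1, t.succ_pos, ht, g, g.injective_of_ne_zero fun h0 => h2 ?_⟩
  exact congrArg Subtype.val (LinearMap.congr_fun h0 x)

theorem IsInterval.eq_of_injective {M' : Type u} [AddCommGroup M'] [Module A M'] {a' b' : ℕ}
    (h : IsInterval N M a b) (h' : IsInterval N M' a' b') (f : M →ₗ[A] M')
    (hf : Function.Injective f) : a = a' ∧ b ≤ b' := by
  obtain ⟨z, hz⟩ := h'
  obtain ⟨c, hc, hc', h1⟩ := hz.exists_eq_below (LinearMap.range f)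
  have h2 := h.of_equiv (LinearEquiv.ofInjective f hf)
  rw [h1] at h2
  have h3 := h2.nontrivial
  rcases hc.eq_or_lt with rfl | hlt
  · rw [hz.below_eq_bot le_rfl] at h3
    exact absurd h3 (not_nontrivial _)
  · obtain ⟨rfl, rfl⟩ := h2.eq_of_isInterval (hz.isInterval_below hlt hc')
    exact ⟨rfl, hc'⟩

theorem IsInterval.isTorsionless_iff (h : IsInterval N M v (v + 1)) :
    IsTorsionless A M ↔ IsProjSocle N.n N.soc v := by
  constructor
  · intro ht
    obtain ⟨b, hb, hbn, f, hf⟩ := h.exists_injective_projCover ht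
    exact ⟨b, hbn, hb, (h.eq_of_injective (isInterval_projCover hb hbn) f hf).1.symm⟩
  · rintro ⟨b, hbn, hb, rfl⟩
    have h1 := isInterval_projCover hb hbn
    obtain ⟨e⟩ := h.nonempty_equiv h1.socle
    exact ⟨ModuleCat.of A (projCover N b), (Nakayama.socle A (projCover N b)).subtype ∘ₗ e.toLinearMap,
      projective_projCover, (Submodule.injective_subtype _).comp e.injective⟩

theorem IsInterval.isProjSocle_of_injective (h : IsInterval N M a b) {P : Type u} [AddCommGroup P]
    [Module A P] [Module.Projective A P] (f : M →ₗ[A] P) (hf : Function.Injective f) :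
    IsProjSocle N.n N.soc a :=
  h.socle.isTorsionless_iff.mp ⟨ModuleCat.of A P, f ∘ₗ (Nakayama.socle A M).subtype,
    inferInstanceAs (Module.Projective A P), hf.comp (Submodule.injective_subtype _)⟩

/-- Every non-zero submodule contains the simple socle, so two complementary submodules cannot both
be non-zero. -/
theorem exists_isInterval_of_isSimpleModule_socle (N : LinearNakayama k A) [Module.Finite A M]
    [IsSimpleModule A (socle A M)] : ∃ a b, IsInterval N M a b := by
  have := N.isArtinianRing
  have : IsArtinian A M := inferInstance
  have hnt : Nontrivial M := by
    have := IsSimpleModule.nontrivial A (socle A M)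
    exact (Submodule.injective_subtype (socle A M)).nontrivial
  have key : ∀ U : Submodule A M, U ≠ ⊥ → socle A M ≤ U := by
    intro U hU
    obtain ⟨S, hS, hSU⟩ := (eq_bot_or_exists_atom_le U).resolve_left hU
    have h1 : IsSimpleModule A S := isSimpleModule_iff_isAtom.mpr hS
    have h2 : S ≤ socle A M := le_sSup h1
    have h3 : IsAtom (socle A M) := isSimpleModule_iff_isAtom.mp inferInstance
    exact ((h3.le_iff.mp h2).resolve_left hS.1) ▸ hSU
  refine exists_isInterval fun U V hUV => ?_
  by_contra! hcon
  have h1 := hUV.disjoint (key U hcon.1) (key V hcon.2)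
  have := IsSimpleModule.nontrivial A (socle A M)
  rw [le_bot_iff.mp h1] at this
  exact not_nontrivial _ this

theorem IsInterval.isDClosedSimple_iff (h : IsInterval N M v (v + 1)) :
    IsDClosedSimple A d M ↔ IsProjSocle N.n N.soc v ∨
      ∃ c, v < c ∧ c ≤ N.n ∧ N.soc c ≤ v ∧ d ≤ pdI N.soc v c := by
  refine or_congr h.isTorsionless_iff ⟨?_, ?_⟩
  · rintro ⟨X, hX, ⟨e⟩, hpd⟩
    have := h.isSimpleModule
    have : IsSimpleModule A (Nakayama.socle A X) := .congr e
    obtain ⟨a, b, hab⟩ := exists_isInterval_of_isSimpleModule_socle (M := X) N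
    obtain ⟨rfl, -⟩ := h.eq_of_isInterval (hab.socle.of_equiv e)
    rw [hab.pd_eq] at hpd
    exact ⟨b, hab.lt, hab.le, hab.soc_le, by exact_mod_cast hpd⟩
  · rintro ⟨c, h1, h2, h3, h4⟩
    obtain ⟨X, hX⟩ := exists_isInterval_of_soc_le h1 h2 h3
    refine ⟨X, hX.finite, hX.socle.nonempty_equiv h, ?_⟩
    rw [hX.pd_eq]
    exact_mod_cast h4

end Closed

/-! ### From a bound concave algebra to a bound Kupisch function. -/

section Bound

variable {M : Type u} [AddCommGroup M] [Module A M] {a b m d : ℕ}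

theorem pd_le_gldim [h : Module.Finite A M] : pd A M ≤ gldim A :=
  le_iSup (fun X : {M : ModuleCat.{u} A // Module.Finite A M} => pd A X.1) ⟨ModuleCat.of A M, h⟩

theorem pdI_le_of_gldim_le (N : LinearNakayama k A) (h : gldim A ≤ ((d : ℕ∞) : WithBot ℕ∞))
    (hb : b ≤ N.n) : pdI N.soc a b ≤ d := by
  rcases Nat.eq_zero_or_pos (pdI N.soc a b) with h0 | h0
  · omega
  obtain ⟨h1, h2⟩ := lt_of_pdI_pos h0
  obtain ⟨X, hX⟩ := exists_isInterval_of_soc_le h2 hb h1.le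
  have := hX.finite
  have h3 := (pd_le_gldim (A := A) (M := X)).trans h
  rw [hX.pd_eq] at h3
  exact_mod_cast h3

theorem LinearNakayama.kupisch_eq (i : Fin N.n) : N.kupisch i = (i + 1 - N.soc (i + 1) : ℕ) := by
  have h1 : Submodule.span A {N.proj (idem k i)} = projCover N (i + 1) := by
    rw [← LinearNakayama.path_succ_eq_idem]
    apply le_antisymm
    · rw [Submodule.span_singleton_le_iff_mem]
      exact path_mem_projCover (by omega)
    · rw [projCover, IsIntervalFamily.below, Submodule.span_le]
      rintro _ ⟨t, ht, rfl⟩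
      have ht : t < (i : ℕ) + 1 := ht
      have := LinearNakayama.path_mul_path (N := N) (s := t) (t := i) (b := i + 1) (by omega)
        (by omega)
      rw [SetLike.mem_coe, Submodule.mem_span_singleton]
      exact ⟨_, this⟩
  rw [LinearNakayama.kupisch, h1, (isInterval_projCover (by omega) i.isLt).length_eq]

theorem HasHeight.length_le (h : HasHeight A m) (hM : IsInterval N M a b) : b - a ≤ m := by
  have := h.2 ⟨ModuleCat.of A M, hM.isIndec, hM.length_eq⟩
  exact_mod_cast this

theorem HasHeight.isSummit_iff (h : HasHeight A m) (hM : IsInterval N M a b) :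
    IsSummit A M ↔ b = a + m := by
  have hlt := hM.lt
  constructor
  · rintro ⟨-, h1⟩
    obtain ⟨X, hX, hl⟩ := h.1
    have h2 := h1 X hX
    rw [hl, hM.length_eq] at h2
    have h3 : m ≤ b - a := by exact_mod_cast h2
    have := h.length_le hM
    omega
  · rintro rfl
    refine ⟨hM.isIndec, fun X hX => ?_⟩
    rw [hM.length_eq, Nat.add_sub_cancel_left]
    exact h.2 ⟨X, hX, rfl⟩

theorem LinearNakayama.exists_isBoundKupisch (hm : 2 ≤ m) (hd : Even d) (h1 : IsConcave k A)
    (h2 : HasHeight A (m + 1)) (h3 : IsDBound A d) :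
    ∃ N : LinearNakayama k A, IsBoundKupisch N.n m d N.soc := by
  obtain ⟨N, p, hmono, hanti⟩ := h1
  have hK := N.isKupisch
  have hk : ∀ {i j : ℕ} (hi : i < N.n) (hj : j < N.n), N.kupisch ⟨i, hi⟩ ≤ N.kupisch ⟨j, hj⟩ →
      i + 1 - N.soc (i + 1) ≤ j + 1 - N.soc (j + 1) := by
    intro i j hi hj h
    rw [N.kupisch_eq, N.kupisch_eq] at h
    exact_mod_cast h
  have hmono' : ∀ i j : ℕ, i ≤ j → j ≤ p → i + 1 - N.soc (i + 1) ≤ j + 1 - N.soc (j + 1) := by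
    intro i j hij hj
    have := p.isLt
    exact hk (by omega) (by omega) (hmono (a := ⟨i, by omega⟩) (b := ⟨j, by omega⟩)
      (by simpa [Fin.le_def] using hij.trans hj) (by simpa [Fin.le_def] using hj) hij)
  have hanti' : ∀ i j : ℕ, i ≤ j → p ≤ i → j < N.n →
      j + 1 - N.soc (j + 1) ≤ i + 1 - N.soc (i + 1) := by
    intro i j hij hi hj
    exact hk (by omega) (by omega) (hanti (a := ⟨i, by omega⟩) (b := ⟨j, by omega⟩)
      (by simpa [Fin.le_def] using hi) (by simpa [Fin.le_def] using hi.trans hij) hij)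
  have hheight : ∀ b ≤ N.n, b ≤ N.soc b + (m + 1) := by
    intro b hb
    rcases Nat.eq_zero_or_pos b with rfl | hb0
    · omega
    · have := h2.length_le (isInterval_projCover hb0 hb)
      omega
  refine ⟨N, { hK with
    two_le := hm
    even := hd
    height := hheight
    asc := ?_
    desc := ?_
    summit := ?_
    pd_le := fun a b hb => pdI_le_of_gldim_le N h3.1 hb
    closed := ?_ }⟩
  · intro s hs hs' b hb
    rcases Nat.eq_zero_or_pos b with rfl | hb0
    · rw [hK.one]; omega
    obtain ⟨c, rfl⟩ : ∃ c, b = c + 1 := ⟨b - 1, by omega⟩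
    have e1 := hK.lt (b := c + 1) (by omega)
    have e2 := hK.lt (b := c + 1 + 1) (by omega)
    by_cases hp : c + 1 ≤ p
    · have := hmono' c (c + 1) (by omega) hp
      omega
    -- Past the peak the lengths only decrease, but the summit `s` is still to come; so this length
    -- is already the maximal one.
    · have := hanti' (c + 1) (s - 1) (by omega) (by omega) (by omega)
      rw [Nat.sub_add_cancel (by omega)] at this
      have := hheight (c + 1) (by omega)
      omega
  · intro s hs hs' b hb hbn
    obtain ⟨c, rfl⟩ : ∃ c, b = c + 1 := ⟨b - 1, by omega⟩
    have e1 := hK.lt (b := c + 1) (by omega)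
    have e2 := hK.lt (b := c + 1 + 1) (by omega)
    by_cases hp : c + 1 ≤ p
    · have := hmono' (s - 1) c (by omega) (by omega)
      rw [Nat.sub_add_cancel (by omega)] at this
      have := hheight (c + 1 + 1) (by omega)
      omega
    · have := hanti' c (c + 1) (by omega) (by omega) (by omega)
      omega
  · obtain ⟨X, hX, hl⟩ := h2.1
    obtain ⟨a, b, hab⟩ := exists_isInterval_of_isIndec N hX
    rw [hab.length_eq] at hl
    have hl' : b - a = m + 1 := by exact_mod_cast hl
    have := hab.soc_le
    have := hheight b hab.le
    exact ⟨b, hab.le, by omega⟩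
  · intro v hv
    obtain ⟨X, hX⟩ := exists_isInterval_of_soc_le (N := N) (a := v) (b := v + 1) (by omega) hv (by
      have := hK.lt (b := v + 1) (by omega)
      omega)
    refine (hX.isDClosedSimple_iff.mp (h3.2 X hX.isSimpleModule)).imp id ?_
    rintro ⟨c, e1, e2, e3, e4⟩
    exact ⟨c, e1, e2, e3, le_antisymm (pdI_le_of_gldim_le N h3.1 e2) e4⟩

end Bound

end Nakayama

/-! ### The conditions on characteristics as conditions on the Kupisch function. -/

namespace Nakayama

variable {k A : Type u} [Field k] [Ring A] [Algebra k A] {N : LinearNakayama k A}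
  {M : Type u} [AddCommGroup M] [Module A M] {a b p m d : ℕ}

theorem charEntry_of_odd {L : ℕ → ℕ} {a b u : ℕ} (h : Odd (pdS L u)) :
    charEntry L a b u = pdS L u := if_pos h

theorem charEntry_of_not_odd {L : ℕ → ℕ} {a b u : ℕ} (h : ¬ Odd (pdS L u)) :
    charEntry L a b u = pdI L a b := if_neg h

theorem odd_pdS_of_charEntry {L : ℕ → ℕ} {a b u : ℕ} (h : Odd (charEntry L a b u))
    (h' : Even (pdI L a b)) : Odd (pdS L u) := by
  by_contra hc
  rw [charEntry_of_not_odd hc] at h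
  exact Nat.not_odd_iff_even.mpr h' h

theorem even_pdS_of_charEntry {L : ℕ → ℕ} {a b u : ℕ} (h : Even (charEntry L a b u)) :
    Even (pdS L u) := by
  by_contra hc
  rw [Nat.not_even_iff_odd] at hc
  rw [charEntry_of_odd hc] at h
  exact Nat.not_even_iff_odd.mpr hc h

theorem IsInterval.isPlusStrictlyIncreasing_iff (h : IsInterval N M p (p + m)) :
    IsPlusStrictlyIncreasing A M ↔ IsPlus N.n m N.soc p := by
  have hlt := h.lt
  rw [IsPlusStrictlyIncreasing, and_iff_right h.isIndec]
  constructor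
  · rintro ⟨e, l, hc, he, ho, hi⟩
    obtain ⟨h1, h2⟩ := (h.hasChar_iff _).mp hc
    rw [List.length_cons] at h1
    have h3 := h2 0 (by simp)
    rw [List.getElem_cons_zero, add_zero] at h3
    have h4 : Even (pdS N.soc p) := even_pdS_of_charEntry (h3 ▸ he)
    rw [charEntry_of_not_odd (Nat.not_odd_iff_even.mpr h4)] at h3
    have h5 : ∀ i (hi : i < l.length), Odd (pdS N.soc (p + (i + 1))) ∧
        l[i] = pdS N.soc (p + (i + 1)) := by
      intro i hi
      have h5 := h2 (i + 1) (by simpa using hi)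
      rw [List.getElem_cons_succ] at h5
      have h6 := odd_pdS_of_charEntry (h5 ▸ ho _ (List.getElem_mem hi)) (h3 ▸ he)
      exact ⟨h6, by rw [h5, charEntry_of_odd h6]⟩
    rw [List.pairwise_append] at hi
    refine ⟨h.le, h4, fun u hu hu' => ?_, fun u hu hu' => ?_, h3 ▸ he, fun u hu hu' => ?_⟩
    · obtain ⟨i, rfl⟩ : ∃ i, u = p + (i + 1) := ⟨u - p - 1, by omega⟩
      exact (h5 i (by omega)).1
    · obtain ⟨i, rfl⟩ : ∃ i, u = p + (i + 1) := ⟨u - p - 1, by omega⟩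
      have h6 := List.pairwise_iff_getElem.mp hi.1 i (i + 1) (by omega) (by omega) (by omega)
      rwa [(h5 i (by omega)).2, (h5 (i + 1) (by omega)).2] at h6
    · obtain ⟨i, rfl⟩ : ∃ i, u = p + (i + 1) := ⟨u - p - 1, by omega⟩
      have h6 := hi.2.2 _ (List.getElem_mem (show i < l.length by omega)) e (by simp)
      rwa [(h5 i (by omega)).2, h3] at h6
  · intro hp
    refine ⟨pdI N.soc p (p + m), (List.range (m - 1)).map fun i => pdS N.soc (p + (i + 1)), ?_,
      hp.even_pd, ?_, ?_⟩
    · rw [h.hasChar_iff]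
      refine ⟨by simp; omega, ?_⟩
      rintro (_ | i) hi
      · rw [List.getElem_cons_zero, add_zero,
          charEntry_of_not_odd (Nat.not_odd_iff_even.mpr hp.even)]
      · simp only [List.length_cons, List.length_map, List.length_range] at hi
        rw [List.getElem_cons_succ, charEntry_of_odd (hp.odd _ (by omega) (by omega))]
        simp
    · intro x hx
      obtain ⟨i, hi, rfl⟩ := List.mem_map.mp hx
      rw [List.mem_range] at hi
      exact hp.odd _ (by omega) (by omega)
    · rw [List.pairwise_append]
      refine ⟨?_, by simp, ?_⟩
      · rw [List.pairwise_map]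
        have hmono : ∀ j i, i < j → j < m - 1 →
            pdS N.soc (p + (i + 1)) < pdS N.soc (p + (j + 1)) := by
          intro j i hij hj
          induction j with
          | zero => omega
          | succ j ih =>
            have h1 := hp.incr (p + (j + 1)) (by omega) (by omega)
            rcases (Nat.lt_succ_iff.mp hij).eq_or_lt with rfl | h2
            · exact h1
            · exact (ih h2 (by omega)).trans h1
        refine List.pairwise_lt_range.imp_of_mem fun {i j} _ hj hij => hmono j i hij ?_
        exact List.mem_range.mp hj
      · intro x hx y hy
        obtain ⟨i, hi, rfl⟩ := List.mem_map.mp hx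
        rw [List.mem_singleton.mp hy]
        rw [List.mem_range] at hi
        exact hp.lt _ (by omega) (by omega)

/-- The radical is the syzygy of the top of the summit, so its projective dimension `e` is one less
than the value at `a + m`. Since `e` is even and the first entry is odd, `e - 1 < c₁` amounts to
comparing the values at `a + m` and `a`. -/
theorem IsInterval.isMinusStrictlyIncreasing_iff (h : IsInterval N M a (a + m)) (hm : 2 ≤ m)
    (hle : a + m + 1 ≤ N.n) (heq : N.soc (a + m + 1) = a) :
    IsMinusStrictlyIncreasing A M ↔ IsMinus N.n m N.soc a := by
  have hlt := h.lt
  have hlast : pdS N.soc (a + m) = 1 + pdI N.soc a (a + m) := by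
    rw [pdS, pdI_step (by omega) (by omega), heq]
  rw [IsMinusStrictlyIncreasing, and_iff_right h.isIndec]
  constructor
  · rintro ⟨e, l, hc, he, ho, hi⟩
    obtain ⟨h1, h2⟩ := (h.hasChar_iff _).mp hc
    rw [List.length_append, List.length_singleton] at h1
    have h3 := h2 l.length (by simp)
    rw [List.getElem_concat_length rfl] at h3
    have h4 : Even (pdS N.soc (a + l.length)) := even_pdS_of_charEntry (h3 ▸ he)
    rw [charEntry_of_not_odd (Nat.not_odd_iff_even.mpr h4)] at h3
    have h5 : ∀ i (hi : i < l.length), Odd (pdS N.soc (a + i)) ∧ l[i] = pdS N.soc (a + i) := by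
      intro i hi
      have h5 := h2 i (by simp; omega)
      rw [List.getElem_append_left hi] at h5
      have h6 := odd_pdS_of_charEntry (h5 ▸ ho _ (List.getElem_mem hi)) (h3 ▸ he)
      exact ⟨h6, by rw [h5, charEntry_of_odd h6]⟩
    rw [List.pairwise_cons, List.pairwise_map] at hi
    refine ⟨hle, heq, fun u hu hu' => ?_, fun u hu hu' => ?_, fun u hu => ?_, ?_, ?_⟩
    · obtain ⟨i, rfl⟩ : ∃ i, u = a + i := ⟨u - a, by omega⟩
      exact (h5 i (by omega)).1
    · obtain ⟨i, rfl⟩ : ∃ i, u = a + i := ⟨u - a, by omega⟩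
      have h6 := List.pairwise_iff_getElem.mp hi.2 i (i + 1) (by omega) (by omega) (by omega)
      rw [(h5 i (by omega)).2, (h5 (i + 1) (by omega)).2] at h6
      exact_mod_cast h6
    · rwa [show u = a + l.length by omega]
    · rw [hlast, add_comm, ← h3]
      exact he.add_one
    · rw [hlast, ← h3]
      have h6 := h5 0 (by omega)
      have h7 := hi.1 (l[0]'(by omega) : ℕ) (List.mem_map_of_mem (List.getElem_mem (by omega)))
      rw [h6.2, add_zero] at h7
      have h8 : e ≤ pdS N.soc a := by omega
      have h9 : e ≠ pdS N.soc a := by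
        intro h9
        rw [add_zero, ← h9] at h6
        exact Nat.not_odd_iff_even.mpr he h6.1
      omega
  · intro hM
    have hmono : ∀ j i, i < j → j < m - 1 → pdS N.soc (a + i) < pdS N.soc (a + j) := by
      intro j i hij hj
      induction j with
      | zero => omega
      | succ j ih =>
        have h1 := hM.incr (a + j) (by omega) (by omega)
        rcases (Nat.lt_succ_iff.mp hij).eq_or_lt with rfl | h2
        · exact h1
        · exact (ih h2 (by omega)).trans h1
    have hE : Even (pdI N.soc a (a + m)) := by
      have := hM.last
      rw [hlast, Nat.odd_add] at this
      exact this.mp odd_one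
    refine ⟨pdI N.soc a (a + m), (List.range (m - 1)).map fun i => pdS N.soc (a + i), ?_, hE,
      ?_, ?_⟩
    · rw [h.hasChar_iff]
      refine ⟨by simp; omega, fun i hi => ?_⟩
      simp only [List.length_append, List.length_map, List.length_range,
        List.length_singleton] at hi
      rcases Nat.lt_or_ge i (m - 1) with h1 | h1
      · rw [List.getElem_append_left (by simpa using h1),
          charEntry_of_odd (hM.odd _ (by omega) (by omega))]
        simp
      · obtain rfl : i = m - 1 := by omega
        rw [charEntry_of_not_odd (Nat.not_odd_iff_even.mpr (hM.even _ (by omega)))]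
        rw [List.getElem_append_right (by simp)]
        simp
    · intro x hx
      obtain ⟨i, hi, rfl⟩ := List.mem_map.mp hx
      rw [List.mem_range] at hi
      exact hM.odd _ (by omega) (by omega)
    · rw [List.pairwise_cons, List.pairwise_map, List.pairwise_map]
      constructor
      · intro x hx
        rw [List.map_map] at hx
        obtain ⟨i, hi, rfl⟩ := List.mem_map.mp hx
        rw [List.mem_range] at hi
        have h1 := hM.last_le
        have h2 : pdS N.soc a ≤ pdS N.soc (a + i) := by
          rcases Nat.eq_zero_or_pos i with rfl | h2
          · rfl
          · exact (hmono i 0 h2 hi).le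
        change _ < ((pdS N.soc (a + i) : ℕ) : ℤ)
        omega
      · refine List.pairwise_lt_range.imp_of_mem fun {i j} _ hj hij => ?_
        exact_mod_cast hmono j i hij (List.mem_range.mp hj)

theorem IsInterval.isSummitRadical_iff (h : IsInterval N M a (a + m)) (hh : HasHeight A (m + 1)) :
    IsSummitRadical A M ↔ a + m + 1 ≤ N.n ∧ N.soc (a + m + 1) = a := by
  have hlt := h.lt
  constructor
  · rintro ⟨P, hP, ⟨e⟩⟩
    obtain ⟨x, y, hxy⟩ := exists_isInterval_of_isIndec N hP.1
    have h1 := (hh.isSummit_iff hxy).mp hP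
    have h2 := (hxy.rad (by omega)).of_equiv e.symm
    obtain ⟨rfl, h3⟩ := h.eq_of_isInterval h2
    rw [add_assoc, ← h1]
    refine ⟨hxy.le, ?_⟩
    have h4 := hh.length_le (isInterval_projCover (by omega) hxy.le)
    have := hxy.soc_le
    omega
  · rintro ⟨h1, h2⟩
    have h3 := isInterval_projCover (N := N) (b := a + m + 1) (by omega) h1
    rw [h2] at h3
    have h4 := h3.rad (by omega)
    exact ⟨ModuleCat.of A _, (hh.isSummit_iff h3).mpr (by omega), h.nonempty_equiv h4⟩

theorem HasStrictlyIncreasingModule.exists_odd (h : HasStrictlyIncreasingModule A m)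
    (N : LinearNakayama k A) : ∃ p, p + m ≤ N.n ∧ Odd (pdI N.soc p (p + m)) ∧
      ∀ u, p ≤ u → u + 1 < p + m → Odd (pdS N.soc u) → Odd (pdS N.soc (u + 1)) →
        pdS N.soc u < pdS N.soc (u + 1) := by
  obtain ⟨M, h1, h2, h3, x, h4, h5⟩ := h
  obtain ⟨a, b, hab⟩ := exists_isInterval_of_isIndec N h1
  have h6 := hab.lt
  rw [hab.length_eq] at h3
  have h7 : b - a = m := by exact_mod_cast h3
  obtain rfl : b = a + m := by omega
  obtain ⟨h8, h9⟩ := (hab.hasChar_iff x).mp h4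
  refine ⟨a, hab.le, hab.isOddModule_iff.mp h2, fun u hu hu' ho ho' => ?_⟩
  obtain ⟨i, rfl⟩ : ∃ i, u = a + i := ⟨u - a, by omega⟩
  have := List.pairwise_iff_getElem.mp h5 i (i + 1) (by omega) (by omega) (by omega)
  rwa [h9, h9, charEntry_of_odd ho, ← add_assoc, charEntry_of_odd ho'] at this

end Nakayama

/-! ### Dominant dimension of modules and of the algebra. -/

namespace Nakayama

open IsIntervalFamily

section Generalities

variable {R : Type u} [Ring R] {M M' : Type u} [AddCommGroup M] [Module R M] [AddCommGroup M']
  [Module R M']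

theorem DomDimGE.of_subsingleton [Subsingleton M] (n : ℕ) : DomDimGE R n (ModuleCat.of R M) := by
  induction n generalizing M with
  | zero => trivial
  | succ n ih =>
    refine ⟨ModuleCat.of R M, LinearMap.id, ⟨⟨fun X Y _ _ _ _ f _ g =>
      ⟨0, fun x => Subsingleton.elim (α := M) _ _⟩⟩, Function.injective_id, fun N _ => ?_⟩, ?_, ?_⟩
    · exact Subsingleton.elim (α := Submodule R M) _ _
    · exact inferInstanceAs (Module.Projective R M)
    · exact ih (M := M ⧸ LinearMap.range (LinearMap.id : M →ₗ[R] M))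

theorem DomDimGE.of_equiv {n : ℕ} (h : DomDimGE R n (ModuleCat.of R M)) (e : M' ≃ₗ[R] M) :
    DomDimGE R n (ModuleCat.of R M') := by
  match n, h with
  | 0, _ => trivial
  | n + 1, ⟨I, f, ⟨h1, h2, h3⟩, h4, h5⟩ =>
    have hr : LinearMap.range (f ∘ₗ e.toLinearMap) = LinearMap.range f :=
      LinearMap.range_comp_of_range_eq_top _ e.range
    refine ⟨I, f ∘ₗ e.toLinearMap, ⟨h1, h2.comp e.injective, fun N hN => h3 N ?_⟩, h4, ?_⟩
    · rwa [hr] at hN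
    · change DomDimGE R n (ModuleCat.of R (I ⧸ LinearMap.range (f ∘ₗ e.toLinearMap)))
      rw [hr]
      exact h5

theorem exists_smul_mem_range {I : Type u} [AddCommGroup I] [Module R I] {f : M →ₗ[R] I}
    (hf : IsInjectiveEnvelope f) {u : I} (hu : u ≠ 0) : ∃ r : R, r • u ≠ 0 ∧
      r • u ∈ LinearMap.range f := by
  by_contra! hcon
  apply hu
  have := hf.2.2 (Submodule.span R {u}) (by
    rw [Submodule.eq_bot_iff]
    rintro _ ⟨h1, h2⟩
    obtain ⟨r, rfl⟩ := Submodule.mem_span_singleton.mp h1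
    by_contra h3
    exact hcon r h3 h2)
  rwa [Submodule.span_singleton_eq_bot] at this

theorem nonempty_quotient_prod_equiv (U : Submodule R M) (V : Submodule R M') :
    Nonempty (((M × M') ⧸ U.prod V) ≃ₗ[R] (M ⧸ U) × (M' ⧸ V)) := by
  let f : M × M' →ₗ[R] (M ⧸ U) × (M' ⧸ V) := LinearMap.prodMap U.mkQ V.mkQ
  have hf : Function.Surjective f :=
    Prod.map_surjective.mpr ⟨U.mkQ_surjective, V.mkQ_surjective⟩
  have hk : LinearMap.ker f = U.prod V := by
    rw [LinearMap.ker_prodMap, Submodule.ker_mkQ, Submodule.ker_mkQ]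
  exact ⟨(Submodule.quotEquivOfEq _ _ hk.symm).trans (f.quotKerEquivOfSurjective hf)⟩

theorem DomDimGE.prod {n : ℕ} (h : DomDimGE R n (ModuleCat.of R M))
    (h' : DomDimGE R n (ModuleCat.of R M')) : DomDimGE R n (ModuleCat.of R (M × M')) := by
  induction n generalizing M M' with
  | zero => trivial
  | succ n ih =>
    obtain ⟨I, f, h1, h2, h3⟩ := h
    obtain ⟨I', f', h1', h2', h3'⟩ := h'
    let g : M × M' →ₗ[R] I × I' := LinearMap.prodMap (M := M) (M₂ := M') f f'
    have hr : LinearMap.range g = (LinearMap.range f).prod (LinearMap.range f') :=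
      LinearMap.range_prodMap (M := M) (M₂ := M') f f'
    refine ⟨ModuleCat.of R (I × I'), g, ⟨⟨fun X Y _ _ _ _ a ha b => ?_⟩, ?_, fun N hN => ?_⟩, ?_, ?_⟩
    · obtain ⟨c, hc⟩ := h1.1.out a ha (LinearMap.fst R I I' ∘ₗ b)
      obtain ⟨c', hc'⟩ := h1'.1.out a ha (LinearMap.snd R I I' ∘ₗ b)
      exact ⟨c.prod c', fun x => Prod.ext (hc x) (hc' x)⟩
    · exact Prod.map_injective.mpr ⟨h1.2.1, h1'.2.1⟩
    · change N ⊓ LinearMap.range g = ⊥ at hN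
      rw [hr] at hN
      -- Essentiality is tested elementwise: a non-zero coordinate can be multiplied into the range
      -- while staying non-zero, first for one factor, then for the other.
      have key : ∀ v : I × I', v ∈ N → v.1 ∈ LinearMap.range f → v.2 ∈ LinearMap.range f' →
          v = 0 := by
        intro v h4 h5 h6
        have h7 : v ∈ N ⊓ (LinearMap.range f).prod (LinearMap.range f') := ⟨h4, h5, h6⟩
        rwa [hN] at h7
      have key' : ∀ v : I × I', v ∈ N → v.1 ∈ LinearMap.range f → v.2 = 0 := by
        intro v h4 h5
        by_contra h6
        obtain ⟨r, h7, h8⟩ := exists_smul_mem_range h1' h6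
        exact h7 (congrArg Prod.snd (key (r • v) (N.smul_mem r h4) (Submodule.smul_mem _ r h5) h8))
      rw [Submodule.eq_bot_iff]
      intro v hv
      have h5 : v.1 = 0 := by
        by_contra h4
        obtain ⟨r, h7, h8⟩ := exists_smul_mem_range h1 h4
        have h9 := key' (r • v) (N.smul_mem r hv) h8
        exact h7 (congrArg Prod.fst (key (r • v) (N.smul_mem r hv) h8 (by
          rw [h9]; exact Submodule.zero_mem _)))
      exact Prod.ext h5 (key' v hv (by rw [h5]; exact Submodule.zero_mem _))
    · exact inferInstanceAs (Module.Projective R (I × I'))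
    · change DomDimGE R n (ModuleCat.of R ((I × I') ⧸ LinearMap.range g))
      rw [hr]
      obtain ⟨e⟩ := nonempty_quotient_prod_equiv (LinearMap.range f) (LinearMap.range f')
      exact (ih h3 h3').of_equiv e

theorem DomDimGE.pi {n l : ℕ} {F : Fin l → Type u} [∀ i, AddCommGroup (F i)] [∀ i, Module R (F i)]
    (h : ∀ i, DomDimGE R n (ModuleCat.of R (F i))) : DomDimGE R n (ModuleCat.of R (∀ i, F i)) := by
  induction l with
  | zero => exact .of_subsingleton n
  | succ l ih =>
    exact ((h 0).prod (ih fun i => h i.succ)).of_equiv (Fin.consLinearEquiv R F).symm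

end Generalities

variable {k A : Type u} [Field k] [Ring A] [Algebra k A] {N : LinearNakayama k A}
  {M : Type u} [AddCommGroup M] [Module A M] {a b x y m n d : ℕ}

/-- The embedding of an interval module into the one with the same socle. -/
theorem IsIntervalBasis.exists_injective {X : Type u} [AddCommGroup X] [Module A X] {w : ℕ → X}
    (hw : IsIntervalBasis N x b w) (h : IsInterval N M x y) (hyb : y ≤ b) :
    ∃ j : M →ₗ[A] X, Function.Injective j ∧ LinearMap.range j = below A w y := by
  obtain ⟨e⟩ := h.nonempty_equiv (hw.isInterval_below h.lt hyb)
  refine ⟨(below A w y).subtype ∘ₗ e.toLinearMap,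
    (Submodule.injective_subtype _).comp e.injective, ?_⟩
  rw [LinearMap.range_comp_of_range_eq_top _ e.range, Submodule.range_subtype]

theorem IsInterval.le_rightEnd (h : IsInterval N M a b) : b ≤ rightEnd N.n N.soc a :=
  IsKupisch.le_rightEnd h.le h.soc_le

theorem IsInterval.exists_envelope (h : IsInterval N M a b) :
    ∃ J : ModuleCat.{u} A, IsInterval N J a (rightEnd N.n N.soc a) :=
  exists_isInterval_of_soc_le (h.lt.trans_le h.le_rightEnd) (IsKupisch.rightEnd_le a)
    (N.isKupisch.map_rightEnd_le a)

theorem IsInterval.injective_iff (h : IsInterval N M a b) :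
    Module.Injective A M ↔ b = rightEnd N.n N.soc a := by
  refine ⟨fun hM => le_antisymm h.le_rightEnd ?_, h.injective_of_eq⟩
  obtain ⟨J, w, hw⟩ := h.exists_envelope
  obtain ⟨j, hj, hr⟩ := hw.exists_injective h h.le_rightEnd
  obtain ⟨r, hrj⟩ := hM.out j hj LinearMap.id
  have hdis : Disjoint (LinearMap.range j) (LinearMap.ker r) := by
    rw [Submodule.disjoint_def]
    rintro _ ⟨x, rfl⟩ hx
    have h1 : r (j x) = x := hrj x
    rw [LinearMap.mem_ker, h1] at hx
    rw [hx, map_zero]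
  rcases IsInterval.eq_bot_or_eq_bot ⟨w, hw⟩ _ _ hdis with h1 | h1
  · have := h.nontrivial
    obtain ⟨x, hx⟩ := exists_ne (0 : M)
    have h2 : j x ∈ LinearMap.range j := ⟨x, rfl⟩
    rw [h1, Submodule.mem_bot, ← map_zero j] at h2
    exact absurd (hj h2) hx
  · exact (IsInterval.eq_of_injective ⟨w, hw⟩ h r (LinearMap.ker_eq_bot.mp h1)).2

/-- The condition passes to retracts. Extend inclusion and retraction to the injective modules by
`α` and `β`. The composite `β ∘ α` fixes the image of `M`, hence is injective on the uniserial
envelope and bijective by finite length. Correcting `β` by its inverse makes the cosyzygy of `M` a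
retract of that of `X`. -/
theorem IsInterval.domDimInterval (h : IsInterval N M x y) {X : Type u} [AddCommGroup X]
    [Module A X] (i : M →ₗ[A] X) (r : X →ₗ[A] M) (hri : ∀ u, r (i u) = u)
    (hX : DomDimGE A n (ModuleCat.of A X)) : DomDimInterval N.n N.soc n x y := by
  induction n generalizing M X x y with
  | zero => trivial
  | succ n ih =>
    obtain ⟨I, ι, ⟨hI, hι, -⟩, hP, hD⟩ : ∃ (I : ModuleCat.{u} A) (f : X →ₗ[A] I),
      IsInjectiveEnvelope f ∧ Module.Projective A I ∧
        DomDimGE A n (ModuleCat.of A (I ⧸ LinearMap.range f)) := hX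
    have hinj : Function.Injective (ι ∘ₗ i) := hι.comp (Function.LeftInverse.injective hri)
    refine ⟨h.isProjSocle_of_injective (ι ∘ₗ i) hinj, fun hlt => ?_⟩
    obtain ⟨J, w, hw⟩ := h.exists_envelope
    obtain ⟨j, hj, hr⟩ := hw.exists_injective h h.le_rightEnd
    have hJ : IsInterval N J x (rightEnd N.n N.soc x) := ⟨w, hw⟩
    have hJi := hJ.injective_iff.mpr rfl
    obtain ⟨α, hα⟩ := hI.out j hj (ι ∘ₗ i)
    obtain ⟨β, hβ⟩ := hJi.out ι hι (j ∘ₗ r)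
    have hβα : ∀ u, β (α (j u)) = j u := by
      intro u
      rw [hα]
      change β (ι (i u)) = _
      rw [hβ]
      exact congrArg j (hri u)
    have hθ : Function.Injective (β ∘ₗ α) := by
      rw [← LinearMap.ker_eq_bot]
      have hdis : Disjoint (LinearMap.range j) (LinearMap.ker (β ∘ₗ α)) := by
        rw [Submodule.disjoint_def]
        rintro _ ⟨u, rfl⟩ hu
        rw [LinearMap.mem_ker] at hu
        rw [← hβα u]
        exact hu
      refine (hJ.eq_bot_or_eq_bot _ _ hdis).resolve_left fun h1 => ?_
      rw [hr] at h1
      have := hw.below_injective (c := y) (c' := x) h.lt.le hlt.le le_rfl hw.lt.le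
        (by rw [h1, hw.below_eq_bot le_rfl])
      have := h.lt
      omega
    have := N.isArtinianRing
    have := hJ.finite
    have hJart : IsArtinian A J := inferInstance
    obtain ⟨e, he⟩ : ∃ e : J ≃ₗ[A] J, ∀ u, e u = β (α u) :=
      ⟨LinearEquiv.ofBijective _ (IsArtinian.bijective_of_injective_endomorphism (β ∘ₗ α) hθ),
        fun u => rfl⟩
    have hej : ∀ u, e.symm (j u) = j u := by
      intro u
      rw [LinearEquiv.symm_apply_eq, he, hβα]
    have hq : IsInterval N (J ⧸ LinearMap.range j) y (rightEnd N.n N.soc x) := by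
      rw [hr]
      exact hw.isInterval_quotient h.lt.le hlt
    refine ih hq (Submodule.mapQ _ (LinearMap.range ι) α ?_)
      (Submodule.mapQ (LinearMap.range ι) _ (e.symm.toLinearMap ∘ₗ β) ?_) ?_ hD
    · rintro _ ⟨u, rfl⟩
      exact ⟨i u, (hα u).symm⟩
    · rintro _ ⟨u, rfl⟩
      exact ⟨r u, by
        change j (r u) = e.symm (β (ι u))
        rw [hβ]
        exact (hej (r u)).symm⟩
    · intro u
      obtain ⟨u, rfl⟩ := Submodule.Quotient.mk_surjective _ u
      rw [Submodule.mapQ_apply, Submodule.mapQ_apply]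
      change Submodule.Quotient.mk (e.symm (β (α u))) = _
      rw [← he, LinearEquiv.symm_apply_apply]

theorem IsInterval.domDimGE (h : IsInterval N M x y) (hD : DomDimInterval N.n N.soc n x y) :
    DomDimGE A n (ModuleCat.of A M) := by
  induction n generalizing M x y with
  | zero => trivial
  | succ n ih =>
    obtain ⟨hx, hD⟩ := hD
    obtain ⟨J, w, hw⟩ := h.exists_envelope
    obtain ⟨j, hj, hr⟩ := hw.exists_injective h h.le_rightEnd
    have hJ : IsInterval N J x (rightEnd N.n N.soc x) := ⟨w, hw⟩
    refine ⟨J, j, ⟨hJ.injective_iff.mpr rfl, hj, fun V hV => ?_⟩,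
      hJ.projective_iff.mpr (N.isKupisch.map_rightEnd hx).symm, ?_⟩
    · refine (hJ.eq_bot_or_eq_bot V _ (disjoint_iff.mpr hV)).resolve_right fun h1 => ?_
      change LinearMap.range j = ⊥ at h1
      rw [hr] at h1
      have := hw.below_injective (c := y) (c' := x) h.lt.le h.le_rightEnd le_rfl hw.lt.le
        (by rw [h1, hw.below_eq_bot le_rfl])
      have := h.lt
      omega
    · change DomDimGE A n (ModuleCat.of A (J ⧸ LinearMap.range j))
      rw [hr]
      rcases h.le_rightEnd.eq_or_lt with h1 | h1
      · have : Subsingleton (J ⧸ below A w y) := by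
          rw [h1, hw.below_top]
          infer_instance
        exact .of_subsingleton n
      · exact ih (hw.isInterval_quotient h.lt.le h1) (hD h1)

variable (N) in
theorem LinearNakayama.nonempty_equiv_pi :
    Nonempty (A ≃ₗ[A] ∀ i : Fin N.n, projCover N (i + 1)) := by
  let f : A →ₗ[A] ∀ i : Fin N.n, projCover N (i + 1) := LinearMap.pi fun i =>
    LinearMap.toSpanSingleton A _ ⟨_, path_mem_projCover (N := N) i.val.succ_pos⟩
  have hf : ∀ u i, (f u i : A) = u * N.path i (i + 1) := fun u i => rfl
  refine ⟨LinearEquiv.ofBijective f ⟨?_, ?_⟩⟩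
  · rw [← LinearMap.ker_eq_bot, LinearMap.ker_eq_bot']
    intro u hu
    rw [← mul_one u, LinearNakayama.one_eq_sum (N := N), Finset.mul_sum]
    refine Finset.sum_eq_zero fun t ht => ?_
    rw [← hf u ⟨t, Finset.mem_range.mp ht⟩, hu]
    rfl
  · intro v
    refine ⟨∑ i, (v i : A), funext fun i => Subtype.ext ?_⟩
    rw [hf, Finset.sum_mul, Finset.sum_eq_single_of_mem i (Finset.mem_univ i)]
    · exact smul_path_of_mem_projCover (b := i + 1) (by omega) (v i).2
    · intro j _ hj
      have h1 := smul_path_of_mem_projCover (b := j + 1) (by omega) (v j).2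
      rw [Nat.add_sub_cancel] at h1
      rw [← h1, mul_assoc]
      have h2 : N.path (j : ℕ) (j + 1) * N.path (i : ℕ) (i + 1) = 0 :=
        LinearNakayama.path_mul_path_of_ne (by
          have := Fin.val_ne_of_ne hj
          omega)
      rw [h2, mul_zero]

theorem domDimGE_iff (N : LinearNakayama k A) : DomDimGE A n (ModuleCat.of A A) ↔
    ∀ b, 0 < b → b ≤ N.n → DomDimInterval N.n N.soc n (N.soc b) b := by
  constructor
  · intro h b hb hbn
    exact (isInterval_projCover hb hbn).domDimInterval (projCover N b).subtype
      (LinearMap.toSpanSingleton A _ ⟨_, path_mem_projCover hb⟩)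
      (fun u => Subtype.ext (smul_path_of_mem_projCover hb u.2)) h
  · intro h
    obtain ⟨e⟩ := N.nonempty_equiv_pi
    refine (DomDimGE.pi fun i => ?_).of_equiv e
    exact (isInterval_projCover (by omega) i.isLt).domDimGE (h _ (by omega) i.isLt)

theorem DomDimInterval.mono {L : ℕ → ℕ} {n' l : ℕ} (h : DomDimInterval l L n x y) (hn : n' ≤ n) :
    DomDimInterval l L n' x y := by
  induction n' generalizing n x y with
  | zero => trivial
  | succ n' ih =>
    obtain ⟨n, rfl⟩ : ∃ e, n = e + 1 := ⟨n - 1, by omega⟩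
    exact ⟨h.1, fun h1 => ih (h.2 h1) (by omega)⟩

/-- The last vertex is not the socle of a projective module, so its closedness provides a module of
projective dimension `d`. -/
theorem IsBoundKupisch.le_gldim (hB : IsBoundKupisch N.n m d N.soc) :
    ((d : ℕ∞) : WithBot ℕ∞) ≤ gldim A := by
  have hm := hB.two_le
  obtain ⟨s, hs, hs'⟩ := hB.summit
  rcases hB.closed (N.n - 1) (by omega) with ⟨b, hb, hb0, h1⟩ | ⟨c, h1, h2, h3, h4⟩
  · have := hB.mono hb
    have := hB.add_two_le N.n (by omega)
    omega
  · obtain ⟨X, hX⟩ := exists_isInterval_of_soc_le h1 h2 h3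
    have := hX.finite
    rw [← h4, ← hX.pd_eq]
    exact pd_le_gldim

theorem IsBoundKupisch.isHigherAuslander_iff (hB : IsBoundKupisch N.n m d N.soc)
    (hd : IsDBound A d) : IsHigherAuslander A d ↔
      ∀ b, 0 < b → b ≤ N.n → DomDimInterval N.n N.soc d (N.soc b) b := by
  have hgl : gldim A = ((d : ℕ∞) : WithBot ℕ∞) := le_antisymm hd.1 hB.le_gldim
  rw [IsHigherAuslander, and_iff_left hgl, hgl, WithBot.coe_inj]
  constructor
  · intro h b hb hbn
    by_contra hcon
    have h1 : domdim A ≤ ((d - 1 : ℕ) : ℕ∞) := by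
      refine iSup₂_le fun n hn => ?_
      rw [domDimGE_iff N] at hn
      have : n < d := by
        by_contra hc
        exact hcon ((hn b hb hbn).mono (not_lt.mp hc))
      exact_mod_cast Nat.le_sub_one_of_lt this
    rw [← h] at h1
    have h2 : d ≤ d - 1 := by exact_mod_cast h1
    have := hB.d_pos
    omega
  · intro h
    apply le_antisymm
    · exact le_iSup₂ (f := fun (n : ℕ) (_ : DomDimGE A n (ModuleCat.of A A)) => (n : ℕ∞)) d
        ((domDimGE_iff N).mpr h)
    · refine iSup₂_le fun n hn => ?_
      rw [domDimGE_iff N] at hn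
      by_contra hc
      have hlt : d < n := by
        have := not_le.mp hc
        exact_mod_cast this
      have hm := hB.two_le
      obtain ⟨s, hs, hs'⟩ := hB.summit
      -- The simple projective module is not injective, since it is the socle of the next projective
      -- module. It bounds the dominant dimension by `d`.
      refine hB.toIsKupisch.not_domDimInterval (n := N.n) (b := 1) (by omega) one_pos ?_ hB.pd_le
        hlt (hn 1 one_pos (by omega))
      refine lt_of_lt_of_le one_lt_two (IsKupisch.le_rightEnd (by omega) ?_)
      have := hB.add_two_le 2 le_rfl
      omega

end Nakayama

/-! ### The equivalences within the combinatorial model. -/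

namespace Nakayama

variable {k A : Type u} [Field k] [Ring A] [Algebra k A] {N : LinearNakayama k A} {m d : ℕ}

theorem exists_isInterval_of_length_eq (N : LinearNakayama k A) {Y : ModuleCat.{u} A}
    (hY : IsIndec A Y) (hl : Module.length A Y = m) : ∃ p, IsInterval N Y p (p + m) := by
  obtain ⟨a, b, hab⟩ := exists_isInterval_of_isIndec N hY
  have h1 := hab.lt
  rw [hab.length_eq] at hl
  have h2 : b - a = m := by exact_mod_cast hl
  exact ⟨a, by rwa [show a + m = b by omega]⟩

namespace IsBoundKupisch

theorem exists_plus_iff (hB : IsBoundKupisch N.n m d N.soc) (Q : ModuleCat.{u} A → Prop)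
    (q : ℕ → Prop) (hQ : ∀ (p : ℕ) (Y : ModuleCat.{u} A), IsInterval N Y p (p + m) →
      IsPlus N.n m N.soc p → (Q Y ↔ q p)) :
    (∃ Y : ModuleCat.{u} A, IsPlusStrictlyIncreasing A Y ∧ Module.length A Y = m ∧ Q Y) ↔
      ∃ p, IsPlus N.n m N.soc p ∧ q p := by
  have hm := hB.two_le
  constructor
  · rintro ⟨Y, h1, h2, h3⟩
    obtain ⟨p, hp⟩ := exists_isInterval_of_length_eq N h1.1 h2
    have h4 := hp.isPlusStrictlyIncreasing_iff.mp h1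
    exact ⟨p, h4, (hQ p Y hp h4).mp h3⟩
  · rintro ⟨p, h1, h2⟩
    have h3 := h1.lt (p + 1) (by omega) (by omega)
    have h4 := hB.eq_of_pos h1.le (by omega)
    obtain ⟨Y, hY⟩ := exists_isInterval_of_soc_le (N := N) (a := p) (b := p + m) (by omega) h1.le
      (by omega)
    exact ⟨Y, hY.isPlusStrictlyIncreasing_iff.mpr h1, by
      rw [hY.length_eq, Nat.add_sub_cancel_left], (hQ p Y hY h1).mpr h2⟩

theorem exists_minus_iff (hB : IsBoundKupisch N.n m d N.soc) (hh : HasHeight A (m + 1))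
    (Q : ModuleCat.{u} A → Prop) (q : ℕ → Prop)
    (hQ : ∀ (a : ℕ) (Y : ModuleCat.{u} A), IsInterval N Y a (a + m) →
      IsMinus N.n m N.soc a → (Q Y ↔ q a)) :
    (∃ R : ModuleCat.{u} A, IsMinusStrictlyIncreasing A R ∧ Module.length A R = m ∧
      IsSummitRadical A R ∧ Q R) ↔ ∃ a, IsMinus N.n m N.soc a ∧ q a := by
  have hm := hB.two_le
  constructor
  · rintro ⟨Y, h1, h2, h3, h4⟩
    obtain ⟨a, ha⟩ := exists_isInterval_of_length_eq N h1.1 h2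
    obtain ⟨h5, h6⟩ := (ha.isSummitRadical_iff hh).mp h3
    have h7 := (ha.isMinusStrictlyIncreasing_iff hm h5 h6).mp h1
    exact ⟨a, h7, (hQ a Y ha h7).mp h4⟩
  · rintro ⟨a, h1, h2⟩
    have h3 := hB.mono (show a + m ≤ a + m + 1 by omega)
    rw [h1.eq] at h3
    have h4 := h1.le
    obtain ⟨Y, hY⟩ := exists_isInterval_of_soc_le (N := N) (a := a) (b := a + m) (by omega)
      (by omega) h3
    exact ⟨Y, (hY.isMinusStrictlyIncreasing_iff hm h4 h1.eq).mpr h1, by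
      rw [hY.length_eq, Nat.add_sub_cancel_left], (hY.isSummitRadical_iff hh).mpr ⟨h4, h1.eq⟩,
      (hQ a Y hY h1).mpr h2⟩

theorem plus_pd_iff (hB : IsBoundKupisch N.n m d N.soc) :
    (∃ Y : ModuleCat.{u} A, IsPlusStrictlyIncreasing A Y ∧ Module.length A Y = m ∧
      pd A (socle A (Y ⧸ socle A Y)) = 1) ↔ ∃ p, IsPlus N.n m N.soc p ∧ pdS N.soc (p + 1) = 1 := by
  refine hB.exists_plus_iff _ _ fun p Y hY _ => ?_
  have hm := hB.two_le
  rw [(hY.quotient_socle (by omega)).socle.pd_eq]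
  exact ⟨fun h => by exact_mod_cast h, fun h => by exact_mod_cast h⟩

theorem plus_iff (hB : IsBoundKupisch N.n m d N.soc) :
    (∃ Y : ModuleCat.{u} A, IsPlusStrictlyIncreasing A Y ∧ Module.length A Y = m) ↔
      ∃ p, IsPlus N.n m N.soc p := by
  simpa using hB.exists_plus_iff (fun _ => True) (fun _ => True) fun _ _ _ _ => Iff.rfl

theorem plus_injective_iff (hB : IsBoundKupisch N.n m d N.soc) :
    (∃ Y : ModuleCat.{u} A, IsPlusStrictlyIncreasing A Y ∧ Module.length A Y = m ∧
      Module.Injective A Y) ↔ ∃ p, IsPlus N.n m N.soc p ∧ rightEnd N.n N.soc p = p + m :=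
  hB.exists_plus_iff _ _ fun _ _ hY _ => hY.injective_iff.trans eq_comm

theorem minus_projective_iff (hB : IsBoundKupisch N.n m d N.soc) (hh : HasHeight A (m + 1)) :
    (∃ R : ModuleCat.{u} A, IsMinusStrictlyIncreasing A R ∧ Module.length A R = m ∧
      IsSummitRadical A R ∧ Module.Projective A R) ↔
      ∃ a, IsMinus N.n m N.soc a ∧ pdS N.soc (a + m) = 1 := by
  refine hB.exists_minus_iff hh _ _ fun a Y hY ha => ?_
  have hm := hB.two_le
  have h1 := ha.eq
  have h2 : pdS N.soc (a + m) = 1 + pdI N.soc a (a + m) := by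
    rw [pdS, pdI_step (by omega) (by omega), h1]
  have h3 := hY.soc_le
  rw [hY.projective_iff, h2]
  constructor
  · intro h4
    rw [pdI_eq_zero h4.le]
  · intro h4
    by_contra h5
    rw [pdI_step (by omega) (by omega)] at h4
    omega

theorem minus_iff (hB : IsBoundKupisch N.n m d N.soc) (hh : HasHeight A (m + 1)) :
    (∃ R : ModuleCat.{u} A, IsMinusStrictlyIncreasing A R ∧ Module.length A R = m ∧
      IsSummitRadical A R) ↔ ∃ a, IsMinus N.n m N.soc a := by
  simpa using hB.exists_minus_iff hh (fun _ => True) (fun _ => True) fun _ _ _ _ => Iff.rfl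

theorem minus_pd_iff (hB : IsBoundKupisch N.n m d N.soc) (hh : HasHeight A (m + 1)) :
    (∃ R : ModuleCat.{u} A, IsMinusStrictlyIncreasing A R ∧ Module.length A R = m ∧
      IsSummitRadical A R ∧ pd A (top A R) = ((d : ℕ∞) : WithBot ℕ∞)) ↔
      ∃ a, IsMinus N.n m N.soc a ∧ pdS N.soc (a + m - 1) = d := by
  refine hB.exists_minus_iff hh _ _ fun a Y hY ha => ?_
  have hm := hB.two_le
  rw [hY.top.pd_eq, pdS, Nat.sub_add_cancel (by omega)]
  exact ⟨fun h => by exact_mod_cast h, fun h => by exact_mod_cast h⟩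

theorem tfae_combinatorial (hB : IsBoundKupisch N.n m d N.soc) :
    [∀ b, 0 < b → b ≤ N.n → DomDimInterval N.n N.soc d (N.soc b) b,
      ∃ p, IsPlus N.n m N.soc p ∧ pdS N.soc (p + 1) = 1,
      ∃ p, IsPlus N.n m N.soc p,
      ∃ p, IsPlus N.n m N.soc p ∧ rightEnd N.n N.soc p = p + m,
      ∃ a, IsMinus N.n m N.soc a ∧ pdS N.soc (a + m) = 1,
      ∃ a, IsMinus N.n m N.soc a,
      ∃ a, IsMinus N.n m N.soc a ∧ pdS N.soc (a + m - 1) = d].TFAE := by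
  have hm := hB.two_le
  tfae_have 3 → 6 := fun ⟨_, hp⟩ => hB.exists_isMinus_of_isPlus hp
  tfae_have 6 → 5 := fun ⟨_, ha⟩ => hB.exists_isMinus_last_eq_one ha
  tfae_have 5 → 2 := fun ⟨a, ha, h⟩ => ⟨a + m - 1, hB.isPlus_of_isMinus ha, by
    rwa [Nat.sub_add_cancel (by omega)]⟩
  tfae_have 2 → 3 := fun ⟨p, hp, _⟩ => ⟨p, hp⟩
  tfae_have 6 → 7 := fun ⟨_, ha⟩ => hB.exists_isMinus_even_eq ha
  tfae_have 7 → 4 := fun ⟨_, ha, h⟩ => ⟨_, hB.isPlus_of_isMinus ha, hB.rightEnd_of_isMinus ha h⟩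
  tfae_have 4 → 1 := fun ⟨_, hp, h⟩ _ hb hbn => hB.domDimInterval_of_isPlus hp h hb hbn
  tfae_have 1 → 3 := hB.exists_isPlus_of_domDimInterval
  tfae_finish

theorem isHigherAuslander_of_hasStrictlyIncreasingModule (hB : IsBoundKupisch N.n m d N.soc)
    (hd : IsDBound A d) (h : HasStrictlyIncreasingModule A m) : IsHigherAuslander A d := by
  obtain ⟨p, h1, h2, h3⟩ := h.exists_odd N
  exact (hB.isHigherAuslander_iff hd).mpr
    ((hB.tfae_combinatorial.out 2 0).mp (hB.exists_isPlus_of_odd h1 h2 h3))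

end IsBoundKupisch

end Nakayama

/-! ### Restriction along surjections which preserve projectivity. -/

namespace Nakayama

open CategoryTheory

section ChangeOfRings

variable {B C : Type u} [Ring B] [Ring C]

theorem exists_restrictScalars (π : C →+* B) (P : Type u) [AddCommGroup P] [Module B P] :
    ∃ (P' : ModuleCat.{u} C) (e : P' ≃+ P), ∀ (x : C) (u : P'), e (x • u) = π x • e u :=
  ⟨(ModuleCat.restrictScalars π).obj (ModuleCat.of B P), AddEquiv.refl P, fun _ _ => rfl⟩

section

variable {π : C →+* B} {M M' X X' : Type u} [AddCommGroup M] [Module B M] [AddCommGroup M']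
  [Module C M'] [AddCommGroup X] [Module B X] [AddCommGroup X'] [Module C X']

theorem symm_smul {e : M' ≃+ M} (he : ∀ (x : C) u, e (x • u) = π x • e u) (x : C) (u : M) :
    e.symm (π x • u) = x • e.symm u := by
  rw [AddEquiv.symm_apply_eq, he, AddEquiv.apply_symm_apply]

/-- A linear map over the quotient ring, as a linear map over the bigger ring. -/
def pullbackHom {e : M' ≃+ M} (he : ∀ (x : C) u, e (x • u) = π x • e u) {ε : X' ≃+ X}
    (hε : ∀ (x : C) u, ε (x • u) = π x • ε u) (g : X →ₗ[B] M) : X' →ₗ[C] M' where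
  toFun p := e.symm (g (ε p))
  map_add' p q := by rw [map_add, map_add, map_add]
  map_smul' x p := by rw [hε, map_smul, symm_smul he, RingHom.id_apply]

/-- A linear map over the bigger ring, as a linear map over the quotient ring. -/
def pushHom (hπ : Function.Surjective π) {e : M' ≃+ M} (he : ∀ (x : C) u, e (x • u) = π x • e u)
    {ε : X' ≃+ X} (hε : ∀ (x : C) u, ε (x • u) = π x • ε u) (g : X' →ₗ[C] M') : X →ₗ[B] M where
  toFun p := e (g (ε.symm p))
  map_add' p q := by rw [map_add, map_add, map_add]
  map_smul' b p := by
    obtain ⟨x, rfl⟩ := hπ b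
    rw [symm_smul hε, map_smul, he, RingHom.id_apply]

end

/-- A surjective ring homomorphism along which projective modules stay projective. -/
structure IsProjectiveSurjection (π : C →+* B) : Prop where
  surjective : Function.Surjective π
  projective : ∀ {P P' : Type u} [AddCommGroup P] [Module B P] [AddCommGroup P'] [Module C P']
    (e : P' ≃+ P), (∀ (x : C) u, e (x • u) = π x • e u) → Module.Projective B P →
    Module.Projective C P'

theorem IsProjectiveSurjection.comp {D : Type u} [Ring D] {π : C →+* B} {ρ : D →+* C}
    (hπ : IsProjectiveSurjection π) (hρ : IsProjectiveSurjection ρ) :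
    IsProjectiveSurjection (π.comp ρ) := by
  refine ⟨hπ.surjective.comp hρ.surjective, fun {P P'} _ _ _ _ e he hP => ?_⟩
  obtain ⟨X, ε, hε⟩ := exists_restrictScalars π P
  refine hρ.projective (e.trans ε.symm) (fun x u => ?_) (hπ.projective ε hε hP)
  rw [AddEquiv.trans_apply, he, RingHom.comp_apply, symm_smul hε, AddEquiv.trans_apply]

/-- The map `i` splits `π` as a map of left `C`-modules. So `B` is a direct summand of `C`, and a
summand of a free `B`-module becomes a summand of a free `C`-module. -/
theorem isProjectiveSurjection_of_section {π : C →+* B} (i : B →+ C)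
    (hi : ∀ x b, i (π x * b) = x * i b) (hπ : ∀ b, π (i b) = b) : IsProjectiveSurjection π := by
  refine ⟨fun b => ⟨i b, hπ b⟩, fun {P P'} _ _ _ _ e he hP => ?_⟩
  obtain ⟨s, hs⟩ := hP.out
  let f : P' →ₗ[C] (P →₀ C) :=
    { toFun := fun p => (s (e p)).mapRange i (map_zero i)
      map_add' := fun p q => by
        ext r
        rw [map_add, map_add, Finsupp.mapRange_apply, Finsupp.add_apply, map_add,
          Finsupp.add_apply, Finsupp.mapRange_apply, Finsupp.mapRange_apply]
      map_smul' := fun x p => by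
        ext r
        rw [he, map_smul, Finsupp.mapRange_apply, Finsupp.smul_apply, smul_eq_mul, hi,
          RingHom.id_apply, Finsupp.smul_apply, Finsupp.mapRange_apply, smul_eq_mul] }
  let g : (P →₀ C) →ₗ[C] P' := Finsupp.linearCombination C e.symm
  refine Module.Projective.of_split f g (LinearMap.ext fun p => e.injective ?_)
  have h1 : g (f p) = ((s (e p)).mapRange i (map_zero i)).sum fun r x => x • e.symm r :=
    Finsupp.linearCombination_apply C _
  have h2 := hs (e p)
  rw [Finsupp.linearCombination_apply] at h2
  rw [LinearMap.comp_apply, h1, Finsupp.sum_mapRange_index (by simp), map_finsuppSum,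
    LinearMap.id_apply]
  conv_rhs => rw [← h2]
  refine Finsupp.sum_congr fun r _ => ?_
  rw [he, hπ, AddEquiv.apply_symm_apply, id]

theorem hasProjectiveDimensionLT_iff_ker {P M : Type u} [AddCommGroup P] [Module B P]
    [Module.Projective B P] [AddCommGroup M] [Module B M] (g : P →ₗ[B] M)
    (hg : Function.Surjective g) (n : ℕ) :
    HasProjectiveDimensionLT (ModuleCat.of B M) (n + 2) ↔
      HasProjectiveDimensionLT (ModuleCat.of B (LinearMap.ker g)) (n + 1) := by
  rw [← (shortExact_quotient (LinearMap.ker g)).hasProjectiveDimensionLT_X₃_iff n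
    ((IsProjective.iff_projective P).mp inferInstance), ← pd_le_iff, ← pd_le_iff (n + 1)]
  rw [pd_congr (g.quotKerEquivOfSurjective hg)]

theorem IsProjectiveSurjection.projective_iff {π : C →+* B} (hπ : IsProjectiveSurjection π)
    {M M' : Type u} [AddCommGroup M] [Module B M] [AddCommGroup M'] [Module C M']
    (e : M' ≃+ M) (he : ∀ (x : C) u, e (x • u) = π x • e u) :
    Module.Projective C M' ↔ Module.Projective B M := by
  refine ⟨fun hM => ?_, hπ.projective e he⟩
  let g : (M →₀ B) →ₗ[B] M := Finsupp.linearCombination B id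
  have hg : Function.Surjective g := Finsupp.linearCombination_id_surjective B M
  obtain ⟨X, ε, hε⟩ := exists_restrictScalars π (M →₀ B)
  have hg' : Function.Surjective (pullbackHom he hε g) :=
    e.symm.surjective.comp (hg.comp ε.surjective)
  obtain ⟨s, hs⟩ := Module.projective_lifting_property (pullbackHom he hε g) LinearMap.id hg'
  refine Module.Projective.of_split (pushHom hπ.surjective hε he s) g (LinearMap.ext fun p => ?_)
  have h1 : e.symm (g (ε (s (e.symm p)))) = e.symm p := LinearMap.congr_fun hs (e.symm p)
  exact e.symm.injective h1

/-- A free cover over `B` remains a projective cover term over `C`, and its kernel is the same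
group. So both sides can be shifted to this syzygy. -/
theorem IsProjectiveSurjection.hasProjectiveDimensionLT_iff {π : C →+* B}
    (hπ : IsProjectiveSurjection π) (n : ℕ) {M M' : Type u} [AddCommGroup M] [Module B M]
    [AddCommGroup M'] [Module C M'] (e : M' ≃+ M) (he : ∀ (x : C) u, e (x • u) = π x • e u) :
    HasProjectiveDimensionLT (ModuleCat.of C M') n ↔
      HasProjectiveDimensionLT (ModuleCat.of B M) n := by
  induction n generalizing M M' with
  | zero =>
    rw [hasProjectiveDimensionLT_zero_iff_isZero, hasProjectiveDimensionLT_zero_iff_isZero,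
      ModuleCat.isZero_iff_subsingleton, ModuleCat.isZero_iff_subsingleton]
    exact e.toEquiv.subsingleton_congr
  | succ n ih =>
    rcases n with _ | n
    · rw [zero_add, ← projective_iff_hasProjectiveDimensionLT,
        ← projective_iff_hasProjectiveDimensionLT]
      exact hπ.projective_iff e he
    let g : (M →₀ B) →ₗ[B] M := Finsupp.linearCombination B id
    have hg : Function.Surjective g := Finsupp.linearCombination_id_surjective B M
    obtain ⟨X, ε, hε⟩ := exists_restrictScalars π (M →₀ B)
    have hX : Module.Projective C X := hπ.projective ε hε inferInstance
    have hg' : Function.Surjective (pullbackHom he hε g) :=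
      e.symm.surjective.comp (hg.comp ε.surjective)
    have hker : ∀ p : X, p ∈ LinearMap.ker (pullbackHom he hε g) ↔ ε p ∈ LinearMap.ker g :=
      fun p => e.symm.map_eq_zero_iff
    rw [hasProjectiveDimensionLT_iff_ker _ hg', hasProjectiveDimensionLT_iff_ker g hg]
    exact ih
      { toFun := fun p => ⟨ε p.1, (hker p.1).mp p.2⟩
        invFun := fun p => ⟨ε.symm p.1, (hker _).mpr (by
          rw [AddEquiv.apply_symm_apply]
          exact p.2)⟩
        left_inv := fun p => Subtype.ext (ε.symm_apply_apply p.1)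
        right_inv := fun p => Subtype.ext (ε.apply_symm_apply p.1)
        map_add' := fun p q => Subtype.ext (map_add ε p.1 q.1) } fun x p => Subtype.ext (hε x p.1)

theorem IsProjectiveSurjection.pd_eq {π : C →+* B} (hπ : IsProjectiveSurjection π)
    {M M' : Type u} [AddCommGroup M] [Module B M] [AddCommGroup M'] [Module C M']
    (e : M' ≃+ M) (he : ∀ (x : C) u, e (x • u) = π x • e u) : pd C M' = pd B M := by
  have key : ∀ n : ℕ, pd C M' ≤ ((n : ℕ∞) : WithBot ℕ∞) ↔ pd B M ≤ ((n : ℕ∞) : WithBot ℕ∞) :=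
    fun n => by rw [pd_le_iff, pd_le_iff, hπ.hasProjectiveDimensionLT_iff _ e he]
  by_cases h0 : Subsingleton M
  · have := e.toEquiv.subsingleton
    rw [pd_eq_bot_iff.mpr h0, pd_eq_bot_iff.mpr this]
  have h1 : pd B M ≠ ⊥ := fun h => h0 (pd_eq_bot_iff.mp h)
  have h2 : pd C M' ≠ ⊥ := fun h => h0 (by
    have := pd_eq_bot_iff.mp h
    exact e.symm.toEquiv.subsingleton)
  obtain ⟨s, hs⟩ := WithBot.ne_bot_iff_exists.mp h1
  obtain ⟨t, ht⟩ := WithBot.ne_bot_iff_exists.mp h2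
  rw [← hs, ← ht] at key ⊢
  simp only [WithBot.coe_le_coe] at key
  rw [WithBot.coe_inj]
  apply le_antisymm
  · induction s using ENat.recTopCoe with
    | top => exact le_top
    | coe s => exact (key s).mpr le_rfl
  · induction t using ENat.recTopCoe with
    | top => exact le_top
    | coe t => exact (key t).mp le_rfl

/-- The submodule over the bigger ring. -/
def pullbackSubmodule {π : C →+* B} {M M' : Type u} [AddCommGroup M] [Module B M]
    [AddCommGroup M'] [Module C M'] (e : M' ≃+ M) (he : ∀ (x : C) u, e (x • u) = π x • e u)
    (V : Submodule B M) : Submodule C M' where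
  carrier := {x | e x ∈ V}
  add_mem' hx hy := by
    rw [Set.mem_ofPred_eq, map_add]
    exact V.add_mem hx hy
  zero_mem' := by
    rw [Set.mem_ofPred_eq, map_zero]
    exact V.zero_mem
  smul_mem' x u hu := by
    rw [Set.mem_ofPred_eq, he]
    exact V.smul_mem _ hu

/-- Submodules over both rings coincide. -/
def submoduleOrderIso {π : C →+* B} (hπ : Function.Surjective π) {M M' : Type u} [AddCommGroup M]
    [Module B M] [AddCommGroup M'] [Module C M'] (e : M' ≃+ M)
    (he : ∀ (x : C) u, e (x • u) = π x • e u) : Submodule B M ≃o Submodule C M' where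
  toFun := pullbackSubmodule e he
  invFun V :=
    { carrier := {x | e.symm x ∈ V}
      add_mem' := fun hx hy => by
        rw [Set.mem_ofPred_eq, map_add]
        exact V.add_mem hx hy
      zero_mem' := by
        rw [Set.mem_ofPred_eq, map_zero]
        exact V.zero_mem
      smul_mem' := fun b u hu => by
        obtain ⟨x, rfl⟩ := hπ b
        rw [Set.mem_ofPred_eq, symm_smul he]
        exact V.smul_mem x hu }
  left_inv V := Submodule.ext fun x => by
    change e (e.symm x) ∈ V ↔ _
    rw [AddEquiv.apply_symm_apply]
  right_inv V := Submodule.ext fun x => by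
    change e.symm (e x) ∈ V ↔ _
    rw [AddEquiv.symm_apply_apply]
  map_rel_iff' {U V} := by
    refine ⟨fun h x hx => ?_, fun h x hx => h hx⟩
    have := h (show e.symm x ∈ pullbackSubmodule e he U by
      change e (e.symm x) ∈ U
      rwa [AddEquiv.apply_symm_apply])
    change e (e.symm x) ∈ V at this
    rwa [AddEquiv.apply_symm_apply] at this

theorem exists_quotient_addEquiv {π : C →+* B} {M M' : Type u} [AddCommGroup M] [Module B M]
    [AddCommGroup M'] [Module C M'] (e : M' ≃+ M) (he : ∀ (x : C) u, e (x • u) = π x • e u)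
    (V : Submodule B M) (V' : Submodule C M') (hV : ∀ x, x ∈ V' ↔ e x ∈ V) :
    ∃ f : (M' ⧸ V') ≃+ (M ⧸ V), ∀ (x : C) u, f (x • u) = π x • f u := by
  refine ⟨QuotientAddGroup.congr V'.toAddSubgroup V.toAddSubgroup e ?_, ?_⟩
  · ext x
    constructor
    · rintro ⟨u, hu, rfl⟩
      exact (hV u).mp hu
    · intro hx
      exact ⟨e.symm x, (hV _).mpr (by rwa [AddEquiv.apply_symm_apply]), e.apply_symm_apply x⟩
  · intro x u
    obtain ⟨u, rfl⟩ := Submodule.Quotient.mk_surjective _ u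
    change Submodule.Quotient.mk (e (x • u)) = π x • Submodule.Quotient.mk (e u)
    rw [he, Submodule.Quotient.mk_smul]

theorem IsProjectiveSurjection.hasChar {π : C →+* B} (hπ : IsProjectiveSurjection π)
    {M M' : Type u} [AddCommGroup M] [Module B M] [AddCommGroup M'] [Module C M']
    (e : M' ≃+ M) (he : ∀ (x : C) u, e (x • u) = π x • e u) {z : List ℕ} (h : HasChar B M z) :
    HasChar C M' z := by
  obtain ⟨V, h0, h1, h2⟩ := h
  let Φ := submoduleOrderIso hπ.surjective e he
  refine ⟨fun i => Φ (V i), (congrArg Φ h0).trans Φ.map_bot, (congrArg Φ h1).trans Φ.map_top, fun i => ?_⟩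
  obtain ⟨h3, h4, h5⟩ := h2 i
  let ε : Φ (V i.succ) ≃+ V i.succ :=
    { toFun := fun p => ⟨e p.1, p.2⟩
      invFun := fun p => ⟨e.symm p.1, by
        change e (e.symm p.1) ∈ V i.succ
        rw [AddEquiv.apply_symm_apply]
        exact p.2⟩
      left_inv := fun p => Subtype.ext (e.symm_apply_apply p.1)
      right_inv := fun p => Subtype.ext (e.apply_symm_apply p.1)
      map_add' := fun p q => Subtype.ext (map_add e p.1 q.1) }
  obtain ⟨f, hf⟩ := exists_quotient_addEquiv ε (fun x p => Subtype.ext (he x p.1))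
    ((V i.castSucc).submoduleOf (V i.succ)) ((Φ (V i.castSucc)).submoduleOf (Φ (V i.succ)))
    fun x => Iff.rfl
  have h6 := hπ.pd_eq f hf
  have h7 := hπ.pd_eq e he
  have h8 : IsOddModule C (Φ (V i.succ) ⧸ (Φ (V i.castSucc)).submoduleOf (Φ (V i.succ))) ↔
      IsOddModule B (V i.succ ⧸ (V i.castSucc).submoduleOf (V i.succ)) := by
    rw [IsOddModule, IsOddModule, h6]
  refine ⟨(apply_covBy_apply_iff Φ).mpr h3, fun h => ?_, fun h => ?_⟩
  · rw [h6]; exact h4 (h8.mp h)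
  · rw [h7]; exact h5 (fun h' => h (h8.mpr h'))

/-- The kernel is a superfluous maximal submodule, so it contains every proper submodule; two
complementary proper submodules cannot add up to everything. -/
theorem IsProjectiveCover.eq_bot_or_eq_bot {P W : Type u} [AddCommGroup P] [Module B P]
    [AddCommGroup W] [Module B W] [IsSimpleModule B W] {f : P →ₗ[B] W} (hf : IsProjectiveCover f)
    (U V : Submodule B P) (h : IsCompl U V) : U = ⊥ ∨ V = ⊥ := by
  have hco : IsCoatom (LinearMap.ker f) := by
    rw [← isSimpleModule_iff_isCoatom]
    exact .congr (f.quotKerEquivOfSurjective hf.2.1)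
  have key : ∀ U : Submodule B P, U ≤ LinearMap.ker f ∨ U = ⊤ := by
    intro U
    by_contra! hcon
    refine hcon.2 (hf.2.2 U (hco.2 _ (lt_of_le_of_ne le_sup_right fun h => hcon.1 ?_)))
    rw [h]
    exact le_sup_left
  rcases key U with h1 | rfl
  · rcases key V with h2 | rfl
    · have := sup_le h1 h2
      rw [h.sup_eq_top] at this
      exact absurd (top_le_iff.mp this) hco.1
    · exact .inl (by simpa using h.disjoint)
  · exact .inr (by simpa using h.disjoint)

end ChangeOfRings

/-- In a one-point extension the elements `(a, 0, 0)` form a left ideal which maps isomorphically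
onto the original algebra; it provides the section needed for each step. -/
theorem IsPartialClosure.exists_isProjectiveSurjection {k : Type u} [Field k] {d : ℕ}
    {A C : AlgCat.{u} k} (h : IsPartialClosure k d A C) :
    ∃ π : C →+* A, IsProjectiveSurjection π := by
  induction h with
  | @closed A C _ hC =>
    obtain ⟨e⟩ := hC
    exact ⟨(e : C →+* A), isProjectiveSurjection_of_section (e.symm : A →+ C)
      (fun x b => by
        change e.symm (e x * b) = x * e.symm b
        rw [map_mul, AlgEquiv.symm_apply_apply]) fun b => e.apply_symm_apply b⟩
  | @step A E C hE _ ih =>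
    obtain ⟨Y, -, -, ⟨e⟩⟩ := hE
    obtain ⟨ρ, hρ⟩ := ih
    let π : E →+* A :=
      { toFun := fun x => (e x).base
        map_one' := by rw [map_one]; rfl
        map_mul' := fun x y => by rw [map_mul]; rfl
        map_zero' := by rw [map_zero]; rfl
        map_add' := fun x y => by rw [map_add]; rfl }
    refine ⟨π.comp ρ, IsProjectiveSurjection.comp ?_ hρ⟩
    refine isProjectiveSurjection_of_section
      { toFun := fun a => e.symm ⟨a, 0, 0⟩
        map_zero' := map_zero e.symm
        map_add' := fun a b => ?_ } (fun x b => ?_) fun b => ?_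
    · rw [← map_add]
      congr 1
      ext <;> simp
    · change e.symm ⟨(e x).base * b, 0, 0⟩ = x * e.symm ⟨b, 0, 0⟩
      apply e.injective
      rw [map_mul, AlgEquiv.apply_symm_apply, AlgEquiv.apply_symm_apply]
      ext <;> simp
    · change (e (e.symm _)).base = b
      rw [AlgEquiv.apply_symm_apply]

/-- The module `P(ω)` of the ascent algebra, viewed over `A`, stays projective and indecomposable
and keeps its characteristic. So it is a projective interval of length `m + 1`, and the entries
before the last one are those of its radical. -/
theorem IsClosureOfAscent.exists_isMinus {k : Type u} [Field k] {d m : ℕ} {A : AlgCat.{u} k}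
    (N : LinearNakayama k A) (hm : 2 ≤ m) {l : List ℕ} (hl : l.length = m - 1)
    (ho : ∀ x ∈ l, Odd x) (hc : l.Pairwise (· < ·))
    (h : IsClosureOfAscent k d (l ++ [0, 1]) A) :
    ∃ a, IsMinus N.n m N.soc a ∧ pdS N.soc (a + m) = 1 := by
  obtain ⟨B, ⟨-, P, ⟨W, f, hW, -, hf⟩, hP⟩, hBA⟩ := h
  obtain ⟨π, hπ⟩ := hBA.exists_isProjectiveSurjection
  obtain ⟨P', e, he⟩ := exists_restrictScalars π P
  have hP' := hπ.hasChar e he hP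
  have hproj : Module.Projective A P' := hπ.projective e he hf.1
  let Φ := submoduleOrderIso hπ.surjective e he
  have hnt : Nontrivial P' := by
    have := IsSimpleModule.nontrivial B W
    have := hf.2.1.nontrivial
    exact e.toEquiv.nontrivial
  obtain ⟨a, b, hab⟩ := exists_isInterval (N := N) (M := P') fun U V hUV => by
    have h1 := hf.eq_bot_or_eq_bot (Φ.symm U) (Φ.symm V) (Φ.symm.isCompl hUV)
    rwa [map_eq_bot_iff, map_eq_bot_iff] at h1
  obtain ⟨h1, h2⟩ := (hab.hasChar_iff _).mp hP'
  have h3 := hab.projective_iff.mp hproj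
  have hlt := hab.lt
  have hle := hab.le
  rw [List.length_append, hl] at h1
  simp only [List.length_cons, List.length_nil] at h1
  obtain rfl : b = a + m + 1 := by omega
  have h0 : pdI N.soc a (a + m + 1) = 0 := pdI_eq_zero h3.le
  have hodd : ∀ i (hi : i < l.length), Odd (pdS N.soc (a + i)) ∧ pdS N.soc (a + i) = l[i] := by
    intro i hi
    have h4 := h2 i (by simp; omega)
    rw [List.getElem_append_left hi] at h4
    have h5 := odd_pdS_of_charEntry (h4 ▸ ho _ (List.getElem_mem hi)) (h0 ▸ Even.zero)
    exact ⟨h5, by rw [h4, charEntry_of_odd h5]⟩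
  have hlast : pdS N.soc (a + m) = 1 := by
    have h4 := h2 m (by simp; omega)
    rw [List.getElem_append_right (by omega)] at h4
    have h6 : (([0, 1] : List ℕ)[m - l.length]'(by simp; omega)) = 1 := by
      have : m - l.length = 1 := by omega
      simp [this]
    rw [h6] at h4
    have h5 := odd_pdS_of_charEntry (h4 ▸ odd_one) (h0 ▸ Even.zero)
    rw [h4, charEntry_of_odd h5]
  have heven : Even (pdS N.soc (a + (m - 1))) := by
    have h4 := h2 (m - 1) (by simp; omega)
    rw [List.getElem_append_right (by omega)] at h4
    have h6 : (([0, 1] : List ℕ)[m - 1 - l.length]'(by simp; omega)) = 0 := by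
      have : m - 1 - l.length = 0 := by omega
      simp [this]
    rw [h6] at h4
    exact even_pdS_of_charEntry (h4 ▸ Even.zero)
  refine ⟨a, ⟨hle, h3.symm, fun u hu hu' => ?_, fun u hu hu' => ?_, fun u hu => ?_, ?_, ?_⟩, hlast⟩
  · obtain ⟨i, rfl⟩ : ∃ i, u = a + i := ⟨u - a, by omega⟩
    exact (hodd i (by omega)).1
  · obtain ⟨i, rfl⟩ : ∃ i, u = a + i := ⟨u - a, by omega⟩
    rw [(hodd i (by omega)).2, add_assoc, (hodd (i + 1) (by omega)).2]
    exact List.pairwise_iff_getElem.mp hc i (i + 1) (by omega) (by omega) (by omega)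
  · rwa [show u = a + (m - 1) by omega]
  · rw [hlast]; exact odd_one
  · rw [hlast]
    exact (hodd 0 (by omega)).1.pos

end Nakayama

/-! ### One-point extensions and the realization of Kupisch functions. -/

namespace Nakayama

open IsIntervalFamily

/-- Removing the last vertex. -/
def restrictTriangular (k : Type u) [Field k] (n : ℕ) :
    upperTriangular k (n + 1) →ₐ[k] upperTriangular k n where
  toFun x := ⟨fun i j => x.1 i.castSucc j.castSucc, fun i j h =>
    x.2 i.castSucc j.castSucc (Fin.castSucc_lt_castSucc_iff.mpr h)⟩
  map_one' := by
    apply Subtype.ext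
    ext i j
    exact congrFun (congrFun (Matrix.submatrix_one Fin.castSucc (Fin.castSucc_injective n)) i) j
  map_mul' x y := by
    apply Subtype.ext
    ext i j
    change (x.1 * y.1) i.castSucc j.castSucc =
      ∑ l : Fin n, x.1 i.castSucc l.castSucc * y.1 l.castSucc j.castSucc
    rw [Matrix.mul_apply, Fin.sum_univ_castSucc, y.2 (Fin.last n) j.castSucc (Fin.castSucc_lt_last j),
      mul_zero, add_zero]
  map_zero' := rfl
  map_add' _ _ := rfl
  commutes' c := by
    apply Subtype.ext
    ext i j
    change algebraMap k (Matrix _ _ k) c i.castSucc j.castSucc = algebraMap k (Matrix _ _ k) c i j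
    simp [Matrix.algebraMap_matrix_apply]

theorem nonempty_algEquiv_of_surjective {k R A A' : Type*} [Field k] [Ring R] [Algebra k R] [Ring A]
    [Algebra k A] [Ring A'] [Algebra k A'] (p : R →ₐ[k] A) (p' : R →ₐ[k] A')
    (hp : Function.Surjective p) (hp' : Function.Surjective p') (h : ∀ x, p x = 0 ↔ p' x = 0) :
    Nonempty (A ≃ₐ[k] A') := by
  have key : ∀ x y, p x = p y ↔ p' x = p' y := fun x y => by
    rw [← sub_eq_zero, ← map_sub, h, map_sub, sub_eq_zero]
  have hσ : ∀ x, p' (Function.surjInv hp (p x)) = p' x := fun x =>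
    (key _ _).mp (Function.surjInv_eq hp (p x))
  let f : A →ₐ[k] A' :=
    { toFun := fun a => p' (Function.surjInv hp a)
      map_one' := by rw [← map_one p, hσ, map_one]
      map_mul' := fun a b => by
        obtain ⟨x, rfl⟩ := hp a
        obtain ⟨y, rfl⟩ := hp b
        rw [← map_mul, hσ, hσ, hσ, map_mul]
      map_zero' := by rw [← map_zero p, hσ, map_zero]
      map_add' := fun a b => by
        obtain ⟨x, rfl⟩ := hp a
        obtain ⟨y, rfl⟩ := hp b
        rw [← map_add, hσ, hσ, hσ, map_add]
      commutes' := fun c => by rw [← p.commutes, hσ, p'.commutes] }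
  have hf : ∀ x, f (p x) = p' x := hσ
  refine ⟨AlgEquiv.ofBijective f ⟨fun a b hab => ?_, fun y => ?_⟩⟩
  · obtain ⟨x, rfl⟩ := hp a
    obtain ⟨y, rfl⟩ := hp b
    rw [hf, hf] at hab
    exact (key x y).mpr hab
  · obtain ⟨x, rfl⟩ := hp' y
    exact ⟨p x, hf x⟩

section

variable {k A : Type u} [Field k] [Ring A] [Algebra k A] {N : LinearNakayama k A}

namespace LinearNakayama

theorem path_eq_proj {i j : Fin N.n} (h : i ≤ j) : N.path i (j + 1) = N.proj (matrixUnit k i j h) := by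
  rw [path, dif_pos ⟨Nat.lt_succ_of_le h, j.2⟩]
  rfl

theorem proj_eq (x : upperTriangular k N.n) :
    N.proj x = ∑ i : Fin N.n, ∑ j : Fin N.n, x.1 i j • N.path i (j + 1) := by
  conv_lhs => rw [eq_sum_matrixUnit x]
  rw [map_sum]
  refine Finset.sum_congr rfl fun i _ => ?_
  rw [map_sum]
  refine Finset.sum_congr rfl fun j _ => ?_
  split_ifs with h
  · rw [map_smul, path_eq_proj h]
  · rw [map_zero, x.2 i j (not_le.mp h), zero_smul]

theorem path_mul_proj_mul_path (x : upperTriangular k N.n) (i j : Fin N.n) :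
    N.path i (i + 1) * N.proj x * N.path j (j + 1) = x.1 i j • N.path i (j + 1) := by
  rw [proj_eq, Finset.mul_sum, Finset.sum_mul, Finset.sum_eq_single_of_mem i (Finset.mem_univ i),
    Finset.mul_sum, Finset.sum_mul, Finset.sum_eq_single_of_mem j (Finset.mem_univ j)]
  · rw [mul_smul_comm, smul_mul_assoc]
    by_cases h : i ≤ j
    · have h1 : (i : ℕ) ≤ j := h
      rw [path_mul_path le_rfl (by omega), path_mul_path h1 (by omega)]
    · rw [x.2 i j (not_le.mp h), zero_smul, zero_smul]
  · intro j' _ hj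
    have := Fin.val_ne_of_ne hj
    rw [mul_assoc, smul_mul_assoc, path_mul_path_of_ne (by omega), smul_zero, mul_zero]
  · intro i' _ hi
    have := Fin.val_ne_of_ne hi
    rw [Finset.mul_sum, Finset.sum_mul]
    refine Finset.sum_eq_zero fun j' _ => ?_
    rw [mul_smul_comm, path_mul_path_of_ne (by omega), smul_zero, zero_mul]

/-- Multiplying by two vertex idempotents isolates a single matrix entry, so the kernel is spanned
by the matrix units of the vanishing paths and is determined by the function `soc`. -/
theorem proj_eq_zero_iff (x : upperTriangular k N.n) :
    N.proj x = 0 ↔ ∀ i j : Fin N.n, N.soc (j + 1) ≤ i → x.1 i j = 0 := by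
  constructor
  · intro h i j hij
    by_cases hle : i ≤ j
    · have h1 := path_mul_proj_mul_path x i j
      rw [h, mul_zero, zero_mul] at h1
      have h2 := (path_ne_zero_iff (N := N) (a := i) (b := j + 1) (Nat.lt_succ_of_le hle) j.2).mpr hij
      exact (smul_eq_zero.mp h1.symm).resolve_right h2
    · exact x.2 i j (not_le.mp hle)
  · intro h
    rw [proj_eq]
    refine Finset.sum_eq_zero fun i _ => Finset.sum_eq_zero fun j _ => ?_
    by_cases hij : N.soc (j + 1) ≤ i
    · rw [h i j hij, zero_smul]
    · by_cases hle : i ≤ j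
      · rw [not_not.mp ((path_ne_zero_iff (N := N) (a := i) (b := j + 1) (Nat.lt_succ_of_le hle)
          j.2).not.mpr hij), smul_zero]
      · rw [x.2 i j (not_le.mp hle), zero_smul]

/-- A linear Nakayama algebra is determined by its Kupisch series. -/
theorem nonempty_algEquiv {A' : Type u} [Ring A'] [Algebra k A'] (N' : LinearNakayama k A')
    (hn : N.n = N'.n) (hs : ∀ b ≤ N.n, N.soc b = N'.soc b) : Nonempty (A ≃ₐ[k] A') := by
  obtain ⟨p', hp', h⟩ : ∃ p' : upperTriangular k N.n →ₐ[k] A', Function.Surjective p' ∧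
      ∀ x, p' x = 0 ↔ ∀ i j : Fin N.n, N'.soc (j + 1) ≤ i → x.1 i j = 0 := by
    rw [hn]
    exact ⟨N'.proj, N'.surjective, proj_eq_zero_iff⟩
  refine nonempty_algEquiv_of_surjective N.proj p' N.surjective hp' fun x => ?_
  rw [proj_eq_zero_iff, h]
  exact forall₂_congr fun i j => by rw [hs (j + 1) j.2]

theorem soc_eq {b c : ℕ} (hb : b ≤ N.n) (hc : c < b) (h : ∀ a < b, N.path a b ≠ 0 ↔ c ≤ a) :
    N.soc b = c := by
  apply le_antisymm
  · exact (path_ne_zero_iff hc hb).mp ((h c hc).mpr le_rfl)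
  · have h1 := N.isKupisch.lt (b := b) (by omega)
    exact (h _ h1).mp ((path_ne_zero_iff h1 hb).mpr le_rfl)

end LinearNakayama

variable {Y : Type u} [AddCommGroup Y] [Module A Y] {a : ℕ} {z : ℕ → Y}

theorem IsIntervalFamily.proj_smul {b : ℕ} (hz : IsIntervalFamily N a b z)
    (x : upperTriangular k N.n) (t : Fin N.n) (ht : t < b) :
    N.proj x • z t = ∑ i : Fin N.n, algebraMap k A (x.1 i t) • z i := by
  rw [LinearNakayama.proj_eq, Finset.sum_smul]
  refine Finset.sum_congr rfl fun i _ => ?_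
  rw [Finset.sum_smul, Finset.sum_eq_single_of_mem t (Finset.mem_univ t)]
  · rw [Algebra.smul_def, mul_smul]
    by_cases hi : i ≤ t
    · rw [hz.smul i t hi ht]
    · rw [x.2 i t (not_le.mp hi), map_zero, zero_smul, zero_smul]
  · intro j _ hj
    have := Fin.val_ne_of_ne hj
    rw [Algebra.smul_def, mul_smul, hz.smul_ne i t (j + 1) ht (by omega), smul_zero]

/-- The one-point extension as a quotient of the upper triangular matrices. -/
def onePointProj (hz : IsIntervalBasis N a N.n z) :
    upperTriangular k (N.n + 1) →ₐ[k] OnePointExt k A Y where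
  -- The last column above the diagonal holds the coordinates of a vector in the basis `z`; the
  -- corner entry is the scalar.
  toFun x := ⟨N.proj (restrictTriangular k N.n x),
    ∑ i : Fin N.n, algebraMap k A (x.1 i.castSucc (Fin.last N.n)) • z i,
    x.1 (Fin.last N.n) (Fin.last N.n)⟩
  map_one' := by
    ext
    · simp
    · change (∑ i : Fin N.n, _ : Y) = 0
      refine Finset.sum_eq_zero fun i _ => ?_
      change algebraMap k A ((1 : Matrix _ _ k) i.castSucc (Fin.last N.n)) • z i = 0
      rw [Matrix.one_apply_ne (Fin.castSucc_lt_last i).ne, map_zero, zero_smul]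
    · exact Matrix.one_apply_eq _
  map_mul' x y := by
    ext
    · simp
    · change ∑ i : Fin N.n, algebraMap k A ((x.1 * y.1) i.castSucc (Fin.last N.n)) • z i =
        N.proj (restrictTriangular k N.n x) • ∑ i : Fin N.n, algebraMap k A (y.1 i.castSucc
          (Fin.last N.n)) • z i + algebraMap k A (y.1 (Fin.last N.n) (Fin.last N.n)) •
            ∑ i : Fin N.n, algebraMap k A (x.1 i.castSucc (Fin.last N.n)) • z i
      have h1 : ∀ j : Fin N.n, N.proj (restrictTriangular k N.n x) •
          algebraMap k A (y.1 j.castSucc (Fin.last N.n)) • z j =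
          ∑ i : Fin N.n, algebraMap k A (x.1 i.castSucc j.castSucc * y.1 j.castSucc
            (Fin.last N.n)) • z i := by
        intro j
        rw [← mul_smul, ← Algebra.commutes, mul_smul, hz.proj_smul _ j j.2, Finset.smul_sum]
        refine Finset.sum_congr rfl fun i _ => ?_
        rw [← mul_smul, ← map_mul, mul_comm]
        rfl
      rw [Finset.smul_sum, Finset.sum_congr rfl fun j _ => h1 j, Finset.sum_comm, Finset.smul_sum,
        ← Finset.sum_add_distrib]
      refine Finset.sum_congr rfl fun i _ => ?_
      rw [← Finset.sum_smul, ← mul_smul, ← map_mul, ← map_sum, ← add_smul, ← map_add,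
        Matrix.mul_apply, Fin.sum_univ_castSucc, mul_comm (y.1 (Fin.last N.n) (Fin.last N.n))]
    · change (x.1 * y.1) (Fin.last N.n) (Fin.last N.n) = _
      rw [Matrix.mul_apply, Fin.sum_univ_castSucc, Finset.sum_eq_zero, zero_add]
      · rfl
      · intro i _
        rw [x.2 (Fin.last N.n) i.castSucc (Fin.castSucc_lt_last i), zero_mul]
  map_zero' := by
    ext
    · simp
    · change (∑ i : Fin N.n, _ : Y) = 0
      refine Finset.sum_eq_zero fun i _ => ?_
      change algebraMap k A 0 • z i = 0
      rw [map_zero, zero_smul]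
    · rfl
  map_add' x y := by
    ext
    · simp
    · change ∑ i : Fin N.n, algebraMap k A (x.1 i.castSucc (Fin.last N.n) +
        y.1 i.castSucc (Fin.last N.n)) • z i = ∑ i : Fin N.n, _ + ∑ i : Fin N.n, _
      rw [← Finset.sum_add_distrib]
      refine Finset.sum_congr rfl fun i _ => ?_
      rw [map_add, add_smul]
    · rfl
  commutes' c := by
    ext
    · change N.proj (restrictTriangular k N.n (algebraMap k _ c)) = algebraMap k A c
      rw [AlgHom.commutes, AlgHom.commutes]
    · change (∑ i : Fin N.n, _ : Y) = 0
      refine Finset.sum_eq_zero fun i _ => ?_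
      change algebraMap k A ((algebraMap k (Matrix _ _ k) c) i.castSucc (Fin.last N.n)) • z i = 0
      rw [Matrix.algebraMap_matrix_apply, if_neg (Fin.castSucc_lt_last i).ne, map_zero, zero_smul]
    · change algebraMap k (Matrix _ _ k) c (Fin.last N.n) (Fin.last N.n) = c
      rw [Matrix.algebraMap_matrix_apply, if_pos rfl]
      rfl

theorem exists_coeff_fin (hz : IsIntervalBasis N a N.n z) (y : Y) :
    ∃ w : ℕ → k, y = ∑ i : Fin N.n, algebraMap k A (w i) • z i := by
  obtain ⟨w, hw⟩ := hz.exists_coeff le_rfl (hz.mem_top y)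
  exact ⟨w, by rw [hw, Finset.sum_range]⟩

/-- The one-point extension by an interval module with the last vertex as its top. -/
def onePointNakayama (hz : IsIntervalBasis N a N.n z) : LinearNakayama k (OnePointExt k A Y) where
  n := N.n + 1
  pos := N.n.succ_pos
  proj := onePointProj hz
  surjective := by
    rintro ⟨α, y, c⟩
    obtain ⟨x, rfl⟩ := N.surjective α
    obtain ⟨w, rfl⟩ := exists_coeff_fin hz y
    let X : Matrix (Fin (N.n + 1)) (Fin (N.n + 1)) k := fun i =>
      Fin.lastCases (motive := fun _ => Fin (N.n + 1) → k)
        (Fin.lastCases (motive := fun _ => k) c fun _ => 0)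
        (fun i => Fin.lastCases (motive := fun _ => k) (w i) fun j => x.1 i j) i
    have h1 : ∀ i j : Fin N.n, X i.castSucc j.castSucc = x.1 i j := fun i j => by simp [X]
    have h2 : ∀ i : Fin N.n, X i.castSucc (Fin.last N.n) = w i := fun i => by simp [X]
    have h3 : ∀ i : Fin N.n, X (Fin.last N.n) i.castSucc = 0 := fun i => by simp [X]
    have h4 : X (Fin.last N.n) (Fin.last N.n) = c := by simp [X]
    refine ⟨⟨X, fun i j hij => ?_⟩, ?_⟩
    · induction j using Fin.lastCases with
      | last => exact absurd hij (not_lt.mpr (Fin.le_last i))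
      | cast j =>
        induction i using Fin.lastCases with
        | last => exact h3 j
        | cast i =>
          rw [h1]
          exact x.2 i j (Fin.castSucc_lt_castSucc_iff.mp hij)
    · ext
      · change N.proj _ = N.proj x
        congr 1
        apply Subtype.ext
        ext i j
        exact h1 i j
      · change ∑ i : Fin N.n, algebraMap k A (X i.castSucc (Fin.last N.n)) • z i = _
        simp only [h2]
      · exact h4
  admissible := by
    intro x hx i j hij
    have hb : N.proj (restrictTriangular k N.n x) = 0 := congrArg OnePointExt.base hx
    have hv : ∑ i : Fin N.n, algebraMap k A (x.1 i.castSucc (Fin.last N.n)) • z i = 0 :=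
      congrArg OnePointExt.vec hx
    have hs : x.1 (Fin.last N.n) (Fin.last N.n) = 0 := congrArg OnePointExt.scal hx
    induction i using Fin.lastCases with
    | last =>
      induction j using Fin.lastCases with
      | last => exact hs
      | cast j => exact x.2 _ _ (Fin.castSucc_lt_last j)
    | cast i =>
      induction j using Fin.lastCases with
      | last =>
        -- In the last column `hij` leaves only the vertex `N.n - 1`. Its coefficient vanishes
        -- because this vertex is the top of the interval module, so its basis vector is non-zero.
        have h1 := congrArg (fun y => N.path i (i + 1) • y) hv
        simp only [smul_zero, Finset.smul_sum] at h1
        rw [Finset.sum_eq_single_of_mem i (Finset.mem_univ i)] at h1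
        · rw [← mul_smul, ← Algebra.commutes, mul_smul, hz.smul i i le_rfl i.2] at h1
          by_contra h0
          have h2 := congrArg (fun y => algebraMap k A
            (x.1 i.castSucc (Fin.last N.n))⁻¹ • y) h1
          simp only [smul_zero, ← mul_smul, ← map_mul] at h2
          rw [inv_mul_cancel₀ h0, map_one, one_smul] at h2
          refine hz.ne_zero i ?_ i.2 h2
          have := hz.lt
          simp only [Fin.val_last, Fin.val_castSucc] at hij
          omega
        · intro j _ hj
          have := Fin.val_ne_of_ne hj
          rw [← mul_smul, ← Algebra.commutes, mul_smul, hz.smul_ne i j (i + 1) j.2 (by omega),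
            smul_zero]
      | cast j => exact N.admissible _ hb i j hij

theorem onePointNakayama_path (hz : IsIntervalBasis N a N.n z) {s b : ℕ} (hsb : s < b)
    (hb : b ≤ N.n + 1) : (onePointNakayama hz).path s b = onePointProj hz
      (matrixUnit k (⟨s, by omega⟩ : Fin (N.n + 1)) ⟨b - 1, by omega⟩
        (Fin.mk_le_mk.mpr (by omega))) :=
  dif_pos ⟨hsb, hb⟩

theorem onePointNakayama_path_ne_zero_iff (hz : IsIntervalBasis N a N.n z) {s b : ℕ} (hsb : s < b)
    (hb : b ≤ N.n) : (onePointNakayama hz).path s b ≠ 0 ↔ N.path s b ≠ 0 := by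
  have h1 : (onePointNakayama hz).path s b = ⟨N.path s b, 0, 0⟩ := by
    rw [onePointNakayama_path hz hsb (by omega), LinearNakayama.path, dif_pos ⟨hsb, hb⟩]
    ext
    · change N.proj _ = N.proj _
      congr 1
      apply Subtype.ext
      ext i j
      change Matrix.single _ _ (1 : k) i.castSucc j.castSucc = Matrix.single _ _ 1 i j
      simp [Matrix.single_apply, Fin.ext_iff]
    · change (∑ i : Fin N.n, _ : Y) = 0
      refine Finset.sum_eq_zero fun i _ => ?_
      change algebraMap k A (Matrix.single _ _ (1 : k) i.castSucc (Fin.last N.n)) • z i = 0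
      rw [Matrix.single_apply, if_neg, map_zero, zero_smul]
      rintro ⟨-, h⟩
      have := congrArg Fin.val h
      simp only [Fin.val_last] at this
      omega
    · change Matrix.single _ _ (1 : k) (Fin.last N.n) (Fin.last N.n) = 0
      rw [Matrix.single_apply, if_neg]
      rintro ⟨-, h⟩
      have := congrArg Fin.val h
      simp only [Fin.val_last] at this
      omega
  rw [h1, not_iff_not]
  exact ⟨fun h => congrArg OnePointExt.base h, fun h => by rw [h]; rfl⟩

theorem onePointNakayama_path_last_ne_zero_iff (hz : IsIntervalBasis N a N.n z) {s : ℕ}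
    (hs : s < N.n + 1) : (onePointNakayama hz).path s (N.n + 1) ≠ 0 ↔ a ≤ s := by
  have hlt := hz.lt
  by_cases hs' : s < N.n
  · have h1 : (onePointNakayama hz).path s (N.n + 1) = ⟨0, z s, 0⟩ := by
      rw [onePointNakayama_path hz hs le_rfl]
      ext
      · change N.proj _ = 0
        rw [← map_zero N.proj]
        congr 1
        apply Subtype.ext
        ext i j
        change Matrix.single _ _ (1 : k) i.castSucc j.castSucc = 0
        rw [Matrix.single_apply, if_neg]
        rintro ⟨-, h⟩
        have := congrArg Fin.val h
        have := j.2
        simp only [Fin.val_castSucc, Nat.add_sub_cancel] at *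
        omega
      · change (∑ i : Fin N.n, algebraMap k A (Matrix.single _ _ (1 : k) i.castSucc
          (Fin.last N.n)) • z i : Y) = z s
        rw [Finset.sum_eq_single_of_mem (⟨s, hs'⟩ : Fin N.n) (Finset.mem_univ _)]
        · rw [Matrix.single_apply, if_pos ⟨rfl, Fin.ext (by simp)⟩, map_one, one_smul]
        · intro i _ hi
          rw [Matrix.single_apply, if_neg, map_zero, zero_smul]
          rintro ⟨h, -⟩
          exact hi (Fin.ext (congrArg Fin.val h).symm)
      · change Matrix.single _ _ (1 : k) (Fin.last N.n) (Fin.last N.n) = 0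
        rw [Matrix.single_apply, if_neg]
        rintro ⟨h, -⟩
        have := congrArg Fin.val h
        simp only [Fin.val_last] at this
        omega
    rw [h1]
    constructor
    · intro h
      by_contra hc
      rw [hz.eq_zero s (not_le.mp hc)] at h
      exact h rfl
    · exact fun h h0 => hz.ne_zero s h hs' (congrArg OnePointExt.vec h0)
  · obtain rfl : s = N.n := by omega
    exact iff_of_true (LinearNakayama.path_ne_zero_of_le (N := onePointNakayama hz) hs le_rfl
      (by omega)) hlt.le

theorem onePointNakayama_soc (hz : IsIntervalBasis N a N.n z) {b : ℕ} (hb : b ≤ N.n) :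
    (onePointNakayama hz).soc b = N.soc b := by
  rcases Nat.eq_zero_or_pos b with rfl | hb0
  · rw [LinearNakayama.soc_zero, LinearNakayama.soc_zero]
  · refine LinearNakayama.soc_eq (N := onePointNakayama hz) (hb.trans (Nat.le_succ _))
      (N.isKupisch.lt hb0) fun s hs => ?_
    rw [onePointNakayama_path_ne_zero_iff hz hs hb, LinearNakayama.path_ne_zero_iff hs hb]

theorem onePointNakayama_soc_last (hz : IsIntervalBasis N a N.n z) :
    (onePointNakayama hz).soc (N.n + 1) = a :=
  LinearNakayama.soc_eq (N := onePointNakayama hz) le_rfl (hz.lt.trans (Nat.lt_succ_self _))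
    fun _ hs => onePointNakayama_path_last_ne_zero_iff hz hs

end

/-- Every Kupisch function is realized by a linear Nakayama algebra. -/
theorem exists_linearNakayama (k : Type u) [Field k] {L : ℕ → ℕ} (hL : IsKupisch L) {n : ℕ}
    (hn : 0 < n) : ∃ (A : AlgCat.{u} k) (N : LinearNakayama k A), N.n = n ∧
      ∀ b ≤ n, N.soc b = L b := by
  induction n, hn using Nat.le_induction with
  | base =>
    let N : LinearNakayama k k :=
      { n := 1
        pos := one_pos
        proj :=
          { toFun := fun x => x.1 0 0
            map_one' := rfl
            map_mul' := fun x y => by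
              change (x.1 * y.1) 0 0 = _
              simp [Matrix.mul_apply]
            map_zero' := rfl
            map_add' := fun _ _ => rfl
            commutes' := fun c => by
              change algebraMap k (Matrix (Fin 1) (Fin 1) k) c 0 0 = _
              simp [Matrix.algebraMap_matrix_apply] }
        surjective := fun c => ⟨algebraMap k _ c, by
          change algebraMap k (Matrix (Fin 1) (Fin 1) k) c 0 0 = _
          simp [Matrix.algebraMap_matrix_apply]⟩
        admissible := fun x hx i j _ => by
          rw [Subsingleton.elim i 0, Subsingleton.elim j 0]
          exact hx }
    refine ⟨AlgCat.of k k, N, rfl, fun b hb => ?_⟩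
    have hK := N.isKupisch
    have h1 : b = 0 ∨ b = 1 := by omega
    rcases h1 with rfl | rfl
    · exact hK.zero.trans hL.zero.symm
    · exact hK.one.trans hL.one.symm
  | succ n hn ih =>
    obtain ⟨A, N, rfl, hs⟩ := ih
    have hn' : 0 < N.n := hn
    have h1 := hL.mono (show N.n ≤ N.n + 1 by omega)
    have h2 := hL.succ_lt hn'
    have h3 := hs N.n le_rfl
    -- The new projective module must have the radical `[L (n + 1), n)`, which is a module because
    -- `L n ≤ L (n + 1) < n`.
    obtain ⟨Y, z, hz⟩ := exists_isInterval_of_soc_le (N := N) h2 le_rfl (by omega)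
    refine ⟨AlgCat.of k (OnePointExt k A Y), onePointNakayama hz, rfl, fun b hb => ?_⟩
    rcases hb.eq_or_lt with rfl | hb
    · exact onePointNakayama_soc_last hz
    · exact (onePointNakayama_soc hz (Nat.lt_succ_iff.mp hb)).trans (hs b (Nat.lt_succ_iff.mp hb))

end Nakayama

/-! ### Partial closures of truncated algebras. -/

namespace Nakayama

open IsIntervalFamily

theorem pdI_congr {L L' : ℕ → ℕ} {b : ℕ} (h : ∀ c ≤ b, L c = L' c) (a : ℕ) :
    pdI L a b = pdI L' a b := by
  induction b using Nat.strong_induction_on generalizing a with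
  | _ b ih =>
    by_cases h1 : L b < a ∧ a < b
    · rw [pdI_step h1.1 h1.2, pdI_step (h b le_rfl ▸ h1.1) h1.2,
        ih a h1.2 (fun c hc => h c (hc.trans h1.2.le)), h b le_rfl]
    · rw [pdI, dif_neg h1, pdI, dif_neg (h b le_rfl ▸ h1)]

/-- The simple module at the vertex `v` is `d`-closed. -/
def IsClosedVertex (n : ℕ) (L : ℕ → ℕ) (d v : ℕ) : Prop :=
  IsProjSocle n L v ∨ ∃ c, v < c ∧ c ≤ n ∧ L c ≤ v ∧ d ≤ pdI L v c

theorem IsClosedVertex.congr {n d v : ℕ} {L L' : ℕ → ℕ} (h : ∀ c ≤ n, L c = L' c)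
    (hv : IsClosedVertex n L d v) : IsClosedVertex n L' d v := by
  refine hv.imp (fun ⟨b, h1, h2, h3⟩ => ⟨b, h1, h2, h b h1 ▸ h3⟩) fun ⟨c, h1, h2, h3, h4⟩ =>
    ⟨c, h1, h2, h c h2 ▸ h3, ?_⟩
  rwa [← pdI_congr fun e he => h e (he.trans h2)]

variable {k A : Type u} [Field k] [Ring A] [Algebra k A] {N : LinearNakayama k A}
  {M : Type u} [AddCommGroup M] [Module A M] {a b c m n d : ℕ} {z : ℕ → M} {L : ℕ → ℕ}

theorem IsInterval.hasDClosedFactors_iff (h : IsInterval N M a b) :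
    HasDClosedFactors A d M ↔ ∀ v, a ≤ v → v < b → IsClosedVertex N.n N.soc d v := by
  constructor
  · intro hc v hv hv'
    have h1 := N.isKupisch.lt (b := v + 1) (by omega)
    obtain ⟨X, hX⟩ := exists_isInterval_of_soc_le (N := N) (show v < v + 1 by omega)
      (show v + 1 ≤ N.n from lt_of_lt_of_le hv' h.le) (by omega)
    exact hX.isDClosedSimple_iff.mp (hc X (h.isCompositionFactor_iff.mpr ⟨v, hv, hv', hX⟩))
  · intro hc S hS
    obtain ⟨v, h1, h2, h3⟩ := h.isCompositionFactor_iff.mp hS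
    exact h3.isDClosedSimple_iff.mpr (hc v h1 h2)

theorem hasDClosedFactors_of_subsingleton [Subsingleton M] : HasDClosedFactors A d M := by
  rintro S ⟨hS, V, W, -, ⟨e⟩⟩
  have := IsSimpleModule.nontrivial A S
  have := e.symm.injective.nontrivial
  exact absurd this (not_nontrivial _)

theorem IsIntervalBasis.hasDClosedFactors_below_iff (hz : IsIntervalBasis N a b z) (hac : a ≤ c)
    (hcb : c ≤ b) : HasDClosedFactors A d (below A z c) ↔
      ∀ v, a ≤ v → v < c → IsClosedVertex N.n N.soc d v := by
  rcases hac.eq_or_lt with rfl | hlt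
  · have : Subsingleton (below A z a) := by
      rw [hz.below_eq_bot le_rfl]
      infer_instance
    exact iff_of_true hasDClosedFactors_of_subsingleton fun v h1 h2 => by omega
  · exact (hz.isInterval_below hlt hcb).hasDClosedFactors_iff

theorem IsInterval.isPOmega (h : IsInterval N M a N.n) (hM : a = N.soc N.n) : IsPOmega A M := by
  have hproj := h.projective_iff.mpr hM
  obtain ⟨z, hz⟩ := h
  have hlt := hz.lt
  have hW := hz.isInterval_quotient (c := N.n - 1) (by omega) (by omega)
  have hs := N.isKupisch.lt N.pos
  refine ⟨ModuleCat.of A (M ⧸ below A z (N.n - 1)), (below A z (N.n - 1)).mkQ, ?_, ?_, hproj,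
    Submodule.mkQ_surjective _, fun V hV => ?_⟩
  · refine IsInterval.isSimpleModule (N := N) (a := N.n - 1) ?_
    rwa [Nat.sub_add_cancel N.pos]
  · exact hW.injective_iff.mpr (le_antisymm (IsKupisch.le_rightEnd le_rfl (by omega))
      (IsKupisch.rightEnd_le _))
  · rw [Submodule.ker_mkQ] at hV
    obtain ⟨e, he, he', rfl⟩ := hz.exists_eq_below V
    by_contra hne
    have h1 : e ≤ N.n - 1 := by
      by_contra hc
      obtain rfl : e = N.n := by omega
      exact hne hz.below_top
    have h2 : below A z N.n ≤ below A z (N.n - 1) := by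
      rw [hz.below_top, ← hV]
      exact sup_le (below_mono h1) le_rfl
    have := (hz.below_le_iff hlt.le le_rfl (by omega)).mp h2
    omega

theorem isPOmega_projCover (N : LinearNakayama k A) : IsPOmega A (projCover N N.n) :=
  (isInterval_projCover N.pos le_rfl).isPOmega rfl

namespace IsBoundKupisch

theorem isClosedVertex (hB : IsBoundKupisch n m d L) {v : ℕ} (hv : v < n) :
    IsClosedVertex n L d v :=
  (hB.closed v hv).imp id fun ⟨c, h1, h2, h3, h4⟩ => ⟨c, h1, h2, h3, h4.ge⟩

/-- For `v` below `L (b + 1)`, every module with socle `v` has its vertices below `b`, so the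
witness of closedness in the full algebra already exists in the truncation. -/
theorem isClosedVertex_of_lt (hB : IsBoundKupisch n m d L) {b v : ℕ} (hb : b < n) (hv : L b ≤ v)
    (hv' : v < L (b + 1)) : IsClosedVertex b L d v := by
  have hb0 : 0 < b := by
    rcases Nat.eq_zero_or_pos b with rfl | h
    · rw [zero_add, hB.one] at hv'
      omega
    · exact h
  rcases hv.eq_or_lt with rfl | hlt
  · exact .inl ⟨b, le_rfl, hb0, rfl⟩
  · have h1 : ∀ c, L c ≤ v → c ≤ b := fun c hc => by
      by_contra hcon
      have := hB.mono (show b + 1 ≤ c by omega)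
      omega
    have := hB.succ_lt hb0
    rcases hB.isClosedVertex (show v < n by omega) with ⟨c, h2, h3, rfl⟩ | ⟨c, h2, h3, h4, h5⟩
    · exact .inl ⟨c, h1 c le_rfl, h3, rfl⟩
    · exact .inr ⟨c, h2, h1 c h4, h4, h5⟩

/-- Strict increase above the summit keeps `L (b + 1)` from being an earlier socle. A module `[L (b
+ 1), c)` of projective dimension at least `d` would be the syzygy of `[c, b + 1)`, which would then
exceed `d`. -/
theorem not_isClosedVertex (hB : IsBoundKupisch n m d L) {s b : ℕ} (hs : s ≤ n)
    (hs' : L s + (m + 1) = s) (hsb : s ≤ b) (hb : b < n) : ¬ IsClosedVertex b L d (L (b + 1)) := by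
  have h0 := hB.desc s hs hs' b hsb hb
  rintro (⟨c, h1, -, h2⟩ | ⟨c, h1, h2, h3, h4⟩)
  · have := hB.mono h1
    omega
  · have h5 := hB.pd_le c (b + 1) hb
    rw [pdI_step h1 (by omega)] at h5
    omega

/-- The partial closure of a truncation at or above a summit. -/
theorem isPartialClosure {A : AlgCat.{u} k} {N : LinearNakayama k A}
    (hB : IsBoundKupisch N.n m d N.soc) {s b : ℕ} (hs : s ≤ N.n) (hs' : N.soc s + (m + 1) = s)
    (hsb : s ≤ b) (hb : b ≤ N.n) (E : AlgCat.{u} k) (K : LinearNakayama k E) (hK : K.n = b)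
    (hsoc : ∀ c ≤ b, K.soc c = N.soc c) : IsPartialClosure k d E A := by
  induction hj : N.n - b generalizing b E with
  | zero =>
    obtain rfl : b = N.n := by omega
    refine .closed ⟨ModuleCat.of E (projCover K K.n), isPOmega_projCover K, ?_⟩
      (LinearNakayama.nonempty_algEquiv (N := N) K hK.symm fun c hc => (hsoc c hc).symm)
    refine (isInterval_projCover K.pos le_rfl).hasDClosedFactors_iff.mpr fun v _ hv => ?_
    rw [hK] at hv ⊢
    exact (hB.isClosedVertex hv).congr fun c hc => (hsoc c hc).symm
  | succ j ih =>
    subst hK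
    have hlt : K.n < N.n := by omega
    have h1 := N.isKupisch.mono (show K.n ≤ K.n + 1 by omega)
    have h2 := N.isKupisch.succ_lt K.pos
    have h3 := hsoc K.n le_rfl
    obtain ⟨z, hz⟩ := isInterval_projCover K.pos le_rfl
    -- The maximal submodule with closed factors ends just before the vertex `N.soc (K.n + 1)`. So
    -- the cliff module is exactly the radical of the projective module which `A` has at the next
    -- vertex.
    obtain ⟨w, hw⟩ := hz.isInterval_quotient (c := N.soc (K.n + 1)) (by omega) h2
    have hsoc' : ∀ v, IsClosedVertex K.n K.soc d v ↔ IsClosedVertex K.n N.soc d v := fun v =>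
      ⟨fun h => h.congr hsoc, fun h => h.congr fun c hc => (hsoc c hc).symm⟩
    refine .step (E := AlgCat.of k (OnePointExt k E
      (projCover K K.n ⧸ below E z (N.soc (K.n + 1))))) ⟨ModuleCat.of E _, ⟨ModuleCat.of E
      (projCover K K.n), below E z (N.soc (K.n + 1)), isPOmega_projCover K, ⟨?_, fun V hV hle => ?_⟩,
      ⟨LinearEquiv.refl E _⟩⟩, IsInterval.nontrivial ⟨w, hw⟩, ⟨AlgEquiv.refl⟩⟩
      (ih (b := K.n + 1) (by omega) hlt _ (onePointNakayama hw) rfl (fun c hc => ?_) (by omega))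
    · refine (hz.hasDClosedFactors_below_iff (by omega) h2.le).mpr fun v hv hv' => ?_
      rw [h3] at hv
      exact (hsoc' v).mpr (hB.isClosedVertex_of_lt hlt hv hv')
    · obtain ⟨e, he, he', rfl⟩ := hz.exists_eq_below V
      rw [hz.hasDClosedFactors_below_iff he he'] at hV
      refine below_mono ?_
      by_contra hcon
      exact hB.not_isClosedVertex hs hs' hsb hlt ((hsoc' _).mp (hV _ (by omega) (by omega)))
    · rcases hc.eq_or_lt with rfl | hc
      · exact onePointNakayama_soc_last hw
      · exact (onePointNakayama_soc hw (Nat.lt_succ_iff.mp hc)).trans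
          (hsoc c (Nat.lt_succ_iff.mp hc))

end IsBoundKupisch

/-- A non-zero map forces the top of the source to lie at or below the top of the target. Along this
stretch `L` grows by at most the number of vertices, so lengths do not decrease. -/
theorem LinearNakayama.isAscending (N : LinearNakayama k A)
    (h : ∀ b < N.n, N.soc (b + 1) ≤ N.soc b + 1) : IsAscending k A := by
  refine ⟨⟨N⟩, fun P P' hP hproj hP' hproj' ⟨f, hf⟩ => ?_⟩
  obtain ⟨x, y, hxy⟩ := exists_isInterval_of_isIndec N hP
  obtain ⟨x', y', hxy'⟩ := exists_isInterval_of_isIndec N hP'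
  have h1 := hxy.projective_iff.mp hproj
  have h2 := hxy'.projective_iff.mp hproj'
  rw [hxy.length_eq, hxy'.length_eq]
  have hlt := hxy.lt
  have hle' := hxy'.le
  obtain ⟨z, hz⟩ := hxy
  obtain ⟨w, hw⟩ := hxy'
  have h3 : y ≤ y' := by
    by_contra hcon
    refine hf (LinearMap.ext fun u => ?_)
    have h4 : ∀ t, t < y → f (z t) = 0 := fun t ht => by
      have h5 := hz.smul t (y - 1) (by omega) (by omega)
      rw [← h5, map_smul, hw.smul_eq_zero_of_mem_below le_rfl (by omega) (hw.mem_top _)]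
    obtain ⟨g, rfl⟩ := hz.exists_coeff le_rfl (hz.mem_top u)
    rw [map_sum, LinearMap.zero_apply]
    refine Finset.sum_eq_zero fun t ht => ?_
    rw [map_smul, h4 t (Finset.mem_range.mp ht), smul_zero]
  have h4 : ∀ j, y + j ≤ N.n → N.soc (y + j) ≤ N.soc y + j := by
    intro j
    induction j with
    | zero => intro _; rfl
    | succ j ih =>
      intro hj
      have := ih (by omega)
      have := h (y + j) (by omega)
      rw [← add_assoc]
      omega
  have h5 := h4 (y' - y) (by omega)
  rw [Nat.add_sub_cancel' h3] at h5
  exact_mod_cast (by omega : y - x ≤ y' - x')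

/-- Truncate at the summit `[a, a + m + 1)`. Below a summit the function is ascending, the summit
becomes `P(ω)`, and being projective it contributes the entry `0` at its only non-odd vertex. -/
theorem IsBoundKupisch.exists_isClosureOfAscent {A : AlgCat.{u} k} {N : LinearNakayama k A}
    (hB : IsBoundKupisch N.n m d N.soc) {a : ℕ} (ha : IsMinus N.n m N.soc a)
    (h1 : pdS N.soc (a + m) = 1) : ∃ l : List ℕ, l.length = m - 1 ∧ (∀ x ∈ l, Odd x ∧ x < d) ∧
      l.Pairwise (· < ·) ∧ IsClosureOfAscent k d (l ++ [0, 1]) A := by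
  have hm := hB.two_le
  have hle := ha.le
  have hsum : N.soc (a + m + 1) + (m + 1) = a + m + 1 := by rw [ha.eq]; ring
  have hmono : ∀ j i, i < j → j < m - 1 → pdS N.soc (a + i) < pdS N.soc (a + j) := by
    intro j i hij hj
    induction j with
    | zero => omega
    | succ j ih =>
      have h1 := ha.incr (a + j) (by omega) (by omega)
      rcases (Nat.lt_succ_iff.mp hij).eq_or_lt with rfl | h2
      · exact h1
      · exact (ih h2 (by omega)).trans h1
  refine ⟨(List.range (m - 1)).map fun i => pdS N.soc (a + i), by simp, ?_, ?_, ?_⟩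
  · intro x hx
    obtain ⟨i, hi, rfl⟩ := List.mem_map.mp hx
    rw [List.mem_range] at hi
    have := ha.odd (a + i) (by omega) (by omega)
    exact ⟨this, hB.pdS_lt_of_odd (by omega) this⟩
  · rw [List.pairwise_map]
    exact List.pairwise_lt_range.imp_of_mem fun {i j} _ hj hij =>
      hmono j i hij (List.mem_range.mp hj)
  · obtain ⟨E, K, hK, hsoc⟩ := exists_linearNakayama k N.isKupisch (n := a + m + 1) (by omega)
    refine ⟨E, ⟨K.isAscending fun b hb => ?_, ?_⟩,
      hB.isPartialClosure hle hsum le_rfl hle E K hK hsoc⟩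
    · rw [hsoc _ (by omega), hsoc _ (by omega)]
      exact hB.asc _ hle hsum b (by omega)
    · have hP := isInterval_projCover K.pos le_rfl
      refine ⟨ModuleCat.of E (projCover K K.n), isPOmega_projCover K, (hP.hasChar_iff _).mpr ?_⟩
      have hs : K.soc K.n = a := by rw [hK, hsoc _ le_rfl, ha.eq]
      have hpd : ∀ i ≤ m, pdS K.soc (a + i) = pdS N.soc (a + i) := fun i hi =>
        pdI_congr (fun c hc => hsoc c (by omega)) _
      have h0 : pdI K.soc (K.soc K.n) K.n = 0 := pdI_eq_zero le_rfl
      refine ⟨by simp; omega, fun i hi => ?_⟩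
      simp only [List.length_append, List.length_map, List.length_range, List.length_cons,
        List.length_nil] at hi
      rw [charEntry, h0, hs, hpd i (by omega)]
      rcases Nat.lt_or_ge i (m - 1) with h2 | h2
      · rw [List.getElem_append_left (by simpa using h2), if_pos (ha.odd _ (by omega) (by omega))]
        simp
      · rw [List.getElem_append_right (by simpa using h2)]
        have h3 : i = m - 1 ∨ i = m := by omega
        rcases h3 with rfl | rfl
        · rw [if_neg (Nat.not_odd_iff_even.mpr (ha.even _ (by omega)))]
          simp
        · rw [h1, if_pos odd_one]
          have : i - (i - 1) = 1 := by omega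
          simp [this]

end Nakayama

/-! ### Assembly of the equivalences and the counterexample. -/

namespace Nakayama

open CategoryTheory

theorem tfae_of_isDBound {k : Type u} [Field k] {d m : ℕ} (hd : Even d) (hm : 2 ≤ m)
    (A : AlgCat.{u} k) (hc : IsConcave k A) (hh : HasHeight A (m + 1)) (hb : IsDBound A d) :
    [ IsHigherAuslander A d,
      ∃ Y : ModuleCat.{u} A, IsPlusStrictlyIncreasing A Y ∧ Module.length A Y = m ∧
        pd A (socle A (Y ⧸ socle A Y)) = 1,
      ∃ Y : ModuleCat.{u} A, IsPlusStrictlyIncreasing A Y ∧ Module.length A Y = m,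
      ∃ Y : ModuleCat.{u} A, IsPlusStrictlyIncreasing A Y ∧ Module.length A Y = m ∧
        Module.Injective A Y,
      ∃ R : ModuleCat.{u} A, IsMinusStrictlyIncreasing A R ∧ Module.length A R = m ∧
        IsSummitRadical A R ∧ Module.Projective A R,
      ∃ R : ModuleCat.{u} A, IsMinusStrictlyIncreasing A R ∧ Module.length A R = m ∧
        IsSummitRadical A R,
      ∃ R : ModuleCat.{u} A, IsMinusStrictlyIncreasing A R ∧ Module.length A R = m ∧
        IsSummitRadical A R ∧ pd A (top A R) = ((d : ℕ∞) : WithBot ℕ∞),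
      ∃ c : List ℕ, c.length = m - 1 ∧ (∀ x ∈ c, Odd x ∧ x < d) ∧ c.Pairwise (· < ·) ∧
        IsClosureOfAscent k d (c ++ [0, 1]) A ].TFAE := by
  obtain ⟨N, hB⟩ := LinearNakayama.exists_isBoundKupisch hm hd hc hh hb
  have key := hB.tfae_combinatorial
  rw [hB.isHigherAuslander_iff hb, hB.plus_pd_iff, hB.plus_iff, hB.plus_injective_iff,
    hB.minus_projective_iff hh, hB.minus_iff hh, hB.minus_pd_iff hh]
  tfae_have 1 ↔ 2 := key.out 0 1
  tfae_have 1 ↔ 3 := key.out 0 2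
  tfae_have 1 ↔ 4 := key.out 0 3
  tfae_have 1 ↔ 5 := key.out 0 4
  tfae_have 1 ↔ 6 := key.out 0 5
  tfae_have 1 ↔ 7 := key.out 0 6
  tfae_have 5 → 8 := fun ⟨_, ha, h1⟩ => hB.exists_isClosureOfAscent ha h1
  tfae_have 8 → 5 := fun ⟨_, hl, ho, hp, h⟩ =>
    h.exists_isMinus N hm hl (fun x hx => (ho x hx).1) hp
  tfae_finish

section

variable {k A : Type u} [Field k] [Ring A] [Algebra k A] {d : ℕ}

/-- The global dimension is determined by the simple modules. -/
theorem gldim_le_of_pdS_le (N : LinearNakayama k A) (h : ∀ v < N.n, pdS N.soc v ≤ d) :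
    gldim A ≤ ((d : ℕ∞) : WithBot ℕ∞) := by
  refine iSup_le fun ⟨X, hX⟩ => ?_
  have := N.isArtinianRing
  have h1 : IsFiniteLength A X := isFiniteLength_iff_isNoetherian_isArtinian.mpr
    ⟨inferInstance, inferInstance⟩
  suffices ∀ (M : Type u) [AddCommGroup M] [Module A M], IsFiniteLength A M →
      HasProjectiveDimensionLT (ModuleCat.of A M) (d + 1) from (pd_le_iff d).mpr (this X h1)
  intro M _ _ hM
  induction hM with
  | of_subsingleton =>
    rename_i M _ _ _
    exact (pd_le_iff d).mp ((pd_eq_bot_iff.mpr inferInstance).le.trans bot_le)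
  | of_simple_quotient hV ih =>
    rename_i M _ _ V hS
    obtain ⟨v, hv⟩ := exists_isInterval_of_isSimpleModule (M := M ⧸ V) N
    refine (shortExact_quotient V).hasProjectiveDimensionLT_X₂ (d + 1) ih ((pd_le_iff d).mp ?_)
    rw [hv.pd_eq]
    exact_mod_cast h v hv.le

end

/-- The example has Kupisch series `(1, 2, 2, 3, 2)` with `d = m = 2`. Its simple modules have
projective dimensions `0, 1, 2, 1, 2`. The module `[2, 4)` has characteristic `(2, 1)` and is
plus-strictly-increasing, while all four modules of length two have projective dimension `0` or `2`.
-/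
theorem exists_isHigherAuslander_not_hasStrictlyIncreasingModule (k : Type u) [Field k] :
    ∃ (d m : ℕ) (A : AlgCat.{u} k), Even d ∧ 2 ≤ m ∧ IsConcave k A ∧ HasHeight A (m + 1) ∧
      IsDBound A d ∧ IsHigherAuslander A d ∧ ¬ HasStrictlyIncreasingModule A m := by
  let L : ℕ → ℕ := fun b => if b ≤ 2 then 0 else if b ≤ 4 then 1 else b - 2
  have hL : IsKupisch L := by
    refine ⟨fun a b hab => ?_, rfl, fun b hb => ?_⟩
    · simp only [L]
      split_ifs <;> omega
    · simp only [L]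
      split_ifs <;> omega
  obtain ⟨A, N, hn, hs⟩ := exists_linearNakayama k hL (n := 5) (by omega)
  have s1 : N.soc 1 = 0 := hs 1 (by omega)
  have s2 : N.soc 2 = 0 := hs 2 (by omega)
  have s3 : N.soc 3 = 1 := hs 3 (by omega)
  have s4 : N.soc 4 = 1 := hs 4 (by omega)
  have s5 : N.soc 5 = 3 := hs 5 (by omega)
  have p01 : pdI N.soc 0 1 = 0 := pdI_eq_zero (by omega)
  have p12 : pdI N.soc 1 2 = 1 := by rw [pdI_step (by omega) (by omega), s2, p01]
  have p23 : pdI N.soc 2 3 = 2 := by rw [pdI_step (by omega) (by omega), s3, p12]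
  have p13 : pdI N.soc 1 3 = 0 := pdI_eq_zero (by omega)
  have p34 : pdI N.soc 3 4 = 1 := by rw [pdI_step (by omega) (by omega), s4, p13]
  have p45 : pdI N.soc 4 5 = 2 := by rw [pdI_step (by omega) (by omega), s5, p34]
  have p02 : pdI N.soc 0 2 = 0 := pdI_eq_zero (by omega)
  have p24 : pdI N.soc 2 4 = 2 := by rw [pdI_step (by omega) (by omega), s4, p12]
  have p35 : pdI N.soc 3 5 = 0 := pdI_eq_zero (by omega)
  have hconc : IsConcave k A := by
    refine ⟨N, ⟨3, by omega⟩, ?_, ?_⟩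
    · rintro ⟨i, hi⟩ hi' ⟨j, hj⟩ hj' hij
      have h1 : i ≤ 3 := hi'
      have h2 : j ≤ 3 := hj'
      have h3 : i ≤ j := hij
      rw [N.kupisch_eq, N.kupisch_eq, Nat.cast_le]
      simp only
      interval_cases j <;> interval_cases i <;> simp [s1, s2, s3, s4]
    · rintro ⟨i, hi⟩ hi' ⟨j, hj⟩ hj' hij
      have h1 : 3 ≤ i := hi'
      have h2 : 3 ≤ j := hj'
      have h3 : i ≤ j := hij
      rw [hn] at hi hj
      rw [N.kupisch_eq, N.kupisch_eq, Nat.cast_le]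
      simp only
      interval_cases j <;> interval_cases i <;> simp_all
  have hheight : HasHeight A (2 + 1) := by
    constructor
    · have h1 := isInterval_projCover (N := N) (b := 4) (by omega) (by omega)
      refine ⟨ModuleCat.of A (projCover N 4), h1.isIndec, h1.length_eq.trans ?_⟩
      rw [s4]
    · rintro l ⟨M, hM, rfl⟩
      obtain ⟨a, b, hab⟩ := exists_isInterval_of_isIndec N hM
      have h1 := hab.soc_le
      have h2 := hab.le
      have h3 := hab.lt
      rw [hn] at h2
      rw [hab.length_eq]
      have h4 : b ≤ N.soc b + 3 := by
        interval_cases b <;> omega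
      exact_mod_cast (by omega : b - a ≤ 3)
  have hbound : IsDBound A 2 := by
    refine ⟨gldim_le_of_pdS_le N fun v hv => ?_, fun S hS => ?_⟩
    · rw [hn] at hv
      interval_cases v
      · exact p01.le.trans (by omega)
      · exact p12.le.trans (by omega)
      · exact p23.le
      · exact p34.le.trans (by omega)
      · exact p45.le
    · obtain ⟨v, hv⟩ := exists_isInterval_of_isSimpleModule (M := S) N
      rw [hv.isDClosedSimple_iff]
      have h1 := hv.le
      rw [hn] at h1 ⊢
      have h2 : v < 5 := h1
      interval_cases v
      · exact .inl ⟨1, by omega, by omega, s1⟩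
      · exact .inl ⟨3, by omega, by omega, s3⟩
      · exact .inr ⟨3, by omega, by omega, by omega, p23.ge⟩
      · exact .inl ⟨5, by omega, by omega, s5⟩
      · exact .inr ⟨5, by omega, by omega, by omega, p45.ge⟩
  refine ⟨2, 2, A, even_two, le_rfl, hconc, hheight, hbound, ?_, fun h => ?_⟩
  · refine ((tfae_of_isDBound even_two le_rfl A hconc hheight hbound).out 0 2).mpr ?_
    obtain ⟨Y, hY⟩ := exists_isInterval_of_soc_le (N := N) (a := 2) (b := 4) (by omega) (by omega)
      (by omega)
    refine ⟨Y, (hY.isPlusStrictlyIncreasing_iff (p := 2) (m := 2)).mpr ⟨by omega, ?_,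
      fun u h1 h2 => ?_, fun u h1 h2 => ?_, ?_, fun u h1 h2 => ?_⟩, hY.length_eq⟩
    · rw [pdS, p23]; exact even_two
    · obtain rfl : u = 3 := by omega
      rw [pdS, p34]; exact odd_one
    · omega
    · rw [p24]; exact even_two
    · obtain rfl : u = 3 := by omega
      rw [pdS, p34, p24]; omega
  · obtain ⟨p, h1, h2, -⟩ := h.exists_odd N
    rw [hn] at h1
    have h3 : p ≤ 3 := by omega
    refine Nat.not_even_iff_odd.mpr h2 ?_
    interval_cases p
    · rw [p02]; exact Even.zero
    · rw [p13]; exact Even.zero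
    · rw [p24]; exact even_two
    · rw [p35]; exact Even.zero

end Nakayama

theorem proposition8p6 (k : Type u) [Field k] :
    (∀ (d m : ℕ), Even d → 2 ≤ m → ∀ A : AlgCat.{u} k,
      Nakayama.IsConcave k A → Nakayama.HasHeight A (m + 1) → Nakayama.IsDBound A d →
      [ -- (1)
        Nakayama.IsHigherAuslander A d,
        -- (2)
        ∃ Y : ModuleCat.{u} A, Nakayama.IsPlusStrictlyIncreasing A Y ∧ Module.length A Y = m ∧
          -- `soc₂ Y / soc Y` is the socle of `Y / soc Y`
          Nakayama.pd A (Nakayama.socle A (Y ⧸ Nakayama.socle A Y)) = 1,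
        -- (2')
        ∃ Y : ModuleCat.{u} A, Nakayama.IsPlusStrictlyIncreasing A Y ∧ Module.length A Y = m,
        -- (2'')
        ∃ Y : ModuleCat.{u} A, Nakayama.IsPlusStrictlyIncreasing A Y ∧ Module.length A Y = m ∧
          Module.Injective A Y,
        -- (3)
        ∃ R : ModuleCat.{u} A, Nakayama.IsMinusStrictlyIncreasing A R ∧ Module.length A R = m ∧
          Nakayama.IsSummitRadical A R ∧ Module.Projective A R,
        -- (3')
        ∃ R : ModuleCat.{u} A, Nakayama.IsMinusStrictlyIncreasing A R ∧ Module.length A R = m ∧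
          Nakayama.IsSummitRadical A R,
        -- (3'')
        ∃ R : ModuleCat.{u} A, Nakayama.IsMinusStrictlyIncreasing A R ∧ Module.length A R = m ∧
          Nakayama.IsSummitRadical A R ∧
          Nakayama.pd A (Nakayama.top A R) = ((d : ℕ∞) : WithBot ℕ∞),
        -- (4)
        ∃ c : List ℕ, c.length = m - 1 ∧ (∀ x ∈ c, Odd x ∧ x < d) ∧ c.Pairwise (· < ·) ∧
          Nakayama.IsClosureOfAscent k d (c ++ [0, 1]) A ].TFAE ∧
      -- (5) is sufficient
      (Nakayama.HasStrictlyIncreasingModule A m → Nakayama.IsHigherAuslander A d)) ∧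
    -- (5) is not necessary
    (∃ (d m : ℕ) (A : AlgCat.{u} k), Even d ∧ 2 ≤ m ∧ Nakayama.IsConcave k A ∧
      Nakayama.HasHeight A (m + 1) ∧ Nakayama.IsDBound A d ∧ Nakayama.IsHigherAuslander A d ∧
      ¬ Nakayama.HasStrictlyIncreasingModule A m) := by
  refine ⟨fun d m hd hm A hc hh hb => ⟨Nakayama.tfae_of_isDBound hd hm A hc hh hb, fun h => ?_⟩,
    Nakayama.exists_isHigherAuslander_not_hasStrictlyIncreasingModule k⟩
  obtain ⟨N, hB⟩ := Nakayama.LinearNakayama.exists_isBoundKupisch hm hd hc hh hb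
  exact hB.isHigherAuslander_of_hasStrictlyIncreasingModule hb h
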